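/- Let $\mathcal A$ be a structure with a two-element domain $A$ and a finite signature, which may contain both function symbols and relation symbols (of arbitrary finite arities). An operation $f\colon A^k\to A$ is called essentially unary if it depends on at most one of its arguments (so constant operations are included). The problem $\mathrm{CSP}(\mathcal A)$ is: given a finite structure $\mathcal X$ of the same signature (encoded by the size of its domain and the tables of its operations and relations), decide whether there is a homomorphism $\mathcal X\to\mathcal A$. The structure $\mathrm{graph}(\mathcal A)$ is the relational structure on the domain $A$ with all relations of $\mathcal A$ and, for every $k$-ary basic operation $f$ of $\mathcal A$, the $(k+1)$-ary relation $\{(a_1,\dots,a_k,b) : f(a_1,\dots,a_k)=b\}$. 1. If all basic operations of $\mathcal A$ are essentially unary, then $\mathrm{CSP}(\mathcal A)$ and $\mathrm{CSP}(\mathrm{graph}(\mathcal A))$ are equivalent under polynomial-time many-one reductions. 2. If some basic operation of $\mathcal A$ is not essentially unary, then $\mathrm{CSP}(\mathcal A)$ is solvable in (deterministic) polynomial time. -/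

import Mathlib

/-! ### Decision problems, the class P and polynomial-time many-one reductions

Polynomial-time computability is Mathlib's `Turing.TM2ComputableInPolyTime`: a (multi-stack) Turing
machine which, started on the code of an instance, halts with the code of the value on its output
stack after at most polynomially many steps in the length of the input. -/

/-- A decision problem: a type of instances, an injective encoding of the instances as
bit strings, and the set of yes-instances. -/
structure DecisionProblem where
  Instance : Type
  encode : Instance → List Bool
  encode_injective : Function.Injective encode
  Yes : Instance → Prop

namespace DecisionProblem

open Classical in
/-- The problem is decided by a deterministic Turing machine in polynomial time. -/
def InP (P : DecisionProblem) : Prop :=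
  Nonempty (Turing.TM2ComputableInPolyTime P.encode Computability.encodeBool
    (fun I : P.Instance => decide (P.Yes I)))

/-- Polynomial-time many-one (Karp) reducibility. -/
def ManyOneReducible (P Q : DecisionProblem) : Prop :=
  ∃ f : P.Instance → Q.Instance,
    Nonempty (Turing.TM2ComputableInPolyTime P.encode Q.encode f) ∧
      ∀ I, P.Yes I ↔ Q.Yes (f I)

/-- Equivalence under polynomial-time many-one reductions. -/
def PolyTimeEquivalent (P Q : DecisionProblem) : Prop :=
  P.ManyOneReducible Q ∧ Q.ManyOneReducible P

end DecisionProblem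

/-! ### Essentially unary operations -/

/-- `f` depends on its `i`-th argument: changing only that argument can change the value. -/
def DependsOnArg {A : Type*} {k : ℕ} (f : (Fin k → A) → A) (i : Fin k) : Prop :=
  ∃ (x : Fin k → A) (a : A), f (Function.update x i a) ≠ f x

/-- `f` depends on at most one of its arguments (constant operations included). -/
def EssentiallyUnary {A : Type*} {k : ℕ} (f : (Fin k → A) → A) : Prop :=
  ∀ i j : Fin k, DependsOnArg f i → DependsOnArg f j → i = j

/-! ### The graph of a structure -/



/-- The relation symbols of the graph signature: those of `L`, and a `(k+1)`-ary symbol `G_f` for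
every `k`-ary function symbol `f` of `L`. -/
inductive GraphRel (L : FirstOrder.Language.{0, 0}) : ℕ → Type
  | rel {k : ℕ} (R : L.Relations k) : GraphRel L k
  | graph {k : ℕ} (f : L.Functions k) : GraphRel L (k + 1)

/-- The (purely relational) signature of graphs of `L`-structures. -/
def graphLanguage (L : FirstOrder.Language.{0, 0}) : FirstOrder.Language.{0, 0} where
  Functions := fun _ => Empty
  Relations := GraphRel L

/-- The interpretation of the graph signature in an `L`-structure. -/
def graphRelMap (L : FirstOrder.Language.{0, 0}) (A : Type*) [L.Structure A] :
    {k : ℕ} → GraphRel L k → (Fin k → A) → Prop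
  | _, .rel R, x => FirstOrder.Language.Structure.RelMap R x
  | _, .graph (k := k) f, x =>
      FirstOrder.Language.Structure.funMap f (fun i : Fin k => x i.castSucc) = x (Fin.last k)

/-- The graph of the `L`-structure `A`, a structure on the same domain. -/
instance graphStructure (L : FirstOrder.Language.{0, 0}) (A : Type*) [L.Structure A] :
    (graphLanguage L).Structure A where
  funMap := fun f => f.elim
  RelMap := fun R => graphRelMap L A R

instance graphLanguage_finite (L : FirstOrder.Language.{0, 0}) [Finite L.Symbols] :
    Finite (graphLanguage L).Symbols := by
  let g : L.Symbols → (graphLanguage L).Symbols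
    | .inl ⟨k, f⟩ => .inr ⟨k + 1, GraphRel.graph f⟩
    | .inr ⟨k, R⟩ => .inr ⟨k, GraphRel.rel R⟩
  refine Finite.of_surjective g ?_
  rintro (⟨_, f⟩ | ⟨_, R⟩)
  · exact f.elim
  · cases R with
    | rel R => exact ⟨.inr ⟨_, R⟩, rfl⟩
    | graph f => exact ⟨.inl ⟨_, f⟩, rfl⟩

/-! ### Finite structures as instances, and their encoding -/

/-- A finite `L`-structure; its domain is `{0, …, size - 1}`. -/
structure FiniteStructure (L : FirstOrder.Language.{0, 0}) where
  size : ℕ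
  str : L.Structure (Fin size)

attribute [instance] FiniteStructure.str

/-- A list of natural numbers as a bit string: each number is written in unary, followed by
the terminator `false`. -/
def unaryEncode (l : List ℕ) : List Bool :=
  l.flatMap fun m => List.replicate m true ++ [false]

noncomputable section

/-- A fixed listing of the function symbols of a finite signature. -/
def functionSymbols (L : FirstOrder.Language.{0, 0}) [Finite L.Symbols] : List (Σ k, L.Functions k) :=
  (Set.finite_univ_iff.2 (Finite.of_injective (Sum.inl : _ → L.Symbols)
    Sum.inl_injective)).toFinset.toList

/-- A fixed listing of the relation symbols of a finite signature. -/
def relationSymbols (L : FirstOrder.Language.{0, 0}) [Finite L.Symbols] : List (Σ k, L.Relations k) :=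
  (Set.finite_univ_iff.2 (Finite.of_injective (Sum.inr : _ → L.Symbols)
    Sum.inr_injective)).toFinset.toList

namespace FiniteStructure

variable {L : FirstOrder.Language.{0, 0}}

/-- The value table of the `k`-ary operation `f`: its `n ^ k` values, the value at the tuple `a`
being at position `∑ i, a i * n ^ i`. -/
def functionTable (X : FiniteStructure L) (f : Σ k, L.Functions k) : List ℕ :=
  List.ofFn fun j : Fin (X.size ^ f.1) =>
    (FirstOrder.Language.Structure.funMap f.2 (finFunctionFinEquiv.symm j) : Fin X.size).val

open Classical in
/-- The characteristic table (zeros and ones) of the `k`-ary relation `R`, in the same order. -/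
def relationTable (X : FiniteStructure L) (R : Σ k, L.Relations k) : List ℕ :=
  List.ofFn fun j : Fin (X.size ^ R.1) =>
    if FirstOrder.Language.Structure.RelMap R.2 (finFunctionFinEquiv.symm j : Fin R.1 → Fin X.size)
    then 1 else 0

/-- The code of a finite structure: the size of its domain followed by the tables of all its
basic operations and relations. -/
def encode [Finite L.Symbols] (X : FiniteStructure L) : List Bool :=
  unaryEncode (X.size ::
    ((functionSymbols L).flatMap X.functionTable ++ (relationSymbols L).flatMap X.relationTable))

end FiniteStructure

theorem mem_functionSymbols (L : FirstOrder.Language.{0, 0}) [Finite L.Symbols] (f : Σ k, L.Functions k) :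
    f ∈ functionSymbols L := by
  simp [functionSymbols]

theorem mem_relationSymbols (L : FirstOrder.Language.{0, 0}) [Finite L.Symbols] (R : Σ k, L.Relations k) :
    R ∈ relationSymbols L := by
  simp [relationSymbols]

theorem unaryEncode_injective : Function.Injective unaryEncode := by
  have key : ∀ (a b : ℕ) (u v : List Bool),
      List.replicate a true ++ false :: u = List.replicate b true ++ false :: v →
        a = b ∧ u = v := by
    intro a
    induction a with
    | zero =>
      rintro (_ | b) u v h
      · simpa using h
      · simp [List.replicate_succ] at h
    | succ a ih =>
      rintro (_ | b) u v h
      · simp [List.replicate_succ] at h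
      · have := ih b u v (by simpa [List.replicate_succ] using h)
        exact ⟨by rw [this.1], this.2⟩
  intro l
  induction l with
  | nil =>
    rintro (_ | ⟨b, l'⟩) h
    · rfl
    · simp [unaryEncode] at h
  | cons a l ih =>
    rintro (_ | ⟨b, l'⟩) h
    · simp [unaryEncode] at h
    · obtain ⟨h1, h2⟩ := key a b (unaryEncode l) (unaryEncode l')
        (by simpa [unaryEncode] using h)
      rw [h1, ih h2]

theorem flatMap_eq_of_length_eq {α β : Type*} {s t : α → List β}
    (hlen : ∀ a, (s a).length = (t a).length) :
    ∀ l : List α, l.flatMap s = l.flatMap t → ∀ a ∈ l, s a = t a := by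
  intro l
  induction l with
  | nil => simp
  | cons b l ih =>
    intro h a ha
    rw [List.flatMap_cons, List.flatMap_cons] at h
    obtain ⟨h1, h2⟩ := List.append_inj h (hlen b)
    rcases List.mem_cons.1 ha with rfl | ha
    · exact h1
    · exact ih h2 a ha

theorem FiniteStructure.encode_injective (L : FirstOrder.Language.{0, 0}) [Finite L.Symbols] :
    Function.Injective (FiniteStructure.encode (L := L)) := by
  rintro ⟨n, s⟩ ⟨m, t⟩ h
  obtain ⟨h0, h1⟩ := List.cons.inj (unaryEncode_injective h)
  have hnm : n = m := h0
  subst hnm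
  obtain ⟨hf, hr⟩ := List.append_inj h1 (by simp [FiniteStructure.functionTable])
  congr 1
  apply FirstOrder.Language.Structure.ext
  · funext k f x
    have := flatMap_eq_of_length_eq (by simp [FiniteStructure.functionTable]) _ hf ⟨k, f⟩
      (mem_functionSymbols L _)
    have := congrFun (List.ofFn_injective this) (finFunctionFinEquiv x)
    simp only [Equiv.symm_apply_apply] at this
    exact Fin.ext this
  · funext k R x
    have := flatMap_eq_of_length_eq (by simp [FiniteStructure.relationTable]) _ hr ⟨k, R⟩
      (mem_relationSymbols L _)
    have := congrFun (List.ofFn_injective this) (finFunctionFinEquiv x)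
    have e : finFunctionFinEquiv.symm (finFunctionFinEquiv x) = x := Equiv.symm_apply_apply _ _
    rw [e] at this
    apply propext
    split_ifs at this with h1 h2 h2
    · exact ⟨fun _ => h2, fun _ => h1⟩
    · exact ⟨fun h => absurd h h1, fun h => absurd h h2⟩

/-- The constraint satisfaction problem with template `A`: given a finite `L`-structure `X`,
decide whether there is a homomorphism from `X` to `A`. -/
def CSP (L : FirstOrder.Language.{0, 0}) [Finite L.Symbols] (A : Type*) [L.Structure A] :
    DecisionProblem where
  Instance := FiniteStructure L
  encode := FiniteStructure.encode
  encode_injective := FiniteStructure.encode_injective L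
  Yes := fun X => Nonempty (FirstOrder.Language.Hom L (Fin X.size) A)

end

/-!
# Constraint satisfaction over two-element structures with operations

**Polynomial time.** Machines are programmed through a small tower of languages. Structured programs
on stacks compile to Turing machines (`StackProg.computable_of_exec`). Formulas with polynomially
bounded quantifiers and arrays defined by recursion compile to such programs with polynomial running
time (`StackProg.Form.runs_code`), and so do output programs (`StackProg.Out.computable`).
`PolyTime.PTPred`, `PolyTime.PTFun` and `PolyTime.PTStr` are the predicates, number functions and
strings defined in this way; they are closed under bounded quantification, arithmetic, least fixed
points (`PolyTime.PTPred.lfp`) and bounded recursion (`PolyTime.PTFun.natRec`). After this it is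
enough to define the reductions and the decision procedure by formulas. A homomorphism to a
two-element structure is treated as a predicate on the elements (`PolyTime.IsHom`).

**Essentially unary operations.** A homomorphism from `X` to `A` is the same as a homomorphism from
the graph of `X` to the graph of `A`, which gives one reduction. For the other one, let `X` be an
instance over the graph signature. Every basic operation of `A` is a constant, a projection or a
negated projection. So the value of an operation at elements of `X`, as required by a homomorphism,
is already represented by a signed element: an element of `X` or the constant `False`, possibly
negated. Each tuple in the relation for the graph of an operation forces an equality of signed
elements. The signed elements modulo the equivalence relation generated by these equalities carry the
operations and relations of an instance over the original signature (`PolyTime.collapse`), and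
homomorphisms correspond (`PolyTime.nonempty_hom_collapse`). The equivalence relation is a least fixed
point.

**Other operations.** An operation that is not essentially unary has a binary restriction that
depends on both arguments (`exists_dependsOnBoth`), and a nonconstant homomorphism provides elements
`u`, `v` of the instance that can be put in place of the constants. A binary operation on truth values
that depends on both arguments generates a conjunction or disjunction, or it is addition modulo two,
possibly with a constant added (`PolyTime.conjunction_or_addition`). In both cases the instance has
only polynomially many candidates for a homomorphism, and these can be listed:

* With a conjunction, the preimage of true is closed under products and factors, hence it consists of
  the elements above the product of all its elements (`PolyTime.exists_eq_above`); disjunctions are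
  dual.
* With an addition `t`, choose greedily elements, the pivots, that do not lie in the affine hull
  generated by the earlier elements. A new pivot `p` at least doubles the number of elements of the
  hull modulo the equality forced by cancellation, because `x ↦ t p x` maps the hull injectively to
  its complement. So the number of sets of pivots is at most the number of elements
  (`PolyTime.weight_le`), and a homomorphism is determined by the set of pivots mapped to true
  (`PolyTime.exists_values`).
-/


/-! ### Structured programs on stacks -/

namespace StackProg

/-- Structured programs acting on stacks of bits, the stacks being numbered by `ℕ`. -/
inductive Cmd : Type
  | skip : Cmd
  | push (k : ℕ) (b : Bool) : Cmd
  | pop (k : ℕ) : Cmd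
  | seq (c d : Cmd) : Cmd
  /-- Continue according to whether stack `k` is empty, has top `false`, or has top `true`. -/
  | case (k : ℕ) (cn cf ct : Cmd) : Cmd
  /-- Repeat the body as long as stack `k` is nonempty. -/
  | loop (k : ℕ) (c : Cmd) : Cmd

/-- The contents of all stacks. -/
abbrev Store := ℕ → List Bool

/-- Big-step semantics: `Exec c s t s'` says that `c`, started in `s`, terminates in `s'` after
exactly `t` elementary steps. -/
inductive Exec : Cmd → Store → ℕ → Store → Prop
  | skip (s) : Exec .skip s 1 s
  | push (k b s) : Exec (.push k b) s 1 (Function.update s k (b :: s k))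
  | pop (k s) : Exec (.pop k) s 1 (Function.update s k (s k).tail)
  | seq {c d s t s' t' s''} : Exec c s t s' → Exec d s' t' s'' → Exec (.seq c d) s (t + t') s''
  | case_nil {k cn cf ct s t s'} : s k = [] → Exec cn s t s' →
      Exec (.case k cn cf ct) s (1 + t) s'
  | case_false {k cn cf ct s t s' l} : s k = false :: l → Exec cf s t s' →
      Exec (.case k cn cf ct) s (1 + t) s'
  | case_true {k cn cf ct s t s' l} : s k = true :: l → Exec ct s t s' →
      Exec (.case k cn cf ct) s (1 + t) s'
  | loop_nil {k c s} : s k = [] → Exec (.loop k c) s 1 s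
  | loop_cons {k c s b l t s' t' s''} : s k = b :: l → Exec c s t s' →
      Exec (.loop k c) s' t' s'' → Exec (.loop k c) s (1 + (t + t')) s''

/-! ### Compilation of stack programs to Turing machines -/

/-- The control points of a program. -/
def Lab : Cmd → Type
  | .skip => Unit
  | .push _ _ => Unit
  | .pop _ => Unit
  | .seq c d => Lab c ⊕ Lab d
  | .case _ cn cf ct => Unit ⊕ (Lab cn ⊕ (Lab cf ⊕ Lab ct))
  | .loop _ c => Unit ⊕ Lab c

/-- A program has finitely many control points. -/
@[reducible] def labFintype : (c : Cmd) → Fintype (Lab c)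
  | .skip => inferInstanceAs (Fintype Unit)
  | .push _ _ => inferInstanceAs (Fintype Unit)
  | .pop _ => inferInstanceAs (Fintype Unit)
  | .seq c d => @instFintypeSum _ _ (labFintype c) (labFintype d)
  | .case _ cn cf ct =>
      @instFintypeSum _ _ _ (@instFintypeSum _ _ (labFintype cn)
        (@instFintypeSum _ _ (labFintype cf) (labFintype ct)))
  | .loop _ c => @instFintypeSum _ _ _ (labFintype c)

/-- The control point at which a program starts. -/
def entry : (c : Cmd) → Lab c
  | .skip => ()
  | .push _ _ => ()
  | .pop _ => ()
  | .seq c _ => Sum.inl (entry c)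
  | .case _ _ _ _ => Sum.inl ()
  | .loop _ _ => Sum.inl ()

/-- A bound on the numbers of the stacks that a program uses. -/
def maxStack : Cmd → ℕ
  | .skip => 0
  | .push k _ => k
  | .pop k => k
  | .seq c d => max (maxStack c) (maxStack d)
  | .case k cn cf ct => max k (max (maxStack cn) (max (maxStack cf) (maxStack ct)))
  | .loop k c => max k (maxStack c)

open Turing in
/-- The machine statement at each control point. The control points are embedded in the labels
of the machine by `emb`, and the machine continues at label `ex` after the program. The internal
state of the machine holds the bit read last. -/
def trans {B : ℕ} {Λ : Type} : (c : Cmd) → (Lab c → Λ) → Λ → Lab c →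
    TM2.Stmt (fun _ : Fin (B + 1) => Bool) Λ (Option Bool)
  | .skip, _, ex, _ => .goto fun _ => ex
  | .push k b, _, ex, _ => .push (Fin.ofNat (B + 1) k) (fun _ => b) (.goto fun _ => ex)
  | .pop k, _, ex, _ => .pop (Fin.ofNat (B + 1) k) (fun _ o => o) (.goto fun _ => ex)
  | .seq c d, emb, _, .inl l => trans c (emb ∘ .inl) (emb (.inr (entry d))) l
  | .seq _ d, emb, ex, .inr l => trans d (emb ∘ .inr) ex l
  | .case k cn cf ct, emb, _, .inl _ =>
      .peek (Fin.ofNat (B + 1) k) (fun _ o => o) (.goto fun v => match v with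
        | none => emb (.inr (.inl (entry cn)))
        | some false => emb (.inr (.inr (.inl (entry cf))))
        | some true => emb (.inr (.inr (.inr (entry ct)))))
  | .case _ cn _ _, emb, ex, .inr (.inl l) => trans cn (emb ∘ .inr ∘ .inl) ex l
  | .case _ _ cf _, emb, ex, .inr (.inr (.inl l)) => trans cf (emb ∘ .inr ∘ .inr ∘ .inl) ex l
  | .case _ _ _ ct, emb, ex, .inr (.inr (.inr l)) => trans ct (emb ∘ .inr ∘ .inr ∘ .inr) ex l
  | .loop k c, emb, ex, .inl _ =>
      .peek (Fin.ofNat (B + 1) k) (fun _ o => o) (.goto fun v => match v with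
        | none => ex
        | some _ => emb (.inr (entry c)))
  | .loop _ c, emb, _, .inr l => trans c (emb ∘ .inr) (emb (.inl ())) l

/-- The first `B + 1` stacks of a store. -/
def restrict (B : ℕ) (s : Store) : Fin (B + 1) → List Bool := fun i => s i

theorem restrict_ofNat {B k : ℕ} (h : k ≤ B) (s : Store) :
    restrict B s (Fin.ofNat (B + 1) k) = s k := by
  simp [restrict, Fin.ofNat, Nat.mod_eq_of_lt (Nat.lt_succ_of_le h)]

/-- The stacks modulo `B + 1` do not collide as long as only the first `B + 1` stacks are used. -/
theorem restrict_update {B k : ℕ} (h : k ≤ B) (s : Store) (x : List Bool) :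
    restrict B (Function.update s k x) =
      Function.update (restrict B s) (Fin.ofNat (B + 1) k) x := by
  funext i
  have : i = Fin.ofNat (B + 1) k ↔ (i : ℕ) = k := by
    simp [Fin.ext_iff, Nat.mod_eq_of_lt (Nat.lt_succ_of_le h)]
  by_cases hi : (i : ℕ) = k
  · rw [this.2 hi]; simp [restrict, Function.update, Nat.mod_eq_of_lt (Nat.lt_succ_of_le h)]
  · rw [Function.update_of_ne (fun h => hi (this.1 h))]
    simp [restrict, Function.update_of_ne hi]

/-- The machine `m` goes from configuration `a` to configuration `b` in exactly `n` steps. -/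
def Steps {B : ℕ} {Λ : Type} (m : Λ → Turing.TM2.Stmt (fun _ : Fin (B + 1) => Bool) Λ
    (Option Bool)) (n : ℕ) (a b : Turing.TM2.Cfg (fun _ : Fin (B + 1) => Bool) Λ
    (Option Bool)) : Prop :=
  (flip bind (Turing.TM2.step m))^[n] (some a) = some b

section Steps

variable {B : ℕ} {Λ : Type} {m : Λ → Turing.TM2.Stmt (fun _ : Fin (B + 1) => Bool) Λ
  (Option Bool)} {a b c : Turing.TM2.Cfg (fun _ : Fin (B + 1) => Bool) Λ (Option Bool)}

theorem Steps.trans {i j : ℕ} (h : Steps m i a b) (h' : Steps m j b c) : Steps m (i + j) a c := by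
  unfold Steps at *
  rw [Nat.add_comm i j, Function.iterate_add_apply, h, h']

theorem Steps.one {l : Λ} {v : Option Bool} {S : Fin (B + 1) → List Bool}
    (h : Turing.TM2.stepAux (m l) v S = b) : Steps m 1 ⟨some l, v, S⟩ b := by
  rw [← h]; rfl

/-- A machine with the code of `c` in it executes `c`, step by step. -/
theorem Exec.steps {c : Cmd} {s s' : Store} {t : ℕ} (h : Exec c s t s')
    (hB : maxStack c ≤ B) (emb : Lab c → Λ) (ex : Λ)
    (hm : ∀ l, m (emb l) = trans c emb ex l) (v : Option Bool) :
    ∃ v', Steps m t ⟨some (emb (entry c)), v, restrict B s⟩ ⟨some ex, v', restrict B s'⟩ := by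
  induction h generalizing ex v with
  | skip s => exact ⟨v, Steps.one (by rw [hm]; rfl)⟩
  | push k b s =>
    have hB : k ≤ B := hB
    refine ⟨v, Steps.one ?_⟩
    rw [hm, restrict_update hB, ← restrict_ofNat hB s]; rfl
  | pop k s =>
    have hB : k ≤ B := hB
    refine ⟨(s k).head?, Steps.one ?_⟩
    rw [hm, restrict_update hB, ← restrict_ofNat hB s]; rfl
  | seq h1 h2 ih1 ih2 =>
    simp only [maxStack, max_le_iff] at hB
    obtain ⟨v1, e1⟩ := ih1 hB.1 (emb ∘ .inl) _ (fun l => hm (.inl l)) v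
    obtain ⟨v2, e2⟩ := ih2 hB.2 (emb ∘ .inr) _ (fun l => hm (.inr l)) v1
    exact ⟨v2, e1.trans e2⟩
  | case_nil hk h1 ih =>
    simp only [maxStack, max_le_iff] at hB
    obtain ⟨v1, e1⟩ := ih hB.2.1 (emb ∘ .inr ∘ .inl) _ (fun l => hm (.inr (.inl l))) none
    refine ⟨v1, Steps.trans (Steps.one ?_) e1⟩
    rw [hm]
    simp [entry, StackProg.trans, restrict_ofNat hB.1, hk, -Fin.ofNat_eq_cast]
    rfl
  | case_false hk h1 ih =>
    simp only [maxStack, max_le_iff] at hB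
    obtain ⟨v1, e1⟩ := ih hB.2.2.1 (emb ∘ .inr ∘ .inr ∘ .inl) _
      (fun l => hm (.inr (.inr (.inl l)))) (some false)
    refine ⟨v1, Steps.trans (Steps.one ?_) e1⟩
    rw [hm]
    simp [entry, StackProg.trans, restrict_ofNat hB.1, hk, -Fin.ofNat_eq_cast]
    rfl
  | case_true hk h1 ih =>
    simp only [maxStack, max_le_iff] at hB
    obtain ⟨v1, e1⟩ := ih hB.2.2.2 (emb ∘ .inr ∘ .inr ∘ .inr) _
      (fun l => hm (.inr (.inr (.inr l)))) (some true)
    refine ⟨v1, Steps.trans (Steps.one ?_) e1⟩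
    rw [hm]
    simp [entry, StackProg.trans, restrict_ofNat hB.1, hk, -Fin.ofNat_eq_cast]
    rfl
  | loop_nil hk =>
    refine ⟨none, Steps.one ?_⟩
    simp only [maxStack, max_le_iff] at hB
    rw [hm]
    simp [entry, StackProg.trans, restrict_ofNat hB.1, hk, -Fin.ofNat_eq_cast]
  | @loop_cons k c s b l t s' t' s'' hk h1 h2 ih1 ih2 =>
    have hB' := hB
    simp only [maxStack, max_le_iff] at hB
    obtain ⟨v1, e1⟩ := ih1 hB.2 (emb ∘ .inr) _ (fun l => hm (.inr l)) (some b)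
    obtain ⟨v2, e2⟩ := ih2 hB' emb _ hm v1
    refine ⟨v2, Steps.trans (Steps.one ?_) (e1.trans e2)⟩
    rw [hm]
    simp [entry, StackProg.trans, restrict_ofNat hB.1, hk, -Fin.ofNat_eq_cast]
    rfl

end Steps

/-- The Turing machine running the program `c`, with input stack `i` and output stack `o`. -/
def machine (c : Cmd) (i o : ℕ) : Turing.FinTM2 where
  K := Fin (max (maxStack c) (max i o) + 1)
  k₀ := Fin.ofNat _ i
  k₁ := Fin.ofNat _ o
  Γ := fun _ => Bool
  Λ := Option (Lab c)
  main := some (entry c)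
  ΛFin := @instFintypeOption _ (labFintype c)
  σ := Option Bool
  initialState := none
  Γk₀Fin := inferInstanceAs (Fintype Bool)
  m := fun l => match l with
    | none => .load (fun _ => none) .halt
    | some l => trans c some none l

/-- The store with `w` on stack `i`, all other stacks being empty. -/
def single (i : ℕ) (w : List Bool) : Store := Function.update (fun _ => []) i w

theorem single_restrict {B i : ℕ} (h : i ≤ B) (w : List Bool) :
    restrict B (single i w) = Function.update (fun _ => []) (Fin.ofNat (B + 1) i) w := by
  rw [single, restrict_update h]; rfl

/-- A program that maps the code of every instance to the code of the value within polynomial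
time yields polynomial-time computability by Turing machines. -/
theorem computable_of_exec {α β : Type} (ea : α → List Bool) (eb : β → List Bool) (f : α → β)
    (c : Cmd) (i o : ℕ) (p : Polynomial ℕ)
    (h : ∀ a, ∃ t ≤ p.eval (ea a).length, Exec c (single i (ea a)) t (single o (eb (f a)))) :
    Nonempty (Turing.TM2ComputableInPolyTime ea eb f) := by
  refine ⟨{ tm := machine c i o
            inputAlphabet := Equiv.refl _
            outputAlphabet := Equiv.refl _
            time := p + 1
            outputsFun := fun a => ?_ }⟩
  have h1 := h a
  refine Classical.choice ?_
  obtain ⟨t, ht, h2⟩ := h1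
  obtain ⟨v, hv⟩ := h2.steps (B := max (maxStack c) (max i o)) (m := (machine c i o).m)
    (by simp) some none (fun l => rfl) none
  refine ⟨⟨⟨1 + t, ?_⟩, ?_⟩⟩
  · have e0 : Turing.initList (machine c i o) (List.map (Equiv.refl Bool).invFun (ea a)) =
        ⟨some (some (entry c)), none, restrict _ (single i (ea a))⟩ := by
      rw [single_restrict (by simp), Turing.initList]
      congr 1
      funext k
      by_cases hk : k = Fin.ofNat (max (maxStack c) (max i o) + 1) i
      · subst hk; simp [machine]; rfl
      · exact (dif_neg hk).trans (Function.update_of_ne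
          (β := fun _ : Fin (max (maxStack c) (max i o) + 1) => List Bool) hk _ (fun _ => [])).symm
    have e1 : Turing.haltList (machine c i o) (List.map (Equiv.refl Bool).invFun (eb (f a))) =
        ⟨none, none, restrict _ (single o (eb (f a)))⟩ := by
      rw [single_restrict (by simp), Turing.haltList]
      congr 1
      funext k
      by_cases hk : k = Fin.ofNat (max (maxStack c) (max i o) + 1) o
      · subst hk; simp [machine]; rfl
      · exact (dif_neg hk).trans (Function.update_of_ne
          (β := fun _ : Fin (max (maxStack c) (max i o) + 1) => List Bool) hk _ (fun _ => [])).symm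
    rw [Function.iterate_add_apply]
    erw [e0]
    have hv' := hv
    unfold Steps at hv'
    erw [hv']
    simp only [Option.map_some]
    erw [e1]
    rfl
  · simp; omega

end StackProg

/-! ### Running times and basic routines -/

namespace StackProg

/-- `c`, started in `s`, terminates in `s'` within `T` steps. -/
def Runs (c : Cmd) (s : Store) (T : ℕ) (s' : Store) : Prop := ∃ t ≤ T, Exec c s t s'

theorem Runs.mono {c s T T' s'} (h : Runs c s T s') (hT : T ≤ T') : Runs c s T' s' :=
  let ⟨t, ht, h⟩ := h; ⟨t, ht.trans hT, h⟩

theorem Runs.conv {c s T T' s' s''} (h : Runs c s T s') (hT : T ≤ T') (hs : s' = s'') :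
    Runs c s T' s'' := hs ▸ h.mono hT

theorem Runs.skip (s) : Runs .skip s 1 s := ⟨1, le_rfl, .skip s⟩

theorem Runs.push (k b s) : Runs (.push k b) s 1 (Function.update s k (b :: s k)) :=
  ⟨1, le_rfl, .push k b s⟩

theorem Runs.pop (k s) : Runs (.pop k) s 1 (Function.update s k (s k).tail) :=
  ⟨1, le_rfl, .pop k s⟩

theorem Runs.seq {c d s T s' T' s''} (h : Runs c s T s') (h' : Runs d s' T' s'') :
    Runs (.seq c d) s (T + T') s'' :=
  let ⟨_, ht, h⟩ := h
  let ⟨_, ht', h'⟩ := h'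
  ⟨_, add_le_add ht ht', h.seq h'⟩

theorem Runs.case_nil {k cn cf ct s T s'} (hk : s k = []) (h : Runs cn s T s') :
    Runs (.case k cn cf ct) s (1 + T) s' :=
  let ⟨_, ht, h⟩ := h; ⟨_, by omega, .case_nil hk h⟩

theorem Runs.case_false {k cn cf ct s T s' l} (hk : s k = false :: l) (h : Runs cf s T s') :
    Runs (.case k cn cf ct) s (1 + T) s' :=
  let ⟨_, ht, h⟩ := h; ⟨_, by omega, .case_false hk h⟩

theorem Runs.case_true {k cn cf ct s T s' l} (hk : s k = true :: l) (h : Runs ct s T s') :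
    Runs (.case k cn cf ct) s (1 + T) s' :=
  let ⟨_, ht, h⟩ := h; ⟨_, by omega, .case_true hk h⟩

theorem Runs.loop_nil {k c s} (hk : s k = []) : Runs (.loop k c) s 1 s :=
  ⟨1, le_rfl, .loop_nil hk⟩

theorem Runs.loop_cons {k c s b l T s' T' s''} (hk : s k = b :: l) (h : Runs c s T s')
    (h' : Runs (.loop k c) s' T' s'') : Runs (.loop k c) s (1 + (T + T')) s'' :=
  let ⟨_, ht, h⟩ := h
  let ⟨_, ht', h'⟩ := h'
  ⟨_, by omega, .loop_cons hk h h'⟩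

/-- A loop that runs through the stores `σ 0, …, σ m`. -/
theorem Runs.loop_iter {k : ℕ} {c : Cmd} (σ : ℕ → Store) (m T : ℕ)
    (hne : ∀ i < m, σ i k ≠ []) (hend : σ m k = [])
    (hb : ∀ i < m, Runs c (σ i) T (σ (i + 1))) :
    Runs (.loop k c) (σ 0) (m * (T + 1) + 1) (σ m) := by
  have key : ∀ j ≤ m, Runs (.loop k c) (σ (m - j)) (j * (T + 1) + 1) (σ m) := by
    intro j
    induction j with
    | zero => intro _; simpa using Runs.loop_nil hend
    | succ j ih =>
      intro hj
      obtain ⟨b, l, hbl⟩ := List.exists_cons_of_ne_nil (hne (m - (j + 1)) (by omega))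
      have h1 := hb (m - (j + 1)) (by omega)
      rw [show m - (j + 1) + 1 = m - j by omega] at h1
      exact (Runs.loop_cons hbl h1 (ih (by omega))).mono (by ring_nf; omega)
  simpa using key m le_rfl

/-- Pop everything from stack `a` and push it onto stack `b`. -/
def pour (a b : ℕ) : Cmd :=
  .loop a (.case a .skip (.seq (.pop a) (.push b false)) (.seq (.pop a) (.push b true)))

/-- Pouring a stack onto another one reverses it. -/
theorem runs_pour {a b : ℕ} (hab : a ≠ b) (s : Store) :
    Runs (pour a b) s (4 * (s a).length + 1)
      (Function.update (Function.update s a []) b ((s a).reverse ++ s b)) := by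
  generalize hl : s a = l
  induction l generalizing s with
  | nil =>
    refine (Runs.loop_nil hl).conv (by simp) ?_
    funext k; simp only [Function.update_apply]; split_ifs <;> simp_all
  | cons x l ih =>
    have h1 : Runs (.case a .skip (.seq (.pop a) (.push b false)) (.seq (.pop a) (.push b true)))
        s 3 (Function.update (Function.update s a l) b (x :: s b)) := by
      cases x
      · refine (Runs.case_false hl ((Runs.pop _ _).seq (Runs.push _ _ _))).conv le_rfl ?_
        funext k; simp only [Function.update_apply]; split_ifs <;> simp_all
      · refine (Runs.case_true hl ((Runs.pop _ _).seq (Runs.push _ _ _))).conv le_rfl ?_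
        funext k; simp only [Function.update_apply]; split_ifs <;> simp_all
    refine (Runs.loop_cons hl h1 (ih _ (by simp [hab]))).conv (by simp; omega) ?_
    funext k; simp only [Function.update_apply]; split_ifs <;> simp_all

/-- Empty stack `a`. -/
def clear (a : ℕ) : Cmd := .loop a (.pop a)

theorem runs_clear (a : ℕ) (s : Store) :
    Runs (clear a) s (2 * (s a).length + 1) (Function.update s a []) := by
  generalize hl : s a = l
  induction l generalizing s with
  | nil => exact (Runs.loop_nil hl).conv (by simp) (by rw [← hl]; simp)
  | cons x l ih =>
    refine (Runs.loop_cons hl (Runs.pop _ _) (ih _ (by simp [hl]))).conv (by simp; omega) ?_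
    simp

/-- Copy the unary number on stack `a` onto stack `b`, using the empty stack `d`. -/
def copyUnary (a d b : ℕ) : Cmd :=
  .seq (pour a d)
    (.loop d (.seq (.pop d) (.seq (.push a true) (.push b true))))

theorem runs_copyUnary {a d b n : ℕ} (had : a ≠ d) (hab : a ≠ b) (hdb : d ≠ b) (s : Store)
    (ha : s a = List.replicate n true) (hd : s d = []) :
    Runs (copyUnary a d b) s (8 * n + 2)
      (Function.update s b (List.replicate n true ++ s b)) := by
  have key : ∀ (n : ℕ) (s : Store), s d = List.replicate n true →
      Runs (.loop d (.seq (.pop d) (.seq (.push a true) (.push b true)))) s (4 * n + 1)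
        (Function.update (Function.update (Function.update s d []) a
          (List.replicate n true ++ s a)) b (List.replicate n true ++ s b)) := by
    intro n
    induction n with
    | zero =>
      intro s hs
      refine (Runs.loop_nil hs).conv (by simp) ?_
      funext k; simp only [Function.update_apply]; split_ifs <;> simp_all
    | succ n ih =>
      intro s hs
      refine (Runs.loop_cons hs ((Runs.pop _ _).seq ((Runs.push _ _ _).seq (Runs.push _ _ _)))
        (ih _ ?_)).conv (by omega) ?_
      · simp [had.symm, hdb, hs]
      · funext k
        simp only [Function.update_apply]
        split_ifs <;>
          simp_all [List.replicate_succ', List.append_assoc]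
  refine ((runs_pour had s).seq (key n _ ?_)).conv ?_ ?_
  · simp [ha, hd]
  · simp [ha]; omega
  · funext k; simp only [Function.update_apply]; split_ifs <;> simp_all

/-! ### Polynomial expressions -/

/-- Polynomial expressions in the length of the input and numbered variables. -/
inductive Expr : Type
  | len : Expr
  | const (c : ℕ) : Expr
  | var (i : ℕ) : Expr
  | add (e f : Expr) : Expr
  | mul (e f : Expr) : Expr

/-- The value of an expression, for inputs of length `N` and values `v` of the variables. -/
def Expr.eval (N : ℕ) (v : ℕ → ℕ) : Expr → ℕ
  | .len => N
  | .const c => c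
  | .var i => v i
  | .add e f => e.eval N v + f.eval N v
  | .mul e f => e.eval N v * f.eval N v

/-- The value of an expression is bounded by a polynomial in a common bound of the length and the
variables. -/
theorem Expr.exists_bound (e : Expr) : ∃ p : Polynomial ℕ, ∀ N v M, N ≤ M → (∀ i, v i ≤ M) →
    e.eval N v ≤ p.eval M := by
  induction e with
  | len => exact ⟨.X, by simp [Expr.eval]; tauto⟩
  | const c => exact ⟨(c : Polynomial ℕ), by simp [Expr.eval]⟩
  | var i => exact ⟨.X, by simp [Expr.eval]; tauto⟩
  | add e f ihe ihf =>
    obtain ⟨p, hp⟩ := ihe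
    obtain ⟨q, hq⟩ := ihf
    refine ⟨p + q, fun N v M h1 h2 => ?_⟩
    simp only [Polynomial.eval_add, Expr.eval]
    exact add_le_add (hp _ _ _ h1 h2) (hq _ _ _ h1 h2)
  | mul e f ihe ihf =>
    obtain ⟨p, hp⟩ := ihe
    obtain ⟨q, hq⟩ := ihf
    refine ⟨p * q, fun N v M h1 h2 => ?_⟩
    simp only [Polynomial.eval_mul, Expr.eval]
    exact Nat.mul_le_mul (hp _ _ _ h1 h2) (hq _ _ _ h1 h2)

/-- Push `c` times `true` onto stack `b`. -/
def pushes (b : ℕ) : ℕ → Cmd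
  | 0 => .skip
  | c + 1 => .seq (.push b true) (pushes b c)

theorem runs_pushes (b c : ℕ) (s : Store) :
    Runs (pushes b c) s (c + 1) (Function.update s b (List.replicate c true ++ s b)) := by
  induction c generalizing s with
  | zero => exact (Runs.skip s).conv (by simp) (by simp)
  | succ c ih =>
    refine ((Runs.push _ _ _).seq (ih _)).conv (by omega) ?_
    simp [List.replicate_succ']

/-- Push the value of an expression in unary onto stack `b`. Variable `i` is on stack `vs i`, the
input length on stack `1`, and the stacks from `d` on are free. -/
def Expr.code (vs : ℕ → ℕ) : Expr → ℕ → ℕ → Cmd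
  | .len, b, d => copyUnary 1 d b
  | .const c, b, _ => pushes b c
  | .var i, b, d => copyUnary (vs i) d b
  | .add e f, b, d => .seq (e.code vs b d) (f.code vs b d)
  | .mul e f, b, d => .seq (e.code vs d (d + 1)) (.loop d (.seq (.pop d) (f.code vs b (d + 1))))

/-- The store holds the input length `N` and the values `v` of the variables as expected by
`Expr.code`. -/
structure ExprLayout (vs : ℕ → ℕ) (d N : ℕ) (v : ℕ → ℕ) (s : Store) : Prop where
  one_lt : 1 < d
  vs_lt : ∀ i, vs i < d
  length : s 1 = List.replicate N true
  var : ∀ i, s (vs i) = List.replicate (v i) true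
  free : ∀ k, d ≤ k → s k = []

theorem ExprLayout.update {vs d N v s b} (h : ExprLayout vs d N v s) (hbd : b < d) (hb1 : b ≠ 1)
    (hb : ∀ i, b ≠ vs i) (x : List Bool) : ExprLayout vs d N v (Function.update s b x) where
  one_lt := h.one_lt
  vs_lt := h.vs_lt
  length := by rw [Function.update_of_ne hb1.symm, h.length]
  var i := by rw [Function.update_of_ne (hb i).symm, h.var]
  free k hk := by rw [Function.update_of_ne (by omega), h.free k hk]

theorem ExprLayout.succ {vs d N v s} (h : ExprLayout vs d N v s) :
    ExprLayout vs (d + 1) N v s where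
  one_lt := by have := h.one_lt; omega
  vs_lt i := by have := h.vs_lt i; omega
  length := h.length
  var := h.var
  free k hk := h.free k (by omega)

/-- The code of an expression leaves all stacks but the result stack as they were, and its running
time is bounded by a polynomial in a common bound of the length and the variables. -/
theorem Expr.runs_code (e : Expr) : ∃ p : Polynomial ℕ, ∀ vs d N v s b M,
    ExprLayout vs d N v s → b < d → b ≠ 1 → (∀ i, b ≠ vs i) → N ≤ M → (∀ i, v i ≤ M) →
    Runs (e.code vs b d) s (p.eval M)
      (Function.update s b (List.replicate (e.eval N v) true ++ s b)) := by
  induction e with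
  | len =>
    refine ⟨8 * .X + 2, fun vs d N v s b M h hbd hb1 hb hN hv => ?_⟩
    refine (runs_copyUnary (by have := h.one_lt; omega) (Ne.symm hb1) (by omega) s h.length
      (h.free d le_rfl)).conv ?_ rfl
    simp; omega
  | const c =>
    refine ⟨(c : Polynomial ℕ) + 1, fun vs d N v s b M h hbd hb1 hb hN hv => ?_⟩
    exact (runs_pushes b c s).conv (by simp) rfl
  | var i =>
    refine ⟨8 * .X + 2, fun vs d N v s b M h hbd hb1 hb hN hv => ?_⟩
    refine (runs_copyUnary (by have := h.vs_lt i; omega) (Ne.symm (hb i)) (by omega) s (h.var i)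
      (h.free d le_rfl)).conv ?_ rfl
    have := hv i
    simp; omega
  | add e f ihe ihf =>
    obtain ⟨p, hp⟩ := ihe
    obtain ⟨q, hq⟩ := ihf
    refine ⟨p + q, fun vs d N v s b M h hbd hb1 hb hN hv => ?_⟩
    refine ((hp vs d N v s b M h hbd hb1 hb hN hv).seq (hq vs d N v _ b M
      (h.update hbd hb1 hb _) hbd hb1 hb hN hv)).conv (by simp) ?_
    simp only [Expr.eval, Function.update_self, Function.update_idem]
    rw [← List.append_assoc, ← List.replicate_add, Nat.add_comm]
  | mul e f ihe ihf =>
    obtain ⟨p, hp⟩ := ihe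
    obtain ⟨q, hq⟩ := ihf
    obtain ⟨r, hr⟩ := e.exists_bound
    refine ⟨p + (r * (q + 2) + 1), fun vs d N v s b M h hbd hb1 hb hN hv => ?_⟩
    have h1 := h.one_lt
    have hd := h.free d le_rfl
    have h' := h.succ
    have hvs := h.vs_lt
    set E := e.eval N v with hE
    set F := f.eval N v with hF
    have hEr : E ≤ r.eval M := hr N v M hN hv
    -- The store after `i` rounds of the loop.
    let σ : ℕ → Store := fun i => Function.update
      (Function.update s d (List.replicate (E - i) true)) b (List.replicate (i * F) true ++ s b)
    have hσ : ∀ i, i < E → Runs (.seq (.pop d) (f.code vs b (d + 1))) (σ i)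
        (1 + q.eval M) (σ (i + 1)) := by
      intro i hi
      have e1 : Function.update (σ i) d (σ i d).tail = Function.update
          (Function.update s d (List.replicate (E - (i + 1)) true)) b
            (List.replicate (i * F) true ++ s b) := by
        have : d ≠ b := by omega
        funext k; simp only [σ, Function.update_apply]; split_ifs <;> simp_all [Nat.sub_sub]
      have h2 := Runs.pop d (σ i)
      rw [e1] at h2
      refine (h2.seq (hq vs (d + 1) N v _ b M ?_ (by omega) hb1 hb hN hv)).conv le_rfl ?_
      · refine ExprLayout.update (h'.update (by omega) (by omega) (fun i => ?_) _)
          (by omega) hb1 hb _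
        have := hvs i; omega
      · simp only [σ, Function.update_self, Function.update_idem]
        rw [← List.append_assoc, ← List.replicate_add, ← hF, show (i + 1) * F = F + i * F by ring]
    have hdb : d ≠ b := by omega
    have h3 := Runs.loop_iter (k := d) σ E _
      (fun i hi => by simp [σ, Function.update_of_ne hdb]; omega)
      (by simp [σ, Function.update_of_ne hdb]) hσ
    have e2 : σ 0 = Function.update s d (List.replicate E true ++ s d) := by
      funext k; simp only [σ, Function.update_apply]; split_ifs <;> simp_all
    rw [e2] at h3
    refine ((hp vs (d + 1) N v s d M h' (by omega) (by omega)
      (fun i => by have := hvs i; omega) hN hv).seq h3).conv ?_ ?_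
    · simp only [Polynomial.eval_add, Polynomial.eval_mul, Polynomial.eval_one,
        Polynomial.eval_ofNat]
      rw [show 1 + q.eval M + 1 = q.eval M + 2 by omega]
      gcongr
    · clear hp hq hr h3 hσ e2
      funext k; simp only [σ, Function.update_apply, Expr.eval]; split_ifs <;> simp_all

end StackProg

/-! ### Formulas with bounded quantifiers and recursively defined arrays -/

namespace StackProg

/-- Extend an environment by a new first entry. -/
def scons {α : Type} (a : α) (f : ℕ → α) : ℕ → α
  | 0 => a
  | i + 1 => f i

/-- The bit array of length `n` whose entry at `m` is computed by `f` from `m` and the entries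
before `m`. -/
def build (f : ℕ → List Bool → Bool) : ℕ → List Bool
  | 0 => []
  | m + 1 => build f m ++ [f m (build f m)]

theorem length_build (f : ℕ → List Bool → Bool) (n : ℕ) : (build f n).length = n := by
  induction n with
  | zero => rfl
  | succ n ih => simp [build, ih]

/-- Formulas about an input string, numbered bit arrays and numbered variables. Both kinds of
variables are de Bruijn indices: binders introduce the index `0`. -/
inductive Form : Type
  | lt (e f : Expr) : Form
  /-- The bit of the input at a position. -/
  | inp (e : Expr) : Form
  /-- The entry of array `j` at a position. -/
  | arr (j : ℕ) (e : Expr) : Form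
  | neg (φ : Form) : Form
  | and (φ ψ : Form) : Form
  /-- There is a number below `e` with the property `φ`. -/
  | ex (e : Expr) (φ : Form) : Form
  /-- `ψ`, for the array of length `e` defined by course-of-values recursion with `φ`. -/
  | letrec (e : Expr) (φ ψ : Form) : Form
  /-- `φ` after renaming variables by `ρ` and arrays by `τ`. -/
  | ren (ρ τ : ℕ → ℕ) (φ : Form) : Form

/-- The truth value of a formula for the input `w`, the arrays `S`, and the values `v` of the
variables. -/
def Form.eval (w : List Bool) : Form → (ℕ → List Bool) → (ℕ → ℕ) → Bool
  | .lt e f, _, v => decide (e.eval w.length v < f.eval w.length v)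
  | .inp e, _, v => w.getD (e.eval w.length v) false
  | .arr j e, S, v => (S j).getD (e.eval w.length v) false
  | .neg φ, S, v => !φ.eval w S v
  | .and φ ψ, S, v => φ.eval w S v && ψ.eval w S v
  | .ex e φ, S, v => (List.range (e.eval w.length v)).any fun i => φ.eval w S (scons i v)
  | .letrec e φ ψ, S, v =>
      ψ.eval w (scons (build (fun m L => φ.eval w (scons L S) (scons m v)) (e.eval w.length v)) S) v
  | .ren ρ τ φ, S, v => φ.eval w (S ∘ τ) (v ∘ ρ)

/-- Evaluate `e` and run the body that many times; stack `d` counts down and stack `d + 1`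
counts up. -/
def forLoop (e : Expr) (vs : ℕ → ℕ) (d : ℕ) (body : Cmd) : Cmd :=
  .seq (e.code vs d (d + 2)) (.seq (.loop d (.seq (.pop d) (.seq body (.push (d + 1) true))))
    (clear (d + 1)))

/-- Push the entry of the array on stack `a` at position `e` onto stack `2`. -/
def readArray (e : Expr) (vs : ℕ → ℕ) (d a : ℕ) : Cmd :=
  .seq (e.code vs d (d + 2)) (.seq
    (.loop d (.seq (.pop d) (.case a .skip (.seq (.pop a) (.push (d + 1) false))
      (.seq (.pop a) (.push (d + 1) true)))))
    (.seq (.case a (.push 2 false) (.push 2 false) (.push 2 true)) (pour (d + 1) a)))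

/-- Append the bit popped from stack `2` to the array on stack `a`, using the empty stack `d`. -/
def appendBit (a d : ℕ) : Cmd :=
  .seq (pour a d) (.seq (.case 2 .skip (.push d false) (.push d true))
    (.seq (.pop 2) (pour d a)))

/-- Push the truth value of a formula onto stack `2`. Variable `i` is on stack `vs i`, array `j` on
stack `as j`, and the stacks from `d` on are free. -/
def Form.code : Form → (ℕ → ℕ) → (ℕ → ℕ) → ℕ → Cmd
  | .lt e f, vs, _, d =>
      .seq (e.code vs d (d + 2)) (.seq (f.code vs (d + 1) (d + 2))
        (.seq (.loop d (.seq (.pop d) (.pop (d + 1))))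
          (.seq (.case (d + 1) (.push 2 false) (.push 2 true) (.push 2 true)) (clear (d + 1)))))
  | .inp e, vs, _, d => readArray e vs d 0
  | .arr j e, vs, as, d => readArray e vs d (as j)
  | .neg φ, vs, as, d => .seq (φ.code vs as d)
      (.case 2 .skip (.seq (.pop 2) (.push 2 true)) (.seq (.pop 2) (.push 2 false)))
  | .and φ ψ, vs, as, d => .seq (φ.code vs as d) (.seq (ψ.code vs as d)
      (.case 2 .skip (.seq (.pop 2) (.seq (.pop 2) (.push 2 false))) (.pop 2)))
  | .ex e φ, vs, as, d => .seq (.push 2 false)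
      (forLoop e vs d (.seq (φ.code (scons (d + 1) vs) as (d + 2))
        (.case 2 .skip (.pop 2) (.seq (.pop 2) (.seq (.pop 2) (.push 2 true))))))
  | .letrec e φ ψ, vs, as, d => .seq
      (forLoop e vs d (.seq (φ.code (scons (d + 1) vs) (scons (d + 2) as) (d + 3))
        (appendBit (d + 2) (d + 3))))
      (.seq (ψ.code vs (scons (d + 2) as) (d + 3)) (clear (d + 2)))
  | .ren ρ τ φ, vs, as, d => φ.code (vs ∘ ρ) (as ∘ τ) d

/-- The store holds the input `w`, the arrays `S` and the values `v` of the variables as expected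
by `Form.code`. Stacks `2` and `3` are reserved for truth values and for the output. -/
structure Layout (vs as : ℕ → ℕ) (d : ℕ) (w : List Bool) (S : ℕ → List Bool) (v : ℕ → ℕ)
    (s : Store) : Prop where
  le_d : 5 ≤ d
  vs_mem : ∀ i, 4 ≤ vs i ∧ vs i < d
  as_mem : ∀ i, 4 ≤ as i ∧ as i < d
  input : s 0 = w
  length : s 1 = List.replicate w.length true
  var : ∀ i, s (vs i) = List.replicate (v i) true
  arr : ∀ j, s (as j) = S j
  free : ∀ k, d ≤ k → s k = []

namespace Layout

variable {vs as : ℕ → ℕ} {d : ℕ} {w : List Bool} {S : ℕ → List Bool} {v : ℕ → ℕ} {s : Store}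

theorem expr (h : Layout vs as d w S v s) : ExprLayout vs d w.length v s where
  one_lt := by have := h.le_d; omega
  vs_lt i := (h.vs_mem i).2
  length := h.length
  var := h.var
  free := h.free

/-- Stores with the same contents below `d`, except for the result and the output stack, have the
same layout. -/
theorem agree (h : Layout vs as d w S v s) {d' : ℕ} {s' : Store} (hd : d ≤ d')
    (hs : ∀ k < d, k ≠ 2 → k ≠ 3 → s' k = s k) (hf : ∀ k, d' ≤ k → s' k = []) :
    Layout vs as d' w S v s' where
  le_d := h.le_d.trans hd
  vs_mem i := ⟨(h.vs_mem i).1, (h.vs_mem i).2.trans_le hd⟩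
  as_mem i := ⟨(h.as_mem i).1, (h.as_mem i).2.trans_le hd⟩
  input := by rw [hs 0 (by have := h.le_d; omega) (by omega) (by omega), h.input]
  length := by rw [hs 1 (by have := h.le_d; omega) (by omega) (by omega), h.length]
  var i := by
    have := h.vs_mem i
    rw [hs _ this.2 (by omega) (by omega), h.var]
  arr i := by
    have := h.as_mem i
    rw [hs _ this.2 (by omega) (by omega), h.arr]
  free := hf

theorem consVar (h : Layout vs as d w S v s) {a n : ℕ} (ha : 4 ≤ a ∧ a < d)
    (hs : s a = List.replicate n true) : Layout (scons a vs) as d w S (scons n v) s where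
  le_d := h.le_d
  vs_mem i := by cases i; exacts [ha, h.vs_mem _]
  as_mem := h.as_mem
  input := h.input
  length := h.length
  var i := by cases i; exacts [hs, h.var _]
  arr := h.arr
  free := h.free

theorem consArr (h : Layout vs as d w S v s) {a : ℕ} {L : List Bool} (ha : 4 ≤ a ∧ a < d)
    (hs : s a = L) : Layout vs (scons a as) d w (scons L S) v s where
  le_d := h.le_d
  vs_mem := h.vs_mem
  as_mem i := by cases i; exacts [ha, h.as_mem _]
  input := h.input
  length := h.length
  var := h.var
  arr i := by cases i; exacts [hs, h.arr _]
  free := h.free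

theorem ren (h : Layout vs as d w S v s) (ρ τ : ℕ → ℕ) :
    Layout (vs ∘ ρ) (as ∘ τ) d w (S ∘ τ) (v ∘ ρ) s where
  le_d := h.le_d
  vs_mem _ := h.vs_mem _
  as_mem _ := h.as_mem _
  input := h.input
  length := h.length
  var _ := h.var _
  arr _ := h.arr _
  free := h.free

theorem update_two (h : Layout vs as d w S v s) (x : List Bool) :
    Layout vs as d w S v (Function.update s 2 x) :=
  h.agree le_rfl (fun k _ h2 _ => Function.update_of_ne h2 _ _)
    fun k hk => by rw [Function.update_of_ne (by have := h.le_d; omega), h.free k hk]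

theorem update_three (h : Layout vs as d w S v s) (x : List Bool) :
    Layout vs as d w S v (Function.update s 3 x) :=
  h.agree le_rfl (fun k _ _ h3 => Function.update_of_ne h3 _ _)
    fun k hk => by rw [Function.update_of_ne (by have := h.le_d; omega), h.free k hk]

end Layout

/-- A loop whose `i`-th round leads from the store `τ i` to `τ (i + 1)`, the two counters on the stacks
`d` and `d + 1` aside, leads from the first to the last of these stores. -/
theorem runs_forLoop (e : Expr) : ∃ p : Polynomial ℕ, ∀ vs d N v M body (τ : ℕ → Store) T,
    ExprLayout vs d N v (τ 0) → N ≤ M → (∀ i, v i ≤ M) →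
    (∀ i ≤ e.eval N v, τ i d = [] ∧ τ i (d + 1) = []) →
    (∀ i < e.eval N v, Runs body
      (Function.update (Function.update (τ i) d (List.replicate (e.eval N v - (i + 1)) true))
        (d + 1) (List.replicate i true)) T
      (Function.update (Function.update (τ (i + 1)) d (List.replicate (e.eval N v - (i + 1)) true))
        (d + 1) (List.replicate i true))) →
    Runs (forLoop e vs d body) (τ 0) (p.eval M * (T + 1)) (τ (e.eval N v)) := by
  obtain ⟨p, hp⟩ := e.runs_code
  obtain ⟨r, hr⟩ := e.exists_bound
  refine ⟨p + 5 * r + 2, fun vs d N v M body τ T h hN hv hτ hb => ?_⟩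
  have hE := hr N v M hN hv
  have h1 := hp vs (d + 2) N v (τ 0) d M h.succ.succ (by omega) (by have := h.one_lt; omega)
    (fun i => by have := h.vs_lt i; omega) hN hv
  clear hp hr
  set E := e.eval N v
  let σ : ℕ → Store := fun i => Function.update (Function.update (τ i) d
    (List.replicate (E - i) true)) (d + 1) (List.replicate i true)
  have h2 := Runs.loop_iter (k := d) (c := .seq (.pop d) (.seq body (.push (d + 1) true)))
    σ E (1 + (T + 1)) (fun i hi => ?_) ?_ ?_
  · have e2 : σ 0 = Function.update (τ 0) d (List.replicate E true ++ τ 0 d) := by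
      have := hτ 0 (Nat.zero_le _)
      funext k; simp only [σ, Function.update_apply]; split_ifs <;> simp_all
    rw [e2] at h2
    refine (h1.seq (h2.seq (runs_clear _ _))).conv ?_ ?_
    · simp only [Polynomial.eval_add, Polynomial.eval_mul, Polynomial.eval_ofNat, σ,
        Function.update_self, List.length_replicate]
      generalize p.eval M = P at *
      generalize r.eval M = R at *
      have := Nat.mul_le_mul_right T hE
      have := Nat.zero_le (P * T)
      have := Nat.zero_le (R * T)
      ring_nf at *
      omega
    · have := hτ E le_rfl
      funext k; simp only [σ, Function.update_apply]; split_ifs <;> simp_all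
  · simp [σ]; omega
  · simp [σ]
  · intro i hi
    have h3 := Runs.pop d (σ i)
    have e3 : Function.update (σ i) d (σ i d).tail = (Function.update (Function.update (τ i) d
        (List.replicate (E - (i + 1)) true)) (d + 1) (List.replicate i true)) := by
      have hd : d ≠ d + 1 := by omega
      simp only [σ]
      rw [Function.update_of_ne hd, Function.update_self, Function.update_comm hd.symm,
        Function.update_idem, List.tail_replicate, Nat.sub_sub]
    rw [e3] at h3
    refine (h3.seq ((hb i hi).seq (Runs.push _ _ _))).conv le_rfl ?_
    simp only [σ, Function.update_self, Function.update_idem, List.replicate_succ]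

end StackProg

/-! ### Running times of formulas -/

namespace StackProg

theorem runs_appendBit {a d : ℕ} (had : a ≠ d) (ha : a ≠ 2) (hd : d ≠ 2) (s : Store) (b : Bool)
    (l : List Bool) (h2 : s 2 = b :: l) (hfree : s d = []) :
    Runs (appendBit a d) s (8 * (s a).length + 9)
      (Function.update (Function.update s 2 l) a (s a ++ [b])) := by
  have h1 := runs_pour had s
  set s1 := Function.update (Function.update s a []) d ((s a).reverse ++ s d) with hs1
  have e1 : s1 2 = b :: l := by simp [hs1, ha.symm, hd.symm, h2]
  have h3 : Runs (.case 2 .skip (.push d false) (.push d true)) s1 2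
      (Function.update s1 d (b :: s1 d)) := by
    cases b
    · exact Runs.case_false e1 (Runs.push _ _ _)
    · exact Runs.case_true e1 (Runs.push _ _ _)
  refine (h1.seq (h3.seq ((Runs.pop _ _).seq (runs_pour had.symm _)))).conv ?_ ?_
  · simp [hs1, Function.update_apply, hd, hfree]; omega
  · clear h1 h3
    funext k; simp only [hs1, Function.update_apply]; split_ifs <;> simp_all

/-- An array is read by moving its beginning to stack `d + 1` and back; positions behind its end have
the entry `false`. -/
theorem runs_readArray (e : Expr) : ∃ p : Polynomial ℕ, ∀ vs d N v s a M,
    ExprLayout vs d N v s → a < d → 2 < d → a ≠ 2 → N ≤ M → (∀ i, v i ≤ M) → (s a).length ≤ M →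
    Runs (readArray e vs d a) s (p.eval M)
      (Function.update s 2 ((s a).getD (e.eval N v) false :: s 2)) := by
  obtain ⟨p, hp⟩ := e.runs_code
  obtain ⟨r, hr⟩ := e.exists_bound
  refine ⟨p + (5 * r + 1) + (4 * r + 4), fun vs d N v s a M h had h2d ha2 hN hv hM => ?_⟩
  have hE := hr N v M hN hv
  have h1 := hp vs (d + 2) N v s d M h.succ.succ (by omega) (by have := h.one_lt; omega)
    (fun i => by have := h.vs_lt i; omega) hN hv
  clear hp hr
  have hd := h.free d le_rfl
  have hd1 := h.free (d + 1) (by omega)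
  generalize e.eval N v = E at *
  let σ : ℕ → Store := fun i => Function.update (Function.update (Function.update s d
    (List.replicate (E - i) true)) (d + 1) ((s a).take i).reverse) a ((s a).drop i)
  have hb : ∀ i < E, Runs (.seq (.pop d) (.case a .skip (.seq (.pop a) (.push (d + 1) false))
      (.seq (.pop a) (.push (d + 1) true)))) (σ i) 4 (σ (i + 1)) := by
    intro i hi
    have h3 := Runs.pop d (σ i)
    have e3 : Function.update (σ i) d (σ i d).tail =
        (Function.update (Function.update (Function.update s d
        (List.replicate (E - (i + 1)) true)) (d + 1) ((s a).take i).reverse) a ((s a).drop i)) := by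
      have hda : d ≠ a := by omega
      funext k
      by_cases hk : k = d
      · subst hk; simp [σ, hda, Nat.sub_sub]
      · simp [σ, Function.update_apply, hk]
    rw [e3] at h3
    have hda : d ≠ a := by omega
    have hda' : d + 1 ≠ a := by omega
    have key : ∀ b : Bool, ∀ l, (s a).drop i = b :: l →
        (s a).take (i + 1) = (s a).take i ++ [b] ∧ (s a).drop (i + 1) = l := by
      intro b l hbl
      have hi : i < (s a).length := by
        by_contra hcon
        rw [List.drop_eq_nil_of_le (by omega)] at hbl
        cases hbl
      rw [List.drop_eq_getElem_cons hi] at hbl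
      obtain ⟨rfl, rfl⟩ := List.cons.inj hbl
      exact ⟨List.take_succ_eq_append_getElem hi, rfl⟩
    rcases hl : (s a).drop i with _ | ⟨_ | _, l⟩
    · refine (h3.seq (Runs.case_nil (by simp [hl]) (Runs.skip _))).conv (by omega) ?_
      have hi : (s a).length ≤ i := List.drop_eq_nil_iff.1 hl
      simp only [σ]
      rw [List.drop_eq_nil_of_le hi, List.drop_eq_nil_of_le (by omega), List.take_of_length_le hi,
        List.take_of_length_le (by omega)]
    · refine (h3.seq (Runs.case_false (l := l) (by simp [hl])
        ((Runs.pop _ _).seq (Runs.push _ _ _)))).conv (by omega) ?_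
      obtain ⟨k1, k2⟩ := key _ _ hl
      clear h1 h3 e3 key h
      simp only [σ, k1, k2, hl]
      funext k; simp only [Function.update_apply]; split_ifs <;> simp_all
    · refine (h3.seq (Runs.case_true (l := l) (by simp [hl])
        ((Runs.pop _ _).seq (Runs.push _ _ _)))).conv (by omega) ?_
      obtain ⟨k1, k2⟩ := key _ _ hl
      clear h1 h3 e3 key h
      simp only [σ, k1, k2, hl]
      funext k; simp only [Function.update_apply]; split_ifs <;> simp_all
  have h2 := Runs.loop_iter (k := d) σ E 4 (fun i hi => by
    have : d ≠ a := by omega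
    simp [σ, this]; omega) (by
    have : d ≠ a := by omega
    simp [σ, this]) hb
  have e0 : σ 0 = Function.update s d (List.replicate E true ++ s d) := by
    clear h1 h2 hb
    funext k; simp only [σ, Function.update_apply]; split_ifs <;> simp_all
  have h3 : Runs (.case a (.push 2 false) (.push 2 false) (.push 2 true)) (σ E) 2
      (Function.update (σ E) 2 ((s a).getD E false :: s 2)) := by
    have ea : σ E a = (s a).drop E := by simp [σ]
    have e2 : σ E 2 = s 2 := by
      have : 2 ≠ d := by omega
      have : 2 ≠ d + 1 := by omega
      simp [σ, *, ha2.symm]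
    have hget : (s a).getD E false = ((s a).drop E).headD false := by
      rw [List.headD_eq_head?_getD, List.head?_drop, List.getD_eq_getElem?_getD]
    rw [hget]
    rcases hl : (s a).drop E with _ | ⟨_ | _, l⟩
    · exact (Runs.case_nil (by rw [ea, hl]) (Runs.push _ _ _)).conv le_rfl (by rw [e2]; rfl)
    · exact (Runs.case_false (by rw [ea, hl]) (Runs.push _ _ _)).conv le_rfl (by rw [e2]; rfl)
    · exact (Runs.case_true (by rw [ea, hl]) (Runs.push _ _ _)).conv le_rfl (by rw [e2]; rfl)
  rw [e0] at h2
  refine (h1.seq (h2.seq (h3.seq (runs_pour (by omega) _)))).conv ?_ ?_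
  · have : d + 1 ≠ 2 := by omega
    have : d + 1 ≠ a := by omega
    have : min E (s a).length ≤ E := min_le_left _ _
    simp [σ, *]
    omega
  · clear h1 h2 h3 e0 hb
    have : d + 1 ≠ 2 := by omega
    have : d + 1 ≠ a := by omega
    have hda : d ≠ a := by omega
    funext k; simp only [σ, Function.update_apply]
    split_ifs <;> simp_all

theorem runs_lt (e f : Expr) : ∃ p : Polynomial ℕ, ∀ vs as d w S v s M,
    Layout vs as d w S v s → w.length ≤ M → (∀ i, v i ≤ M) →
    Runs ((Form.lt e f).code vs as d) s (p.eval M)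
      (Function.update s 2 ((Form.lt e f).eval w S v :: s 2)) := by
  obtain ⟨p, hp⟩ := e.runs_code
  obtain ⟨q, hq⟩ := f.runs_code
  obtain ⟨pe, hpe⟩ := e.exists_bound
  obtain ⟨pf, hpf⟩ := f.exists_bound
  refine ⟨p + q + (3 * pe + 1) + (2 * pf + 4), fun vs as d w S v s M h hN hv => ?_⟩
  have hE := hpe _ _ M hN hv
  have hF := hpf _ _ M hN hv
  have hd := h.free d le_rfl
  have hd1 := h.free (d + 1) (by omega)
  have h5 := h.le_d
  have h1 := hp vs (d + 2) _ v s d M h.expr.succ.succ (by omega) (by omega)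
    (fun i => by have := h.expr.vs_lt i; omega) hN hv
  have h2 := hq vs (d + 2) w.length v
    (Function.update s d (List.replicate (e.eval w.length v) true ++ s d)) (d + 1) M
    (h.expr.succ.succ.update (b := d) (by omega)
      (by omega) (fun i => by have := h.expr.vs_lt i; omega) _) (by omega) (by omega)
    (fun i => by have := h.expr.vs_lt i; omega) hN hv
  simp only [Form.code, Form.eval]
  refine (h1.seq (h2.seq (T' := (3 * pe.eval M + 1) + (2 * pf.eval M + 4)) ?_)).mono ?_
  · clear h1 h2 hp hq hpe hpf
    generalize e.eval w.length v = E at *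
    generalize f.eval w.length v = F at *
    let σ : ℕ → Store := fun i => Function.update (Function.update s d
      (List.replicate (E - i) true)) (d + 1) (List.replicate (F - i) true)
    have hb : ∀ i < E, Runs (.seq (.pop d) (.pop (d + 1))) (σ i) 2 (σ (i + 1)) := by
      intro i hi
      refine ((Runs.pop _ _).seq (Runs.pop _ _)).conv (by omega) ?_
      funext k
      by_cases hk : k = d
      · subst hk; simp [σ, Nat.sub_sub]
      · by_cases hk' : k = d + 1 <;> simp [σ, hk, hk', Nat.sub_sub]
    have h2 := Runs.loop_iter (k := d) σ E 2 (fun i hi => by simp [σ]; omega) (by simp [σ]) hb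
    have e0 : Function.update (Function.update s d (List.replicate E true ++ s d)) (d + 1)
        (List.replicate F true ++ (Function.update s d (List.replicate E true ++ s d)) (d + 1)) =
        σ 0 := by
      clear h2
      funext k; simp only [σ, Function.update_apply]; split_ifs <;> simp_all
    rw [e0]
    have h3 : Runs (.case (d + 1) (.push 2 false) (.push 2 true) (.push 2 true)) (σ E) 2
        (Function.update (σ E) 2 (decide (E < F) :: s 2)) := by
      have ea : σ E (d + 1) = List.replicate (F - E) true := by simp [σ]
      have e2 : σ E 2 = s 2 := by
        have : 2 ≠ d := by omega
        have : 2 ≠ d + 1 := by omega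
        simp [σ, *]
      rcases hl : F - E with _ | n
      · have : ¬ E < F := by omega
        exact (Runs.case_nil (by rw [ea, hl]; rfl) (Runs.push _ _ _)).conv le_rfl
          (by rw [e2]; simp [this])
      · have : E < F := by omega
        exact (Runs.case_true (by rw [ea, hl]; rfl) (Runs.push _ _ _)).conv le_rfl
          (by rw [e2]; simp [this])
    refine (h2.seq (h3.seq (runs_clear _ _))).conv ?_ ?_
    · have : d + 1 ≠ 2 := by omega
      simp [σ, *]
      omega
    · clear h2 h3 e0 hb
      funext k; simp only [σ, Function.update_apply]
      split_ifs <;> simp_all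
  · simp; omega

end StackProg

namespace StackProg

/-- The code of a formula pushes its truth value onto stack `2`, leaves all other stacks as they were,
and runs in polynomial time. The polynomials in the quantifier cases are composed with a bound of the
new variable or array. -/
theorem Form.runs_code (φ : Form) : ∃ p : Polynomial ℕ, ∀ vs as d w S v s M,
    Layout vs as d w S v s → w.length ≤ M → (∀ i, v i ≤ M) → (∀ j, (S j).length ≤ M) →
    Runs (φ.code vs as d) s (p.eval M) (Function.update s 2 (φ.eval w S v :: s 2)) := by
  induction φ with
  | lt e f =>
    obtain ⟨p, hp⟩ := runs_lt e f
    exact ⟨p, fun vs as d w S v s M h hN hv _ => hp vs as d w S v s M h hN hv⟩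
  | inp e =>
    obtain ⟨p, hp⟩ := runs_readArray e
    refine ⟨p, fun vs as d w S v s M h hN hv _ => ?_⟩
    have hd := h.le_d
    have h1 := hp vs d w.length v s 0 M h.expr (by omega) (by omega) (by omega) hN hv
      (by rw [h.input]; exact hN)
    rw [h.input] at h1
    exact h1
  | arr j e =>
    obtain ⟨p, hp⟩ := runs_readArray e
    refine ⟨p, fun vs as d w S v s M h hN hv hS => ?_⟩
    have hd := h.le_d
    have hj := h.as_mem j
    have h1 := hp vs d w.length v s (as j) M h.expr hj.2 (by omega) (by omega) hN hv
      (by rw [h.arr]; exact hS j)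
    rw [h.arr] at h1
    exact h1
  | neg φ ih =>
    obtain ⟨p, hp⟩ := ih
    refine ⟨p + 3, fun vs as d w S v s M h hN hv hS => ?_⟩
    have h1 := hp vs as d w S v s M h hN hv hS
    simp only [Form.code, Form.eval, Polynomial.eval_add, Polynomial.eval_ofNat]
    refine h1.seq ?_
    cases φ.eval w S v
    · exact (Runs.case_false (by simp; rfl) ((Runs.pop _ _).seq (Runs.push _ _ _))).conv
        le_rfl (by simp)
    · exact (Runs.case_true (by simp; rfl) ((Runs.pop _ _).seq (Runs.push _ _ _))).conv
        le_rfl (by simp)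
  | and φ ψ ih1 ih2 =>
    obtain ⟨p, hp⟩ := ih1
    obtain ⟨q, hq⟩ := ih2
    refine ⟨p + (q + 4), fun vs as d w S v s M h hN hv hS => ?_⟩
    have h1 := hp vs as d w S v s M h hN hv hS
    have h2 := hq vs as d w S v _ M (h.update_two (φ.eval w S v :: s 2)) hN hv hS
    simp only [Form.code, Form.eval, Polynomial.eval_add, Polynomial.eval_ofNat]
    refine h1.seq (h2.seq ?_)
    cases ψ.eval w S v
    · exact (Runs.case_false (by simp; rfl)
        ((Runs.pop _ _).seq ((Runs.pop _ _).seq (Runs.push _ _ _)))).conv le_rfl (by simp)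
    · exact (Runs.case_true (by simp; rfl) (Runs.pop _ _)).conv (by omega) (by simp)
  | ex e φ ih =>
    obtain ⟨p, hp⟩ := ih
    obtain ⟨q, hq⟩ := runs_forLoop e
    obtain ⟨r, hr⟩ := e.exists_bound
    refine ⟨1 + q * (p.comp (.X + r) + 4 + 1), fun vs as d w S v s M h hN hv hS => ?_⟩
    have hE := hr _ v M hN hv
    have hd := h.le_d
    have hfree := h.free
    simp only [Form.code, Form.eval, Polynomial.eval_add, Polynomial.eval_mul,
      Polynomial.eval_comp, Polynomial.eval_ofNat, Polynomial.eval_one, Polynomial.eval_X]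
    refine (Runs.push _ _ _).seq ?_
    let B : ℕ → Bool := fun i => (List.range i).any fun i => φ.eval w S (scons i v)
    have hB : ∀ i, B (i + 1) = (B i || φ.eval w S (scons i v)) := by
      intro i; simp [B, List.range_succ]
    refine hq vs d w.length v M _ (fun i => Function.update s 2 (B i :: s 2)) _
      (h.update_two _).expr hN hv (fun i _ => ?_) (fun i hi => ?_)
    · have h1 := hfree d le_rfl
      have h2 := hfree (d + 1) (by omega)
      rw [Function.update_of_ne (by omega), Function.update_of_ne (by omega)]
      exact ⟨h1, h2⟩
    · generalize hs1 : Function.update (Function.update (Function.update s 2 (B i :: s 2)) d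
        (List.replicate (e.eval w.length v - (i + 1)) true)) (d + 1)
        (List.replicate i true) = s1
      have hs12 : s1 2 = B i :: s 2 := by
        rw [← hs1, Function.update_of_ne (by omega), Function.update_of_ne (by omega),
          Function.update_self]
      have hl : Layout (scons (d + 1) vs) as (d + 2) w S (scons i v) s1 := by
        refine (h.agree (d' := d + 2) (s' := s1) (by omega) (fun k hk h2 _ => ?_)
          (fun k hk => ?_)).consVar (by omega) (by simp [← hs1])
        · rw [← hs1, Function.update_of_ne (by omega), Function.update_of_ne (by omega),
            Function.update_of_ne h2]
        · rw [← hs1, Function.update_of_ne (by omega), Function.update_of_ne (by omega),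
            Function.update_of_ne (by omega), hfree k (by omega)]
      have h1 := hp (scons (d + 1) vs) as (d + 2) w S (scons i v) s1 (M + r.eval M) hl
        (by omega) (fun j => ?_) (fun j => (hS j).trans (by omega))
      · have e2 : Function.update (Function.update (Function.update s 2 (B (i + 1) :: s 2)) d
            (List.replicate (e.eval w.length v - (i + 1)) true)) (d + 1) (List.replicate i true)
            = Function.update s1 2 (B (i + 1) :: s 2) := by
          rw [← hs1, Function.update_comm (by omega : d + 1 ≠ 2),
            Function.update_comm (by omega : d ≠ 2), Function.update_idem]
        rw [e2, hB]
        refine h1.seq ?_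
        cases φ.eval w S (scons i v)
        · exact (Runs.case_false (by simp; rfl) (Runs.pop _ _)).conv (by omega)
            (by simp [hs12])
        · exact (Runs.case_true (by simp; rfl) ((Runs.pop _ _).seq ((Runs.pop _ _).seq
            (Runs.push _ _ _)))).conv (by omega) (by simp [hs12])
      · cases j with
        | zero => simp only [scons]; omega
        | succ j => have := hv j; simp only [scons]; omega
  | letrec e φ ψ ih1 ih2 =>
    obtain ⟨p, hp⟩ := ih1
    obtain ⟨p', hp'⟩ := ih2
    obtain ⟨q, hq⟩ := runs_forLoop e
    obtain ⟨r, hr⟩ := e.exists_bound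
    refine ⟨q * (p.comp (.X + r) + (8 * r + 9) + 1) + (p'.comp (.X + r) + (2 * r + 1)),
      fun vs as d w S v s M h hN hv hS => ?_⟩
    have hE := hr _ v M hN hv
    have hd := h.le_d
    have hfree := h.free
    simp only [Form.code, Form.eval, Polynomial.eval_add, Polynomial.eval_mul,
      Polynomial.eval_comp, Polynomial.eval_ofNat, Polynomial.eval_one, Polynomial.eval_X]
    set f : ℕ → List Bool → Bool := fun m L => φ.eval w (scons L S) (scons m v) with hf
    have hτ0 : Function.update s (d + 2) (build f 0) = s := by
      rw [build, ← hfree (d + 2) (by omega), Function.update_eq_self]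
    have hloop := hq vs d w.length v M (.seq (φ.code (scons (d + 1) vs) (scons (d + 2) as) (d + 3))
      (appendBit (d + 2) (d + 3))) (fun i => Function.update s (d + 2) (build f i))
      (p.eval (M + r.eval M) + (8 * r.eval M + 9)) (by rw [hτ0]; exact h.expr) hN hv
      (fun i _ => ?_) (fun i hi => ?_)
    · rw [hτ0] at hloop
      refine hloop.seq ?_
      set E := e.eval w.length v
      set s2 := Function.update s (d + 2) (build f E) with hs2
      have hl : Layout vs (scons (d + 2) as) (d + 3) w (scons (build f E) S) v s2 := by
        refine (h.agree (d' := d + 3) (s' := s2) (by omega) (fun k hk h2 _ => ?_)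
          (fun k hk => ?_)).consArr (by omega) (by simp [hs2])
        · rw [hs2, Function.update_of_ne (by omega)]
        · rw [hs2, Function.update_of_ne (by omega), hfree k (by omega)]
      have h1 := hp' vs (scons (d + 2) as) (d + 3) w _ v s2 (M + r.eval M) hl (by omega)
        (fun j => (hv j).trans (by omega)) (fun j => ?_)
      · refine (h1.seq (runs_clear _ _)).conv ?_ ?_
        · rw [Function.update_of_ne (by omega), hs2, Function.update_self, length_build]
          omega
        · rw [Function.update_comm (by omega : (2 : ℕ) ≠ d + 2), hs2, Function.update_idem,
            ← hfree (d + 2) (by omega), Function.update_eq_self,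
            Function.update_of_ne (by omega)]
      · cases j with
        | zero => simp only [scons, length_build]; omega
        | succ j => have := hS j; simp only [scons]; omega
    · have h1 := hfree d le_rfl
      have h2 := hfree (d + 1) (by omega)
      rw [Function.update_of_ne (by omega), Function.update_of_ne (by omega)]
      exact ⟨h1, h2⟩
    · generalize hs1 : Function.update (Function.update (Function.update s (d + 2) (build f i)) d
        (List.replicate (e.eval w.length v - (i + 1)) true)) (d + 1)
        (List.replicate i true) = s1
      have hs1a : s1 (d + 2) = build f i := by
        rw [← hs1, Function.update_of_ne (by omega), Function.update_of_ne (by omega),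
          Function.update_self]
      have hs1f : ∀ k, d + 3 ≤ k → s1 k = [] := by
        intro k hk
        rw [← hs1, Function.update_of_ne (by omega), Function.update_of_ne (by omega),
            Function.update_of_ne (by omega), hfree k (by omega)]
      have hl : Layout (scons (d + 1) vs) (scons (d + 2) as) (d + 3) w (scons (build f i) S)
          (scons i v) s1 := by
        refine ((h.agree (d' := d + 3) (s' := s1) (by omega) (fun k hk h2 _ => ?_)
          hs1f).consVar (by omega) (by simp [← hs1])).consArr (by omega) hs1a
        rw [← hs1, Function.update_of_ne (by omega), Function.update_of_ne (by omega),
            Function.update_of_ne (by omega)]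
      have h1 := hp _ _ (d + 3) w _ _ s1 (M + r.eval M) hl
        (by omega) (fun j => ?_) (fun j => ?_)
      · have h2 := runs_appendBit (a := d + 2) (d := d + 3) (by omega) (by omega) (by omega)
          (Function.update s1 2 (φ.eval w (scons (build f i) S) (scons i v) :: s1 2)) _ (s1 2)
          (Function.update_self ..) (by rw [Function.update_of_ne (by omega), hs1f _ le_rfl])
        refine (h1.seq h2).conv ?_ ?_
        · rw [Function.update_of_ne (by omega), hs1a, length_build]
          omega
        · rw [Function.update_idem, Function.update_eq_self, Function.update_of_ne (by omega),
            hs1a]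
          rw [← hs1, Function.update_comm (by omega : d + 1 ≠ d + 2),
            Function.update_comm (by omega : d ≠ d + 2), Function.update_idem]
          rfl
      · cases j with
        | zero => simp only [scons]; omega
        | succ j => have := hv j; simp only [scons]; omega
      · cases j with
        | zero => simp only [scons, length_build]; omega
        | succ j => have := hS j; simp only [scons]; omega
  | ren ρ τ φ ih =>
    obtain ⟨p, hp⟩ := ih
    exact ⟨p, fun vs as d w S v s M h hN hv hS => hp _ _ d w _ _ s M (h.ren ρ τ) hN
      (fun i => hv _) (fun j => hS _)⟩

/-! ### Programs with output -/

/-- Output programs: bit strings described by formulas and bounded iteration. -/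
inductive Out : Type
  | nil : Out
  | emit (b : Bool) : Out
  | app (o o' : Out) : Out
  | ite (φ : Form) (o o' : Out) : Out
  /-- The concatenation of the outputs for all values below `e` of the new variable `0`. -/
  | forLt (e : Expr) (o : Out) : Out

/-- The string described by an output program. -/
def Out.eval (w : List Bool) : Out → (ℕ → List Bool) → (ℕ → ℕ) → List Bool
  | .nil, _, _ => []
  | .emit b, _, _ => [b]
  | .app o o', S, v => o.eval w S v ++ o'.eval w S v
  | .ite φ o o', S, v => if φ.eval w S v then o.eval w S v else o'.eval w S v
  | .forLt e o, S, v => (List.range (e.eval w.length v)).flatMap fun i => o.eval w S (scons i v)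

/-- Push the string described by an output program onto stack `3`. -/
def Out.code : Out → (ℕ → ℕ) → (ℕ → ℕ) → ℕ → Cmd
  | .nil, _, _, _ => .skip
  | .emit b, _, _, _ => .push 3 b
  | .app o o', vs, as, d => .seq (o.code vs as d) (o'.code vs as d)
  | .ite φ o o', vs, as, d => .seq (φ.code vs as d)
      (.case 2 .skip (.seq (.pop 2) (o'.code vs as d)) (.seq (.pop 2) (o.code vs as d)))
  | .forLt e o, vs, as, d => forLoop e vs d (o.code (scons (d + 1) vs) as (d + 2))

/-- The string is pushed in order, so that it appears reversed on stack `3`. -/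
theorem Out.runs_code (o : Out) : ∃ p : Polynomial ℕ, ∀ vs as d w S v s M,
    Layout vs as d w S v s → w.length ≤ M → (∀ i, v i ≤ M) → (∀ j, (S j).length ≤ M) →
    Runs (o.code vs as d) s (p.eval M)
      (Function.update s 3 ((o.eval w S v).reverse ++ s 3)) := by
  induction o with
  | nil =>
    refine ⟨1, fun vs as d w S v s M h hN hv hS => ?_⟩
    exact (Runs.skip s).conv (by simp) (by simp [Out.eval])
  | emit b =>
    refine ⟨1, fun vs as d w S v s M h hN hv hS => ?_⟩
    exact (Runs.push _ _ _).conv (by simp) (by simp [Out.eval])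
  | app o o' ih1 ih2 =>
    obtain ⟨p, hp⟩ := ih1
    obtain ⟨q, hq⟩ := ih2
    refine ⟨p + q, fun vs as d w S v s M h hN hv hS => ?_⟩
    have h1 := hp vs as d w S v s M h hN hv hS
    have h2 := hq vs as d w S v _ M (h.update_three ((o.eval w S v).reverse ++ s 3)) hN hv hS
    exact (h1.seq h2).conv (by simp) (by simp [Out.eval])
  | ite φ o o' ih1 ih2 =>
    obtain ⟨p, hp⟩ := ih1
    obtain ⟨q, hq⟩ := ih2
    obtain ⟨r, hr⟩ := φ.runs_code
    refine ⟨r + (2 + (p + q)), fun vs as d w S v s M h hN hv hS => ?_⟩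
    have h0 := hr vs as d w S v s M h hN hv hS
    have h1 := hp vs as d w S v s M h hN hv hS
    have h2 := hq vs as d w S v s M h hN hv hS
    simp only [Out.code, Out.eval, Polynomial.eval_add, Polynomial.eval_ofNat]
    refine h0.seq ?_
    have e2 : ∀ b : Bool, Function.update (Function.update s 2 (b :: s 2)) 2
        (Function.update s 2 (b :: s 2) 2).tail = s := by intro b; simp
    cases φ.eval w S v
    · have h3 := Runs.pop 2 (Function.update s 2 (false :: s 2))
      rw [e2] at h3
      exact (Runs.case_false (by simp; rfl) (h3.seq h2)).conv (by omega) (by simp)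
    · have h3 := Runs.pop 2 (Function.update s 2 (true :: s 2))
      rw [e2] at h3
      exact (Runs.case_true (by simp; rfl) (h3.seq h1)).conv (by omega) (by simp)
  | forLt e o ih =>
    obtain ⟨p, hp⟩ := ih
    obtain ⟨q, hq⟩ := runs_forLoop e
    obtain ⟨r, hr⟩ := e.exists_bound
    refine ⟨q * (p.comp (.X + r) + 1), fun vs as d w S v s M h hN hv hS => ?_⟩
    have hE := hr _ v M hN hv
    have hd := h.le_d
    have hfree := h.free
    simp only [Out.code, Out.eval, Polynomial.eval_add, Polynomial.eval_mul,
      Polynomial.eval_comp, Polynomial.eval_one, Polynomial.eval_X]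
    let B : ℕ → List Bool := fun i => (List.range i).flatMap fun i => o.eval w S (scons i v)
    have hB : ∀ i, B (i + 1) = B i ++ o.eval w S (scons i v) := by
      intro i; simp [B, List.range_succ]
    have hB0 : Function.update s 3 ((B 0).reverse ++ s 3) = s := by simp [B]
    have hloop := hq vs d w.length v M (o.code (scons (d + 1) vs) as (d + 2))
      (fun i => Function.update s 3 ((B i).reverse ++ s 3)) (p.eval (M + r.eval M))
      (h.update_three _).expr hN hv (fun i _ => ?_) (fun i hi => ?_)
    · rw [hB0] at hloop
      exact hloop
    · have h1 := hfree d le_rfl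
      have h2 := hfree (d + 1) (by omega)
      rw [Function.update_of_ne (by omega), Function.update_of_ne (by omega)]
      exact ⟨h1, h2⟩
    · generalize hs1 : Function.update (Function.update (Function.update s 3
        ((B i).reverse ++ s 3)) d
        (List.replicate (e.eval w.length v - (i + 1)) true)) (d + 1)
        (List.replicate i true) = s1
      have hs13 : s1 3 = (B i).reverse ++ s 3 := by
        rw [← hs1, Function.update_of_ne (by omega), Function.update_of_ne (by omega),
          Function.update_self]
      have hl : Layout (scons (d + 1) vs) as (d + 2) w S (scons i v) s1 := by
        refine (h.agree (d' := d + 2) (s' := s1) (by omega) (fun k hk _ h3 => ?_)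
          (fun k hk => ?_)).consVar (by omega) (by simp [← hs1])
        · rw [← hs1, Function.update_of_ne (by omega), Function.update_of_ne (by omega),
            Function.update_of_ne h3]
        · rw [← hs1, Function.update_of_ne (by omega), Function.update_of_ne (by omega),
            Function.update_of_ne (by omega), hfree k (by omega)]
      have h1 := hp (scons (d + 1) vs) as (d + 2) w S (scons i v) s1 (M + r.eval M) hl
        (by omega) (fun j => ?_) (fun j => (hS j).trans (by omega))
      · refine h1.conv le_rfl ?_
        rw [hB, hs13, List.reverse_append, List.append_assoc, ← hs1,
          Function.update_comm (by omega : d + 1 ≠ 3), Function.update_comm (by omega : d ≠ 3),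
          Function.update_idem]
      · cases j with
        | zero => simp only [scons]; omega
        | succ j => have := hv j; simp only [scons]; omega

/-- Compute the length of the string on stack `0` in unary on stack `1`, using the empty
stack `5`. -/
def initLength : Cmd :=
  .seq (pour 0 5) (.loop 5 (.case 5 .skip
    (.seq (.pop 5) (.seq (.push 0 false) (.push 1 true)))
    (.seq (.pop 5) (.seq (.push 0 true) (.push 1 true)))))

theorem runs_initLength (s : Store) (h1 : s 1 = []) (h5 : s 5 = []) :
    Runs initLength s (9 * (s 0).length + 2)
      (Function.update s 1 (List.replicate (s 0).length true)) := by
  have key : ∀ (l : List Bool) (s : Store), s 5 = l →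
      Runs (.loop 5 (.case 5 .skip
        (.seq (.pop 5) (.seq (.push 0 false) (.push 1 true)))
        (.seq (.pop 5) (.seq (.push 0 true) (.push 1 true))))) s (5 * l.length + 1)
        (Function.update (Function.update (Function.update s 5 []) 0 (l.reverse ++ s 0)) 1
          (List.replicate l.length true ++ s 1)) := by
    intro l
    induction l with
    | nil =>
      intro s hs
      refine (Runs.loop_nil hs).conv (by simp) ?_
      funext k; simp only [Function.update_apply]; split_ifs <;> simp_all
    | cons b l ih =>
      intro s hs
      have h1 : Runs (.case 5 .skip
        (.seq (.pop 5) (.seq (.push 0 false) (.push 1 true)))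
        (.seq (.pop 5) (.seq (.push 0 true) (.push 1 true)))) s 4
        (Function.update (Function.update (Function.update s 5 l) 0 (b :: s 0)) 1
          (true :: s 1)) := by
        cases b
        · refine (Runs.case_false hs ((Runs.pop _ _).seq ((Runs.push _ _ _).seq
            (Runs.push _ _ _)))).conv le_rfl ?_
          funext k; simp only [Function.update_apply]; split_ifs <;> simp_all
        · refine (Runs.case_true hs ((Runs.pop _ _).seq ((Runs.push _ _ _).seq
            (Runs.push _ _ _)))).conv le_rfl ?_
          funext k; simp only [Function.update_apply]; split_ifs <;> simp_all
      refine (Runs.loop_cons hs h1 (ih _ (by simp))).conv (by simp; omega) ?_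
      funext k; simp only [Function.update_apply]
      split_ifs <;> simp_all [List.replicate_succ']
  refine ((runs_pour (by omega) s).seq (key (s 0).reverse _ (by simp [h5]))).conv
    (by simp; omega) ?_
  funext k; simp only [Function.update_apply]; split_ifs <;> simp_all

/-- The complete program of an output program: the input is on stack `0`, the output on
stack `4`. -/
def Out.program (o : Out) : Cmd :=
  .seq initLength (.seq (o.code (fun _ => 4) (fun _ => 4) 5)
    (.seq (clear 0) (.seq (clear 1) (pour 3 4))))

/-- A stack grows by at most one element per step. -/
theorem Exec.length_le {c s t s'} (h : Exec c s t s') (k : ℕ) :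
    (s' k).length ≤ (s k).length + t := by
  induction h with
  | skip s => omega
  | push j b s =>
    rw [Function.update_apply]; split_ifs with hk
    · simp [hk]
    · omega
  | pop j s =>
    rw [Function.update_apply]; split_ifs with hk
    · simp [hk]; omega
    · omega
  | _ => omega

/-- The function described by an output program is computable in polynomial time. -/
theorem Out.computable {α β : Type} (ea : α → List Bool) (eb : β → List Bool) (f : α → β)
    (o : Out) (h : ∀ a, eb (f a) = o.eval (ea a) (fun _ => []) (fun _ => 0)) :
    Nonempty (Turing.TM2ComputableInPolyTime ea eb f) := by
  obtain ⟨p, hp⟩ := o.runs_code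
  refine computable_of_exec ea eb f o.program 0 4
    (9 * .X + 2 + (p + (2 * .X + 1 + (2 * .X + 1 + (4 * p + 1))))) fun a => ?_
  rw [h]
  generalize ea a = w
  set s1 : Store := Function.update (single 0 w) 1 (List.replicate w.length true) with hs1
  set R := o.eval w (fun _ => []) (fun _ => 0)
  have h1 := runs_initLength (single 0 w) (by simp [single]) (by simp [single])
  have e0 : single 0 w 0 = w := by simp [single]
  rw [e0] at h1
  have hl : Layout (fun _ => 4) (fun _ => 4) 5 w (fun _ => []) (fun _ => 0) s1 :=
    { le_d := le_rfl
      vs_mem := by simp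
      as_mem := by simp
      input := by simp [hs1, single]
      length := by simp [hs1]
      var := by simp [hs1, single]
      arr := by simp [hs1, single]
      free := fun k hk => by
        rw [hs1, single, Function.update_of_ne (by omega), Function.update_of_ne (by omega)] }
  have h2 := hp _ _ 5 w _ _ s1 w.length hl le_rfl (by simp) (by simp)
  have h13 : s1 3 = [] := by simp [hs1, single]
  have hR : R.length ≤ p.eval w.length := by
    obtain ⟨t, ht, h3⟩ := h2
    have := h3.length_le 3
    simp [h13] at this
    exact this.trans ht
  rw [h13, List.append_nil] at h2
  obtain ⟨t, ht, h3⟩ := h1.seq (h2.seq ((runs_clear 0 _).seq ((runs_clear 1 _).seq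
    (runs_pour (a := 3) (b := 4) (by omega) _))))
  refine ⟨t, ht.trans ?_, ?_⟩
  · simp [hs1, single]
    omega
  · convert h3 using 1
    · rfl
    · funext k
      simp only [hs1, single, Function.update_apply]
      split_ifs <;> simp_all [R]

end StackProg

/-! ### Polynomial-time predicates, number functions and string functions -/

namespace PolyTime

open StackProg

/-- A type of contexts: its elements determine an input string, bit arrays, and numbers, to which
formulas can refer. -/
class Ctx (α : Type) where
  inp : α → List Bool
  arrs : α → ℕ → List Bool
  vars : α → ℕ → ℕ

/-- A context can be extended by a number, or by a bit array. -/
class CtxExt (γ : Type) where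
  arrs : γ → (ℕ → List Bool) → (ℕ → List Bool)
  vars : γ → (ℕ → ℕ) → (ℕ → ℕ)
  /-- The renaming of arrays that forgets the extension. -/
  arrShift : ℕ → ℕ
  /-- The renaming of variables that forgets the extension. -/
  varShift : ℕ → ℕ
  arrs_shift : ∀ c f, arrs c f ∘ arrShift = f
  vars_shift : ∀ c f, vars c f ∘ varShift = f

/-- The new number is variable `0`. -/
instance : CtxExt ℕ where
  arrs _ f := f
  vars n f := scons n f
  arrShift i := i
  varShift i := i + 1
  arrs_shift _ _ := rfl
  vars_shift _ _ := rfl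

/-- The new array is array `0`. -/
instance : CtxExt (List Bool) where
  arrs L f := scons L f
  vars _ f := f
  arrShift i := i + 1
  varShift i := i
  arrs_shift _ _ := rfl
  vars_shift _ _ := rfl

/-- An extended context is a pair of a context and an extension. -/
instance {α γ : Type} [Ctx α] [CtxExt γ] : Ctx (α × γ) where
  inp p := Ctx.inp p.1
  arrs p := CtxExt.arrs p.2 (Ctx.arrs p.1)
  vars p := CtxExt.vars p.2 (Ctx.vars p.1)

/-- The truth of a formula in a context. -/
def holds {α : Type} [Ctx α] (φ : Form) (a : α) : Prop :=
  φ.eval (Ctx.inp a) (Ctx.arrs a) (Ctx.vars a) = true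

/-- The value of an expression in a context. -/
def value {α : Type} [Ctx α] (e : Expr) (a : α) : ℕ := e.eval (Ctx.inp a).length (Ctx.vars a)

/-- A predicate of contexts that is decidable in polynomial time, being given by a formula. -/
def PTPred {α : Type} [Ctx α] (Φ : α → Prop) : Prop := ∃ φ : Form, ∀ a, holds φ a ↔ Φ a

/-- A number-valued function of contexts that is bounded by a polynomial expression and whose graph
is given by a formula. -/
def PTFun {α : Type} [Ctx α] (f : α → ℕ) : Prop :=
  (∃ e : Expr, ∀ a, f a < value e a) ∧ PTPred fun p : α × ℕ => p.2 = f p.1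

/-- A string-valued function of contexts that is given by an output program. -/
def PTStr {α : Type} [Ctx α] (g : α → List Bool) : Prop :=
  ∃ o : Out, ∀ a : α, o.eval (Ctx.inp a) (Ctx.arrs a) (Ctx.vars a) = g a

/-- A map of contexts that only renames arrays and variables. -/
def IsRenaming {β α : Type} [Ctx β] [Ctx α] (g : β → α) : Prop :=
  ∃ ρ τ : ℕ → ℕ, ∀ b, Ctx.inp (g b) = Ctx.inp b ∧ Ctx.arrs (g b) = Ctx.arrs b ∘ τ ∧
    Ctx.vars (g b) = Ctx.vars b ∘ ρ

variable {α β γ δ : Type} [Ctx α] [Ctx β] [CtxExt γ] [CtxExt δ]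

theorem IsRenaming.fst : IsRenaming (Prod.fst : α × γ → α) :=
  ⟨CtxExt.varShift γ, CtxExt.arrShift γ, fun b =>
    ⟨rfl, (CtxExt.arrs_shift b.2 _).symm, (CtxExt.vars_shift b.2 _).symm⟩⟩

theorem IsRenaming.lift_nat {g : β → α} (hg : IsRenaming g) :
    IsRenaming fun p : β × ℕ => (g p.1, p.2) := by
  obtain ⟨ρ, τ, h⟩ := hg
  refine ⟨fun i => Nat.casesOn i 0 fun i => ρ i + 1, τ, fun b => ⟨(h b.1).1, (h b.1).2.1, ?_⟩⟩
  funext i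
  cases i with
  | zero => rfl
  | succ i => exact congrFun (h b.1).2.2 i

theorem IsRenaming.lift_list {g : β → α} (hg : IsRenaming g) :
    IsRenaming fun p : β × List Bool => (g p.1, p.2) := by
  obtain ⟨ρ, τ, h⟩ := hg
  refine ⟨ρ, fun i => Nat.casesOn i 0 fun i => τ i + 1, fun b => ⟨(h b.1).1, ?_, (h b.1).2.2⟩⟩
  funext i
  cases i with
  | zero => rfl
  | succ i => exact congrFun (h b.1).2.1 i

theorem IsRenaming.comp {ε : Type} [Ctx ε] {g : β → α} {h : ε → β} (hg : IsRenaming g)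
    (hh : IsRenaming h) : IsRenaming fun c => g (h c) := by
  obtain ⟨ρ, τ, hg⟩ := hg
  obtain ⟨ρ', τ', hh⟩ := hh
  refine ⟨ρ' ∘ ρ, τ' ∘ τ, fun c => ⟨(hg _).1.trans (hh _).1, ?_, ?_⟩⟩
  · rw [(hg _).2.1, (hh _).2.1]; rfl
  · rw [(hg _).2.2, (hh _).2.2]; rfl

namespace PTPred

theorem congr {Φ Ψ : α → Prop} (h : PTPred Φ) (e : ∀ a, Ψ a ↔ Φ a) : PTPred Ψ :=
  let ⟨φ, hφ⟩ := h; ⟨φ, fun a => (hφ a).trans (e a).symm⟩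

theorem comap {Φ : α → Prop} (h : PTPred Φ) {g : β → α} (hg : IsRenaming g) :
    PTPred fun b => Φ (g b) := by
  obtain ⟨φ, hφ⟩ := h
  obtain ⟨ρ, τ, hg⟩ := hg
  refine ⟨.ren ρ τ φ, fun b => ?_⟩
  beta_reduce
  rw [← hφ (g b)]
  simp [holds, Form.eval, hg b]

theorem fst {Φ : α → Prop} (h : PTPred Φ) : PTPred fun p : α × γ => Φ p.1 := h.comap .fst

theorem not {Φ : α → Prop} (h : PTPred Φ) : PTPred fun a => ¬ Φ a := by
  obtain ⟨φ, hφ⟩ := h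
  exact ⟨.neg φ, fun a => by beta_reduce; rw [← hφ a]; simp [holds, Form.eval]⟩

theorem and {Φ Ψ : α → Prop} (h : PTPred Φ) (h' : PTPred Ψ) : PTPred fun a => Φ a ∧ Ψ a := by
  obtain ⟨φ, hφ⟩ := h
  obtain ⟨ψ, hψ⟩ := h'
  exact ⟨.and φ ψ, fun a => by beta_reduce; rw [← hφ a, ← hψ a]; simp [holds, Form.eval]⟩

theorem or {Φ Ψ : α → Prop} (h : PTPred Φ) (h' : PTPred Ψ) : PTPred fun a => Φ a ∨ Ψ a :=
  (h.not.and h'.not).not.congr fun a => by tauto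

theorem imp {Φ Ψ : α → Prop} (h : PTPred Φ) (h' : PTPred Ψ) : PTPred fun a => Φ a → Ψ a :=
  (h.and h'.not).not.congr fun a => by tauto

theorem iff {Φ Ψ : α → Prop} (h : PTPred Φ) (h' : PTPred Ψ) : PTPred fun a => (Φ a ↔ Ψ a) :=
  ((h.imp h').and (h'.imp h)).congr fun a => by tauto

theorem const (P : Prop) : PTPred fun _ : α => P := by
  by_cases h : P
  · exact ⟨.lt (.const 0) (.const 1), fun a => by simp [holds, Form.eval, Expr.eval, h]⟩
  · exact ⟨.lt (.const 0) (.const 0), fun a => by simp [holds, Form.eval, Expr.eval, h]⟩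

theorem lt_expr (e f : Expr) : PTPred fun a : α => value e a < value f a :=
  ⟨.lt e f, fun a => by simp [holds, Form.eval, value]⟩

theorem eq_expr (e f : Expr) : PTPred fun a : α => value e a = value f a :=
  ((lt_expr e f).not.and (lt_expr f e).not).congr fun a => by omega

theorem ex_expr (e : Expr) {Φ : α → ℕ → Prop} (h : PTPred fun p : α × ℕ => Φ p.1 p.2) :
    PTPred fun a => ∃ i < value e a, Φ a i := by
  obtain ⟨φ, hφ⟩ := h
  refine ⟨.ex e φ, fun a => ?_⟩
  simp only [holds, Form.eval, List.any_eq_true, List.mem_range]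
  exact exists_congr fun i => and_congr Iff.rfl (hφ (a, i))

end PTPred

/-- Renaming of the variables of an expression. -/
theorem exists_value_comap (e : Expr) {g : β → α} (hg : IsRenaming g) :
    ∃ e' : Expr, ∀ b, value e' b = value e (g b) := by
  obtain ⟨ρ, τ, hg⟩ := hg
  induction e with
  | len => exact ⟨.len, fun b => by simp [value, Expr.eval, hg b]⟩
  | const c => exact ⟨.const c, fun b => rfl⟩
  | var i => exact ⟨.var (ρ i), fun b => by simp [value, Expr.eval, hg b]⟩
  | add e f ihe ihf =>
    obtain ⟨e', he⟩ := ihe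
    obtain ⟨f', hf⟩ := ihf
    exact ⟨.add e' f', fun b => congrArg₂ (· + ·) (he b) (hf b)⟩
  | mul e f ihe ihf =>
    obtain ⟨e', he⟩ := ihe
    obtain ⟨f', hf⟩ := ihf
    exact ⟨.mul e' f', fun b => congrArg₂ (· * ·) (he b) (hf b)⟩

theorem PTFun.comap {f : α → ℕ} (h : PTFun f) {g : β → α} (hg : IsRenaming g) :
    PTFun fun b => f (g b) := by
  obtain ⟨⟨e, he⟩, hf⟩ := h
  obtain ⟨e', he'⟩ := exists_value_comap e hg
  exact ⟨⟨e', fun b => by rw [he']; exact he _⟩, hf.comap hg.lift_nat⟩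

theorem PTFun.fst {f : α → ℕ} (h : PTFun f) : PTFun fun p : α × γ => f p.1 := h.comap .fst

namespace PTPred

/-- Substitution of a polynomially bounded function. -/
theorem subst {f : α → ℕ} (hf : PTFun f) {Φ : α → ℕ → Prop}
    (h : PTPred fun p : α × ℕ => Φ p.1 p.2) : PTPred fun a => Φ a (f a) := by
  obtain ⟨⟨e, he⟩, hg⟩ := hf
  refine (ex_expr e (Φ := fun a y => y = f a ∧ Φ a y) (hg.and h)).congr
    fun a => ⟨fun hΦ => ⟨f a, he a, rfl, hΦ⟩, ?_⟩
  rintro ⟨_, _, rfl, hΦ⟩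
  exact hΦ

/-- Substitution of two polynomially bounded functions. -/
theorem subst₂ {f g : α → ℕ} (hf : PTFun f) (hg : PTFun g) {Φ : α → ℕ → ℕ → Prop}
    (h : PTPred fun p : (α × ℕ) × ℕ => Φ p.1.1 p.1.2 p.2) : PTPred fun a => Φ a (f a) (g a) :=
  subst (Φ := fun a x => Φ a x (g a)) hf (subst (Φ := fun p y => Φ p.1 p.2 y) hg.fst h)

theorem lt {f g : α → ℕ} (hf : PTFun f) (hg : PTFun g) : PTPred fun a => f a < g a :=
  subst₂ (Φ := fun _ x y => x < y) hf hg (lt_expr (.var 1) (.var 0))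

theorem le {f g : α → ℕ} (hf : PTFun f) (hg : PTFun g) : PTPred fun a => f a ≤ g a :=
  (lt hg hf).not.congr fun a => by omega

theorem eq {f g : α → ℕ} (hf : PTFun f) (hg : PTFun g) : PTPred fun a => f a = g a :=
  subst₂ (Φ := fun _ x y => x = y) hf hg (eq_expr (.var 1) (.var 0))

end PTPred

namespace PTFun

theorem congr {f g : α → ℕ} (h : PTFun f) (e : ∀ a, g a = f a) : PTFun g := by
  rwa [show g = f from funext e]

theorem of_expr (e : Expr) : PTFun fun a : α => value e a := by
  refine ⟨⟨.add e (.const 1), fun a => Nat.lt_succ_self _⟩, ?_⟩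
  obtain ⟨e', he'⟩ := exists_value_comap e (IsRenaming.fst (α := α) (γ := ℕ))
  exact (PTPred.eq_expr (.var 0) e').congr fun p => by rw [he']; rfl

/-- The newest number of a context. -/
theorem snd : PTFun fun p : α × ℕ => p.2 := of_expr (.var 0)

theorem var₁ : PTFun fun p : (α × ℕ) × γ => p.1.2 := snd.fst

theorem var₂ {γ' : Type} [CtxExt γ'] : PTFun fun p : ((α × ℕ) × γ) × γ' => p.1.1.2 := var₁.fst

theorem const (c : ℕ) : PTFun fun _ : α => c := of_expr (.const c)

theorem length_inp : PTFun fun a : α => (Ctx.inp a).length := of_expr .len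

/-- A function is polynomially bounded if it lies below such a function. -/
theorem of_graph {f g : α → ℕ} (hg : PTFun g) (h : ∀ a, f a ≤ g a)
    (hf : PTPred fun p : α × ℕ => p.2 = f p.1) : PTFun f :=
  let ⟨⟨e, he⟩, _⟩ := hg
  ⟨⟨e, fun a => (h a).trans_lt (he a)⟩, hf⟩

theorem add {f g : α → ℕ} (hf : PTFun f) (hg : PTFun g) : PTFun fun a => f a + g a := by
  refine ⟨?_, ?_⟩
  · obtain ⟨⟨b, hb⟩, _⟩ := hf
    obtain ⟨⟨c, hc⟩, _⟩ := hg
    exact ⟨.add b c, fun a => add_lt_add (hb a) (hc a)⟩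
  · exact PTPred.subst₂ (Φ := fun p x y => p.2 = x + y) hf.fst hg.fst
      (PTPred.eq_expr (.var 2) (.add (.var 1) (.var 0)))

theorem mul {f g : α → ℕ} (hf : PTFun f) (hg : PTFun g) : PTFun fun a => f a * g a := by
  refine ⟨?_, ?_⟩
  · obtain ⟨⟨b, hb⟩, _⟩ := hf
    obtain ⟨⟨c, hc⟩, _⟩ := hg
    exact ⟨.mul b c, fun a => Nat.mul_lt_mul'' (hb a) (hc a)⟩
  · exact PTPred.subst₂ (Φ := fun p x y => p.2 = x * y) hf.fst hg.fst
      (PTPred.eq_expr (.var 2) (.mul (.var 1) (.var 0)))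

theorem pow {f : α → ℕ} (hf : PTFun f) (k : ℕ) : PTFun fun a => f a ^ k := by
  induction k with
  | zero => exact (const 1).congr fun a => pow_zero _
  | succ k ih => exact (ih.mul hf).congr fun a => pow_succ _ _

theorem sum {ι : Type*} (l : List ι) {f : α → ι → ℕ} (hf : ∀ i, PTFun fun a => f a i) :
    PTFun fun a => (l.map (f a)).sum := by
  induction l with
  | nil => exact const 0
  | cons i l ih => exact ((hf i).add ih).congr fun a => by simp

/-- The sum of the two functions is a bound for both. -/
theorem ite {P : α → Prop} [DecidablePred P] {f g : α → ℕ} (hP : PTPred P) (hf : PTFun f)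
    (hg : PTFun g) : PTFun fun a => if P a then f a else g a := by
  refine of_graph (hf.add hg) (fun a => by split_ifs <;> omega) ?_
  refine ((hP.fst.and (.eq snd hf.fst)).or (hP.fst.not.and (.eq snd hg.fst))).congr fun p => ?_
  split_ifs with h <;> simp [h]

theorem sub {f g : α → ℕ} (hf : PTFun f) (hg : PTFun g) : PTFun fun a => f a - g a := by
  refine of_graph hf (fun a => Nat.sub_le _ _) ?_
  refine (((PTPred.le hf.fst hg.fst).and (.eq snd (const 0))).or
    ((PTPred.lt hg.fst hf.fst).and (.eq (snd.add hg.fst) hf.fst))).congr fun p => ?_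
  omega

theorem div {f g : α → ℕ} (hf : PTFun f) (hg : PTFun g) : PTFun fun a => f a / g a := by
  refine of_graph hf (fun a => Nat.div_le_self _ _) ?_
  refine (((PTPred.eq hg.fst (const 0)).and (.eq snd (const 0))).or
    ((PTPred.lt (const 0) hg.fst).and ((PTPred.le (snd.mul hg.fst) hf.fst).and
      (PTPred.lt hf.fst ((snd.add (const 1)).mul hg.fst))))).congr fun p => ?_
  obtain ⟨a, y⟩ := p
  dsimp only
  rcases Nat.eq_zero_or_pos (g a) with h | h
  · simp [h]
  · simp only [h.ne', false_and, h, true_and, false_or]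
    rw [eq_comm, Nat.div_eq_iff h]
    have : (y + 1) * g a = y * g a + g a := by ring
    rw [this]
    omega

theorem mod {f g : α → ℕ} (hf : PTFun f) (hg : PTFun g) : PTFun fun a => f a % g a :=
  (hf.sub (hg.mul (hf.div hg))).congr fun _ => Nat.mod_eq_sub_mul_div

end PTFun

namespace PTPred

theorem ex {f : α → ℕ} (hf : PTFun f) {Φ : α → ℕ → Prop}
    (h : PTPred fun p : α × ℕ => Φ p.1 p.2) : PTPred fun a => ∃ i < f a, Φ a i := by
  obtain ⟨⟨e, he⟩, _⟩ := id hf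
  refine (ex_expr e (Φ := fun a i => i < f a ∧ Φ a i) ((PTPred.lt .snd hf.fst).and h)).congr
    fun a => exists_congr fun i => ⟨fun h => ⟨h.1.trans (he a), h⟩, fun h => h.2⟩

theorem all {f : α → ℕ} (hf : PTFun f) {Φ : α → ℕ → Prop}
    (h : PTPred fun p : α × ℕ => Φ p.1 p.2) : PTPred fun a => ∀ i < f a, Φ a i :=
  (ex hf (Φ := fun a i => ¬ Φ a i) h.not).not.congr fun a => by push Not; rfl

theorem exists_mem {ι : Type*} (l : List ι) {Φ : α → ι → Prop} (h : ∀ i, PTPred fun a => Φ a i) :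
    PTPred fun a => ∃ i ∈ l, Φ a i := by
  induction l with
  | nil => exact (const False).congr fun a => by simp
  | cons i l ih => exact ((h i).or ih).congr fun a => by simp

theorem forall_mem {ι : Type*} (l : List ι) {Φ : α → ι → Prop} (h : ∀ i, PTPred fun a => Φ a i) :
    PTPred fun a => ∀ i ∈ l, Φ a i :=
  (exists_mem l fun i => (h i).not).not.congr fun a => by simp

theorem exists_fintype {ι : Type*} [Finite ι] {Φ : α → ι → Prop} (h : ∀ i, PTPred fun a => Φ a i) :
    PTPred fun a => ∃ i, Φ a i := by
  have := Fintype.ofFinite ι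
  exact (exists_mem Finset.univ.toList h).congr fun a => by simp

theorem forall_fintype {ι : Type*} [Finite ι] {Φ : α → ι → Prop} (h : ∀ i, PTPred fun a => Φ a i) :
    PTPred fun a => ∀ i, Φ a i :=
  (exists_fintype fun i => (h i).not).not.congr fun a => by simp

/-- Every Boolean combination of finitely many predicates is one of them. -/
theorem comb {ι : Type*} [Finite ι] (g : (ι → Prop) → Prop) {Φ : α → ι → Prop}
    (h : ∀ i, PTPred fun a => Φ a i) : PTPred fun a => g (Φ a) := by
  refine (exists_fintype (ι := ι → Prop) (Φ := fun a b => g b ∧ ∀ i, (Φ a i ↔ b i)) fun b =>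
    (const (g b)).and (forall_fintype fun i => (h i).iff (const (b i)))).congr fun a => ?_
  refine ⟨fun hg => ⟨Φ a, hg, fun i => Iff.rfl⟩, ?_⟩
  rintro ⟨b, hb, h⟩
  rwa [show Φ a = b from funext fun i => propext (h i)]

/-- Access to the input. -/
theorem inp {f : α → ℕ} (hf : PTFun f) : PTPred fun a => (Ctx.inp a).getD (f a) false = true :=
  subst (Φ := fun a x => (Ctx.inp a).getD x false = true) hf
    ⟨.inp (.var 0), fun _ => Iff.rfl⟩

/-- Access to the newest array. -/
theorem arr {f : α × List Bool → ℕ} (hf : PTFun f) :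
    PTPred fun p : α × List Bool => p.2.getD (f p) false = true :=
  subst (Φ := fun p x => p.2.getD x false = true) hf ⟨.arr 0 (.var 0), fun _ => Iff.rfl⟩

/-- A predicate of an array, applied to an array defined by recursion. -/
theorem letrec {f : α → ℕ → List Bool → Bool}
    (hf : PTPred fun p : (α × List Bool) × ℕ => f p.1.1 p.2 p.1.2 = true)
    {n : α → ℕ} (hn : PTFun n) {Θ : α → List Bool → Prop}
    (hΘ : PTPred fun p : α × List Bool => Θ p.1 p.2) :
    PTPred fun a => Θ a (build (f a) (n a)) := by
  refine subst (Φ := fun a x => Θ a (build (f a) x)) hn ?_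
  obtain ⟨φ, hφ⟩ := hf.comap (IsRenaming.lift_nat (IsRenaming.lift_list
    (IsRenaming.fst (α := α) (γ := ℕ))))
  obtain ⟨θ, hθ⟩ := hΘ.comap (IsRenaming.lift_list (IsRenaming.fst (α := α) (γ := ℕ)))
  refine ⟨.letrec (.var 0) φ θ, fun p => ?_⟩
  have e : (fun m L => φ.eval (Ctx.inp p) (scons L (Ctx.arrs p)) (scons m (Ctx.vars p))) =
      f p.1 := by
    funext m L
    exact Bool.eq_iff_iff.2 (hφ ((p, L), m))
  refine Iff.trans ?_ (hθ (p, build (f p.1) p.2))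
  simp only [holds, Form.eval, e]
  rfl

end PTPred

namespace PTStr

theorem congr {f g : α → List Bool} (h : PTStr f) (e : ∀ a, g a = f a) : PTStr g := by
  rwa [show g = f from funext e]

theorem nil : PTStr fun _ : α => [] := ⟨.nil, fun _ => rfl⟩

theorem singleton (b : Bool) : PTStr fun _ : α => [b] := ⟨.emit b, fun _ => rfl⟩

theorem append {f g : α → List Bool} (hf : PTStr f) (hg : PTStr g) : PTStr fun a => f a ++ g a := by
  obtain ⟨o, ho⟩ := hf
  obtain ⟨o', ho'⟩ := hg
  exact ⟨.app o o', fun a => by rw [Out.eval, ho, ho']⟩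

theorem ite {P : α → Prop} [DecidablePred P] {f g : α → List Bool} (hP : PTPred P) (hf : PTStr f)
    (hg : PTStr g) : PTStr fun a => if P a then f a else g a := by
  obtain ⟨o, ho⟩ := hf
  obtain ⟨o', ho'⟩ := hg
  obtain ⟨φ, hφ⟩ := hP
  refine ⟨.ite φ o o', fun a => ?_⟩
  rw [Out.eval, ho, ho']
  have := hφ a
  unfold holds at this
  simp only [this]

theorem flatMap_range {n : α → ℕ} (hn : PTFun n) {g : α → ℕ → List Bool}
    (hg : PTStr fun p : α × ℕ => g p.1 p.2) :
    PTStr fun a => (List.range (n a)).flatMap (g a) := by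
  obtain ⟨⟨e, he⟩, _⟩ := id hn
  obtain ⟨o, ho⟩ := ite (PTPred.lt .snd hn.fst) hg nil
  refine ⟨.forLt e o, fun a => ?_⟩
  have h1 : Out.eval (Ctx.inp a) (.forLt e o) (Ctx.arrs a) (Ctx.vars a) =
      (List.range (value e a)).flatMap fun i => if i < n a then g a i else [] := by
    rw [Out.eval]
    exact congrArg (fun h => List.flatMap h _) (funext fun i => ho (a, i))
  obtain ⟨k, hk⟩ := Nat.exists_eq_add_of_le (he a).le
  rw [h1, hk, List.range_add, List.flatMap_append]
  have h2 : (List.map (n a + ·) (List.range k)).flatMap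
      (fun i => if i < n a then g a i else []) = [] := by
    rw [List.flatMap_eq_nil_iff]; intro x hx
    obtain ⟨y, _, rfl⟩ := List.mem_map.1 hx
    rw [if_neg (by omega)]
  rw [h2, List.append_nil]
  refine List.flatMap_congr fun i hi => ?_
  rw [if_pos (List.mem_range.1 hi)]

theorem replicate {n : α → ℕ} (hn : PTFun n) (b : Bool) :
    PTStr fun a => List.replicate (n a) b := by
  refine (flatMap_range hn (g := fun _ _ => [b]) (singleton b)).congr fun a => ?_
  induction n a with
  | zero => rfl
  | succ n ih => rw [List.range_succ, List.flatMap_append, ← ih, List.replicate_succ']; rfl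

theorem flatMap {ι : Type*} (l : List ι) {g : α → ι → List Bool}
    (hg : ∀ i, PTStr fun a => g a i) : PTStr fun a => l.flatMap (g a) := by
  induction l with
  | nil => exact nil
  | cons i l ih => exact ((hg i).append ih).congr fun a => by simp

end PTStr

end PolyTime

/-! ### Iterated and least fixed point definitions -/

namespace PolyTime

open StackProg

/-- The `s`-th iterate of an operator `F` on subsets of `{0, …, B - 1}`, starting with `I`. -/
def iter (B : ℕ) (I : ℕ → Prop) (F : (ℕ → Prop) → ℕ → Prop) : ℕ → ℕ → Prop
  | 0 => fun x => x < B ∧ I x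
  | s + 1 => fun x => x < B ∧ F (iter B I F s) x

theorem iter_lt {B I F s x} (h : iter B I F s x) : x < B := by
  cases s <;> exact h.1

/-- The entries of an array defined by recursion satisfy the recursion. -/
theorem getD_build (f : ℕ → List Bool → Bool) (n m : ℕ) (h : m < n) :
    (build f n).getD m false = f m (build f m) := by
  induction n with
  | zero => omega
  | succ n ih =>
    rw [build]
    rcases Nat.lt_succ_iff_lt_or_eq.1 h with h | rfl
    · rw [List.getD_append _ _ _ _ (by rwa [length_build]), ih h]
    · rw [List.getD_append_right _ _ _ _ (by rw [length_build]), length_build]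
      simp

theorem getD_build_of_le (f : ℕ → List Bool → Bool) (n m : ℕ) (h : n ≤ m) :
    (build f n).getD m false = false :=
  List.getD_eq_default _ _ (by rwa [length_build])

variable {α β : Type} [Ctx α] [Ctx β]

namespace PTPred

/-- Access to an array of the context. -/
theorem arr_of_renaming {g : β → α × List Bool} (hg : IsRenaming g) {f : β → ℕ} (hf : PTFun f) :
    PTPred fun b => (g b).2.getD (f b) false = true :=
  subst (Φ := fun b x => (g b).2.getD x false = true) hf
    ((show PTPred fun q : (α × List Bool) × ℕ => q.1.2.getD q.2 false = true from
      ⟨.arr 0 (.var 0), fun _ => Iff.rfl⟩).comap hg.lift_nat)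

open Classical in
/-- The iterates of a definable operator are computed in one array, stage after stage: position
`s * B + x` holds the truth value for `x` at stage `s`. -/
theorem iter {B s x : α → ℕ} (hB : PTFun B) (hs : PTFun s) (hx : PTFun x) {I : α → ℕ → Prop}
    (hI : PTPred fun p : α × ℕ => I p.1 p.2) {F : α → (ℕ → Prop) → ℕ → Prop}
    (hF : PTPred fun p : (α × List Bool) × ℕ =>
      F p.1.1 (fun y => p.1.2.getD y false = true) p.2) :
    PTPred fun a => PolyTime.iter (B a) (I a) (F a) (s a) (x a) := by
  let slice : (α × List Bool) × ℕ → ℕ → List Bool → Bool :=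
    fun q y _ => q.1.2.getD ((q.2 / B q.1.1 - 1) * B q.1.1 + y) false
  let f : α → ℕ → List Bool → Bool := fun a m L => decide
    ((m < B a ∧ I a m) ∨ (B a ≤ m ∧
      F a (fun y => (build (slice ((a, L), m)) (B a)).getD y false = true) (m % B a)))
  have hf : PTPred fun p : (α × List Bool) × ℕ => f p.1.1 p.2 p.1.2 = true := by
    have hB' : PTFun fun p : (α × List Bool) × ℕ => B p.1.1 := hB.fst.fst
    have h1 : PTPred fun p : (α × List Bool) × ℕ => F p.1.1
        (fun y => (build (slice p) (B p.1.1)).getD y false = true) (p.2 % B p.1.1) := by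
      refine letrec (Θ := fun p L => F p.1.1 (fun y => L.getD y false = true) (p.2 % B p.1.1))
        (f := slice) ?_ hB' ?_
      · exact arr_of_renaming (g := fun p : (((α × List Bool) × ℕ) × List Bool) × ℕ => p.1.1.1)
          (IsRenaming.fst.comp (IsRenaming.fst.comp .fst))
          ((((PTFun.snd.fst.fst.div hB'.fst.fst).sub (.const 1)).mul hB'.fst.fst).add .snd)
      · refine subst (Φ := fun (p : ((α × List Bool) × ℕ) × List Bool) x =>
          F p.1.1.1 (fun y => p.2.getD y false = true) x)
          ((PTFun.snd.mod hB').fst) ?_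
        exact hF.comap (IsRenaming.lift_nat (IsRenaming.lift_list
          (IsRenaming.fst.comp (IsRenaming.fst (α := α × List Bool) (γ := ℕ)))))
    have h2 : PTPred fun p : (α × List Bool) × ℕ => I p.1.1 p.2 :=
      hI.comap (IsRenaming.lift_nat .fst)
    refine (((PTPred.lt .snd hB').and h2).or ((PTPred.le hB' .snd).and h1)).congr fun p => ?_
    simp only [f, decide_eq_true_eq]
  have key : ∀ a s n x, x < B a → s * B a + x < n →
      ((build (f a) n).getD (s * B a + x) false = true ↔
        PolyTime.iter (B a) (I a) (F a) s x) := by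
    intro a s
    induction s with
    | zero =>
      intro n x hx hn
      rw [getD_build _ _ _ hn]
      have h1 : ¬ B a ≤ x := by omega
      simp [f, PolyTime.iter, hx, h1]
    | succ s ih =>
      intro n x hx hn
      rw [getD_build _ _ _ hn]
      have e0 : (s + 1) * B a + x = s * B a + B a + x := by ring
      have h1 : B a ≤ (s + 1) * B a + x := by omega
      have h2 : ((s + 1) * B a + x) / B a = s + 1 := by
        rw [Nat.mul_comm, Nat.mul_add_div (by omega), Nat.div_eq_of_lt hx, add_zero]
      have h3 : ((s + 1) * B a + x) % B a = x := by
        rw [Nat.mul_comm, Nat.mul_add_mod, Nat.mod_eq_of_lt hx]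
      have h4 : (fun y => (build (slice ((a, build (f a) ((s + 1) * B a + x)),
          (s + 1) * B a + x)) (B a)).getD y false = true) = PolyTime.iter (B a) (I a) (F a) s := by
        funext y
        apply propext
        by_cases hy : y < B a
        · rw [getD_build _ _ _ hy]
          simp only [slice, h2, Nat.add_sub_cancel]
          exact ih _ y hy (by omega)
        · rw [getD_build_of_le _ _ _ (by omega)]
          constructor
          · intro h; cases h
          · intro h; exact absurd (iter_lt h) hy
      simp only [f, h4, h3, decide_eq_true_eq, h1, true_and, not_lt.2 h1, false_and, false_or,
        PolyTime.iter, hx]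
  refine ((PTPred.lt hx hB).and (letrec (f := f) (n := fun a => (s a + 1) * B a)
    (Θ := fun a L => L.getD (s a * B a + x a) false = true) hf ((hs.add (.const 1)).mul hB)
    (arr ((hs.mul hB).add hx).fst))).congr fun a => ?_
  constructor
  · intro h
    exact ⟨iter_lt h, (key a _ _ _ (iter_lt h) (by have := iter_lt h; ring_nf; omega)).2 h⟩
  · rintro ⟨h1, h2⟩
    exact (key a _ _ _ h1 (by ring_nf; omega)).1 h2

end PTPred

/-- The least subset of `{0, …, B - 1}` closed under a monotone operator. -/
def lfp (B : ℕ) (F : (ℕ → Prop) → ℕ → Prop) : ℕ → Prop := iter B (fun _ => False) F B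

theorem lfp_lt {B F x} (h : lfp B F x) : x < B := iter_lt h

/-- The induction principle of the least fixed point. -/
theorem lfp_least {B : ℕ} {F : (ℕ → Prop) → ℕ → Prop}
    (hF : ∀ X Y : ℕ → Prop, (∀ x, X x → Y x) → ∀ x, F X x → F Y x)
    {X : ℕ → Prop} (hX : ∀ x < B, F X x → X x) {x : ℕ} (h : lfp B F x) : X x := by
  have key : ∀ s x, iter B (fun _ => False) F s x → X x := by
    intro s
    induction s with
    | zero => intro x h; exact h.2.elim
    | succ s ih => intro x h; exact hX x h.1 (hF _ _ ih x h.2)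
  exact key _ _ h

open Classical in
/-- The iteration is stationary after at most `B` stages, since the stages increase. -/
theorem lfp_closed {B : ℕ} {F : (ℕ → Prop) → ℕ → Prop}
    (hF : ∀ X Y : ℕ → Prop, (∀ x, X x → Y x) → ∀ x, F X x → F Y x)
    {x : ℕ} (hx : x < B) (h : F (lfp B F) x) : lfp B F x := by
  set X := iter B (fun _ => False) F with hX
  have mono : ∀ s x, X s x → X (s + 1) x := by
    intro s
    induction s with
    | zero => intro x h; exact h.2.elim
    | succ s ih => intro x h; exact ⟨h.1, hF _ _ ih x h.2⟩
  -- As long as the stages grow, stage `s` has at least `s` elements.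
  have key : ∀ s, (∀ x, X (s + 1) x → X s x) ∨ s + 1 ≤ ((Finset.range B).filter (X (s + 1))).card := by
    intro s
    induction s with
    | zero =>
      by_cases h0 : ∀ x, X 1 x → X 0 x
      · exact Or.inl h0
      · push Not at h0
        obtain ⟨y, h1, _⟩ := h0
        exact Or.inr (Finset.card_pos.2 ⟨y, by simp [h1, iter_lt h1]⟩)
    | succ s ih =>
      by_cases h0 : ∀ x, X (s + 2) x → X (s + 1) x
      · exact Or.inl h0
      · right
        rcases ih with ih | ih
        · exact absurd (fun x h => ⟨h.1, hF _ _ ih x h.2⟩) h0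
        · push Not at h0
          obtain ⟨y, h1, h2⟩ := h0
          refine ih.trans_lt (Finset.card_lt_card ?_)
          rw [Finset.ssubset_iff_of_subset (Finset.monotone_filter_right _ fun x _ => mono (s + 1) x)]
          exact ⟨y, by simp [h1, iter_lt h1], by simp [h2]⟩
  rcases key B with h1 | h1
  · exact h1 x ⟨hx, h⟩
  · have := Finset.card_filter_le (Finset.range B) (X (B + 1))
    rw [Finset.card_range] at this
    omega

theorem PTPred.lfp {B x : α → ℕ} (hB : PTFun B) (hx : PTFun x)
    {F : α → (ℕ → Prop) → ℕ → Prop}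
    (hF : PTPred fun p : (α × List Bool) × ℕ =>
      F p.1.1 (fun y => p.1.2.getD y false = true) p.2) :
    PTPred fun a => PolyTime.lfp (B a) (F a) (x a) :=
  PTPred.iter (I := fun _ _ => False) hB hB hx (.const False) hF

/-! ### Reading the input -/

theorem unaryEncode_append (l l' : List ℕ) :
    unaryEncode (l ++ l') = unaryEncode l ++ unaryEncode l' := by
  simp [unaryEncode]

theorem unaryEncode_cons (n : ℕ) (l : List ℕ) :
    unaryEncode (n :: l) = List.replicate n true ++ false :: unaryEncode l := by
  simp [unaryEncode]

/-- The block of the `t`-th number in a unary code. -/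
theorem getD_unaryEncode {l : List ℕ} {t : ℕ} (ht : t < l.length) {r : ℕ} (hr : r ≤ l[t]) :
    (unaryEncode l).getD ((unaryEncode (l.take t)).length + r) false = decide (r < l[t]) := by
  have e : unaryEncode l = unaryEncode (l.take t) ++
      (List.replicate l[t] true ++ false :: unaryEncode (l.drop (t + 1))) := by
    rw [← unaryEncode_cons, ← unaryEncode_append, ← List.drop_eq_getElem_cons,
      List.take_append_drop]
  rw [e, List.getD_append_right _ _ _ _ (by omega), Nat.add_sub_cancel_left]
  rcases Nat.lt_or_eq_of_le hr with h | h
  · rw [List.getD_append _ _ _ _ (by simpa using h)]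
    simp [h]
  · rw [List.getD_append_right _ _ _ _ (by simp [h])]
    simp [h]

theorem length_unaryEncode_take_succ {l : List ℕ} {t : ℕ} (ht : t < l.length) :
    (unaryEncode (l.take (t + 1))).length = (unaryEncode (l.take t)).length + l[t] + 1 := by
  rw [List.take_succ_eq_append_getElem ht, unaryEncode_append]
  simp [unaryEncode]; omega

/-- One step of the search for the beginnings of the blocks in a unary code `w`: a new block begins
behind the first `false` after the beginning of a block. -/
def nextBlock (w : List Bool) (X : ℕ → Prop) (x : ℕ) : Prop :=
  ∃ q < x, X q ∧ ¬ w.getD (x - 1) false = true ∧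
    ∀ r < x - 1, q ≤ r → w.getD r false = true

/-- The only element of the `t`-th stage is the beginning of the `t`-th block. -/
theorem iter_nextBlock (l : List ℕ) (t x : ℕ) :
    iter ((unaryEncode l).length + 1) (· = 0) (nextBlock (unaryEncode l)) t x ↔
      t ≤ l.length ∧ x = (unaryEncode (l.take t)).length := by
  induction t generalizing x with
  | zero => simp [iter, unaryEncode]; omega
  | succ t ih =>
    simp only [iter, nextBlock, ih]
    constructor
    · rintro ⟨hx, q, hq, ⟨ht, rfl⟩, h1, h2⟩
      rcases Nat.lt_or_eq_of_le ht with ht | rfl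
      · refine ⟨ht, ?_⟩
        rw [length_unaryEncode_take_succ ht]
        have h3 := getD_unaryEncode ht le_rfl
        simp only [lt_irrefl, decide_false] at h3
        rcases Nat.lt_trichotomy (x - 1) ((unaryEncode (l.take t)).length + l[t]) with h | h | h
        · have h4 := getD_unaryEncode ht
            (r := x - 1 - (unaryEncode (l.take t)).length) (by omega)
          rw [show (unaryEncode (l.take t)).length +
            (x - 1 - (unaryEncode (l.take t)).length) = x - 1 by omega] at h4
          rw [h4] at h1
          simp at h1
          omega
        · omega
        · have := h2 _ h (by omega)
          rw [h3] at this
          cases this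
      · rw [List.take_length] at hq
        omega
    · rintro ⟨ht, rfl⟩
      have h0 := length_unaryEncode_take_succ ht
      refine ⟨?_, _, ?_, ⟨by omega, rfl⟩, ?_, ?_⟩
      · have : (unaryEncode l).length = (unaryEncode (l.take (t + 1))).length +
            (unaryEncode (l.drop (t + 1))).length := by
          rw [← List.length_append, ← unaryEncode_append, List.take_append_drop]
        omega
      · omega
      · rw [h0, Nat.add_sub_cancel, getD_unaryEncode ht le_rfl]
        simp
      · intro r hr hq
        have h4 := getD_unaryEncode ht (r := r - (unaryEncode (l.take t)).length) (by omega)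
        rw [show (unaryEncode (l.take t)).length +
            (r - (unaryEncode (l.take t)).length) = r by omega] at h4
        rw [h4]
        simp; omega

/-- The entries of the list of numbers encoded in the input can be read off. -/
theorem PTFun.entry {l : α → List ℕ} (hl : ∀ a, Ctx.inp a = unaryEncode (l a)) {t : α → ℕ}
    (ht : PTFun t) : PTFun fun a => (l a).getD (t a) 0 := by
  have hN := PTFun.length_inp (α := α)
  -- `A a y` says that the block with the number `t a` begins at some position `q` and consists of
  -- `y` bits `true` and a terminator.
  let A : α → ℕ → Prop := fun a y => ∃ q < (Ctx.inp a).length + 1,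
    iter ((Ctx.inp a).length + 1) (· = 0) (nextBlock (Ctx.inp a)) (t a) q ∧
      (q + y < (Ctx.inp a).length ∧ ¬ (Ctx.inp a).getD (q + y) false = true) ∧
        ∀ r < y, (Ctx.inp a).getD (q + r) false = true
  have hA : PTPred fun p : α × ℕ => A p.1 p.2 := by
    refine .ex (hN.fst.add (.const 1)) (.and ?_ (.and (.and ?_ ?_) ?_))
    · refine .iter (α := (α × ℕ) × ℕ) (hN.fst.fst.add (.const 1)) ht.fst.fst .snd
        (F := fun p => nextBlock (Ctx.inp p.1.1)) (I := fun _ x => x = 0)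
        (.eq .snd (.const 0)) ?_
      refine .ex .snd (.and (.arr_of_renaming (g := fun p : ((((α × ℕ) × ℕ) × List Bool) × ℕ) × ℕ =>
        p.1.1) (IsRenaming.fst.comp .fst) .snd) (.and (.not ?_)
          (.all (PTFun.snd.fst.sub (.const 1)) (.imp (.le .var₁ .snd) ?_))))
      · exact .inp (α := ((((α × ℕ) × ℕ) × List Bool) × ℕ) × ℕ) (PTFun.snd.fst.sub (.const 1))
      · exact .inp (α := (((((α × ℕ) × ℕ) × List Bool) × ℕ) × ℕ) × ℕ) .snd
    · exact .lt (PTFun.snd.add .var₁) hN.fst.fst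
    · exact .not (.inp (α := (α × ℕ) × ℕ) (PTFun.snd.add .var₁))
    · exact .all .var₁ (.inp (α := ((α × ℕ) × ℕ) × ℕ) (PTFun.var₁.add .snd))
  have spec : ∀ a y, A a y ↔ ∃ h : t a < (l a).length, y = (l a)[t a] := by
    intro a y
    simp only [A, hl, iter_nextBlock]
    constructor
    · rintro ⟨q, hq, ⟨h1, rfl⟩, ⟨h2, h3⟩, h4⟩
      rcases Nat.lt_or_eq_of_le h1 with h1 | h1
      · refine ⟨h1, ?_⟩
        rcases Nat.lt_trichotomy y (l a)[t a] with h | h | h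
        · rw [getD_unaryEncode h1 h.le] at h3
          simp [h] at h3
        · exact h
        · have := h4 _ h
          rw [getD_unaryEncode h1 le_rfl] at this
          simp at this
      · rw [h1, List.take_length] at h2
        omega
    · rintro ⟨h, rfl⟩
      have h1 := length_unaryEncode_take_succ h
      have h2 : (unaryEncode (l a)).length = (unaryEncode ((l a).take (t a + 1))).length +
            (unaryEncode ((l a).drop (t a + 1))).length := by
          rw [← List.length_append, ← unaryEncode_append, List.take_append_drop]
      refine ⟨_, ?_, ⟨h.le, rfl⟩, ⟨by omega, ?_⟩, fun r hr => ?_⟩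
      · omega
      · rw [getD_unaryEncode h le_rfl]; simp
      · rw [getD_unaryEncode h hr.le]; simp [hr]
  have hle : ∀ a, (l a).getD (t a) 0 ≤ (Ctx.inp a).length := by
    intro a
    rcases Nat.lt_or_ge (t a) (l a).length with h | h
    · obtain ⟨q, _, _, ⟨h2, _⟩, _⟩ := (spec a _).2 ⟨h, rfl⟩
      rw [List.getD_eq_getElem _ _ h]
      omega
    · rw [List.getD_eq_default _ _ h]; omega
  refine .of_graph hN hle ((hA.or ((PTPred.eq .snd (.const 0)).and
    (.all (Φ := fun p y => ¬ A p.1 y) (hN.fst.add (.const 1))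
      (.not (hA.comap (IsRenaming.lift_nat .fst)))))).congr fun p => ?_)
  obtain ⟨a, y⟩ := p
  dsimp only
  rcases Nat.lt_or_ge (t a) (l a).length with h | h
  · rw [List.getD_eq_getElem _ _ h, spec]
    constructor
    · intro hy; exact Or.inl ⟨h, hy⟩
    · rintro (⟨_, hy⟩ | ⟨_, hy⟩)
      · exact hy
      · refine absurd ((spec a _).2 ⟨h, rfl⟩) (hy _ ?_)
        have := hle a
        rw [List.getD_eq_getElem _ _ h] at this
        omega
  · have h' : ∀ y, ¬ A a y := fun y hy => by
      obtain ⟨h1, _⟩ := (spec a y).1 hy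
      omega
    rw [List.getD_eq_default _ _ h]
    simp [h']

end PolyTime

/-! ### Finite structures in polynomial time -/

namespace PolyTime

open StackProg

/-- The `i`-th digit of `j` in base `n`: the `i`-th entry of the tuple with code `j`. -/
def digit (n j i : ℕ) : ℕ := j / n ^ i % n

/-- The code of a tuple of numbers below `n`, its position in the tables of operations. -/
def tupleCode {k : ℕ} (n : ℕ) (x : Fin k → ℕ) : ℕ := ∑ i, x i * n ^ (i : ℕ)

theorem tupleCode_eq {k n : ℕ} (x : Fin k → Fin n) :
    tupleCode n (fun i => (x i : ℕ)) = finFunctionFinEquiv x := by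
  simp [tupleCode]

theorem digit_eq {k n : ℕ} (j : Fin (n ^ k)) (i : Fin k) :
    digit n j i = finFunctionFinEquiv.symm j i := by
  simp [digit]

theorem digit_lt {n k j : ℕ} (hj : j < n ^ k) (i : Fin k) : digit n j i < n := by
  have := digit_eq ⟨j, hj⟩ i
  rw [show digit n j i = _ from this]
  exact Fin.is_lt _

theorem tupleCode_lt {k n : ℕ} {x : Fin k → ℕ} (hx : ∀ i, x i < n) : tupleCode n x < n ^ k := by
  have := tupleCode_eq fun i => (⟨x i, hx i⟩ : Fin n)
  rw [show tupleCode n x = _ from this]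
  exact Fin.is_lt _

theorem digit_tupleCode {k n : ℕ} {x : Fin k → ℕ} (hx : ∀ i, x i < n) (i : Fin k) :
    digit n (tupleCode n x) i = x i := by
  have h := tupleCode_eq fun i => (⟨x i, hx i⟩ : Fin n)
  have := digit_eq (finFunctionFinEquiv fun i => (⟨x i, hx i⟩ : Fin n)) i
  rw [show tupleCode n x = _ from h, this, Equiv.symm_apply_apply]

end PolyTime

namespace FiniteStructure

open FirstOrder.Language.Structure PolyTime

variable {L : FirstOrder.Language.{0, 0}}

/-- The value of a basic operation at the tuple with code `j`. -/
def fn (X : FiniteStructure L) {k : ℕ} (f : L.Functions k) (j : ℕ) : ℕ :=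
  (X.functionTable ⟨k, f⟩).getD j 0

/-- Whether a basic relation contains the tuple with code `j`. -/
def rl (X : FiniteStructure L) {k : ℕ} (R : L.Relations k) (j : ℕ) : Prop :=
  (X.relationTable ⟨k, R⟩).getD j 0 = 1

variable (X : FiniteStructure L)

theorem length_functionTable (f : Σ k, L.Functions k) :
    (X.functionTable f).length = X.size ^ f.1 := by simp [functionTable]

theorem length_relationTable (f : Σ k, L.Relations k) :
    (X.relationTable f).length = X.size ^ f.1 := by simp [relationTable]

theorem fn_eq {k : ℕ} (f : L.Functions k) {j : ℕ} (hj : j < X.size ^ k) :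
    X.fn f j = (funMap f (fun i => (⟨digit X.size j i, digit_lt hj i⟩ : Fin X.size)) :
      Fin X.size) := by
  rw [fn, List.getD_eq_getElem _ _ (by rw [length_functionTable]; exact hj)]
  simp only [functionTable, List.getElem_ofFn]
  congr 2

theorem fn_lt {k : ℕ} (f : L.Functions k) {j : ℕ} (hj : j < X.size ^ k) : X.fn f j < X.size := by
  rw [fn_eq X f hj]; exact Fin.is_lt _

theorem fn_tupleCode {k : ℕ} (f : L.Functions k) (x : Fin k → Fin X.size) :
    X.fn f (tupleCode X.size fun i => (x i : ℕ)) = (funMap f x : Fin X.size) := by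
  rw [fn_eq X f (tupleCode_lt fun i => (x i).is_lt)]
  congr 2
  funext i
  exact Fin.ext (digit_tupleCode (fun i => (x i).is_lt) i)

theorem rl_iff {k : ℕ} (R : L.Relations k) {j : ℕ} (hj : j < X.size ^ k) :
    X.rl R j ↔ RelMap R (fun i => (⟨digit X.size j i, digit_lt hj i⟩ : Fin X.size)) := by
  rw [rl, List.getD_eq_getElem _ _ (by rw [length_relationTable]; exact hj)]
  simp only [relationTable, List.getElem_ofFn]
  have : (finFunctionFinEquiv.symm ⟨j, hj⟩ : Fin k → Fin X.size) =
      fun i => ⟨digit X.size j i, digit_lt hj i⟩ :=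
    funext fun i => Fin.ext (digit_eq ⟨j, hj⟩ i).symm
  rw [this]
  split_ifs with h <;> simp [h]

theorem rl_tupleCode {k : ℕ} (R : L.Relations k) (x : Fin k → Fin X.size) :
    X.rl R (tupleCode X.size fun i => (x i : ℕ)) ↔ RelMap R x := by
  rw [rl_iff X R (tupleCode_lt fun i => (x i).is_lt)]
  have : (fun i : Fin k => (⟨digit X.size (tupleCode X.size fun i => (x i : ℕ)) i,
      digit_lt (tupleCode_lt fun i => (x i).is_lt) i⟩ : Fin X.size)) = x :=
    funext fun i => Fin.ext (digit_tupleCode (fun i => (x i).is_lt) i)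
  rw [this]

end FiniteStructure

namespace PolyTime

open StackProg

variable {L : FirstOrder.Language.{0, 0}} [Finite L.Symbols]

/-- The context given by a finite structure is its code, without arrays and numbers. -/
noncomputable instance : Ctx (FiniteStructure L) where
  inp X := X.encode
  arrs _ _ := []
  vars _ _ := 0

/-- A table at a known place in a list of tables. -/
theorem getD_flatMap {σ : Type*} (T : σ → List ℕ) (pre post : List σ) (s : σ) (u v : List ℕ)
    {j : ℕ} (hj : j < (T s).length) :
    (u ++ ((pre ++ s :: post).flatMap T ++ v)).getD
      (u.length + ((pre.map fun s => (T s).length).sum + j)) 0 = (T s).getD j 0 := by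
  have h1 : (pre.flatMap T).length = (pre.map fun s => (T s).length).sum := by
    rw [List.length_flatMap]
  rw [List.getD_append_right _ _ _ _ (by omega), Nat.add_sub_cancel_left, List.flatMap_append,
    List.append_assoc, List.getD_append_right _ _ _ _ (by omega), ← h1, Nat.add_sub_cancel_left,
    List.flatMap_cons, List.append_assoc, List.getD_append _ _ _ _ hj]

variable {α : Type} [Ctx α] {X : α → FiniteStructure L}

section

variable (hX : ∀ a, Ctx.inp a = (X a).encode)

include hX

theorem PTFun.size : PTFun fun a => (X a).size :=
  (PTFun.entry hX (.const 0)).congr fun _ => rfl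

/-- A value of a basic operation is an entry of the input, at a place computed from the sizes of the
tables in front of it. -/
theorem PTFun.fn {k : ℕ} (f : L.Functions k) {j : α → ℕ} (hj : PTFun j) :
    PTFun fun a => (X a).fn f (j a) := by
  classical
  obtain ⟨pre, post, h⟩ := List.append_of_mem (mem_functionSymbols L ⟨k, f⟩)
  refine (PTFun.ite (P := fun a => j a < (X a).size ^ k) (.lt hj ((PTFun.size hX).pow k))
    (PTFun.entry hX (t := fun a => 1 + ((pre.map fun s => (X a).size ^ s.1).sum + j a))
    ((PTFun.const 1).add ((PTFun.sum pre fun s => (PTFun.size hX).pow s.1).add hj)))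
      (.const 0)).congr fun a => ?_
  split_ifs with hlt
  · have h2 := getD_flatMap (X a).functionTable pre post ⟨k, f⟩ [(X a).size]
      ((relationSymbols L).flatMap (X a).relationTable) (j := j a)
      (by rw [FiniteStructure.length_functionTable]; exact hlt)
    simp only [FiniteStructure.length_functionTable] at h2
    rw [FiniteStructure.fn, ← h2, h]
    rfl
  · rw [FiniteStructure.fn, List.getD_eq_default]
    rw [FiniteStructure.length_functionTable]
    exact not_lt.1 hlt

theorem PTPred.rl {k : ℕ} (R : L.Relations k) {j : α → ℕ} (hj : PTFun j) :
    PTPred fun a => (X a).rl R (j a) := by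
  classical
  obtain ⟨pre, post, h⟩ := List.append_of_mem (mem_relationSymbols L ⟨k, R⟩)
  refine ((PTPred.lt hj ((PTFun.size hX).pow k)).and (.eq (PTFun.entry hX
    (t := fun a => 1 + ((functionSymbols L).map fun s => (X a).size ^ s.1).sum +
      ((pre.map fun s => (X a).size ^ s.1).sum + j a))
    (((PTFun.const 1).add (PTFun.sum _ fun s : (Σ k, L.Functions k) => (PTFun.size hX).pow s.1)).add
      ((PTFun.sum pre fun s => (PTFun.size hX).pow s.1).add hj)))
      (.const 1))).congr fun a => ?_
  by_cases hlt : j a < (X a).size ^ k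
  · have h2 := getD_flatMap (X a).relationTable pre post ⟨k, R⟩
      ((X a).size :: (functionSymbols L).flatMap (X a).functionTable) [] (j := j a)
      (by rw [FiniteStructure.length_relationTable]; exact hlt)
    simp only [FiniteStructure.length_relationTable, List.length_cons, List.append_nil,
      List.length_flatMap, FiniteStructure.length_functionTable] at h2
    rw [FiniteStructure.rl, ← h2, h, Nat.add_comm 1]
    simp only [hlt, true_and]
    rfl
  · rw [FiniteStructure.rl, List.getD_eq_default]
    · simp [hlt]
    · rw [FiniteStructure.length_relationTable]
      exact not_lt.1 hlt

end

theorem PTFun.digit {n j : α → ℕ} (hn : PTFun n) (hj : PTFun j) (i : ℕ) :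
    PTFun fun a => PolyTime.digit (n a) (j a) i :=
  (hj.div (hn.pow i)).mod hn

theorem PTFun.tupleCode {k : ℕ} {n : α → ℕ} {x : α → Fin k → ℕ} (hn : PTFun n)
    (hx : ∀ i, PTFun fun a => x a i) : PTFun fun a => PolyTime.tupleCode (n a) (x a) :=
  (PTFun.sum (List.finRange k) fun i => (hx i).mul (hn.pow i)).congr fun a => by
    simp [PolyTime.tupleCode, Fin.sum_univ_def]

/-! ### Homomorphisms to a two-element structure -/

open FirstOrder.Language.Structure

variable {A : Type*} [L.Structure A]

/-- A basic operation of a two-element structure as an operation on truth values. -/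
def boolFun (e : A ≃ Prop) {k : ℕ} (f : L.Functions k) (b : Fin k → Prop) : Prop :=
  e (funMap f fun i => e.symm (b i))

/-- A basic relation of a two-element structure as a relation on truth values. -/
def boolRel (e : A ≃ Prop) {k : ℕ} (R : L.Relations k) (b : Fin k → Prop) : Prop :=
  RelMap R fun i => e.symm (b i)

/-- The characteristic function of `H` is a homomorphism, once truth values are identified with
the elements of `A`. -/
def IsHom (e : A ≃ Prop) (X : FiniteStructure L) (H : ℕ → Prop) : Prop :=
  (∀ f ∈ functionSymbols L, ∀ j < X.size ^ f.1,
    (H (X.fn f.2 j) ↔ boolFun e f.2 fun i => H (digit X.size j i))) ∧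
  ∀ R ∈ relationSymbols L, ∀ j < X.size ^ R.1,
    X.rl R.2 j → boolRel e R.2 fun i => H (digit X.size j i)

theorem IsHom.fn {e : A ≃ Prop} {X : FiniteStructure L} {H : ℕ → Prop} (h : IsHom e X H) {k : ℕ}
    (f : L.Functions k) {x : Fin k → ℕ} (hx : ∀ i, x i < X.size) :
    H (X.fn f (tupleCode X.size x)) ↔ boolFun e f fun i => H (x i) := by
  have := h.1 ⟨k, f⟩ (mem_functionSymbols L _) _ (tupleCode_lt hx)
  simpa only [digit_tupleCode hx] using this

/-- The functions `H` are not restricted outside the domain of `X`, as `IsHom` does not refer to values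
there. -/
theorem nonempty_hom_iff (e : A ≃ Prop) (X : FiniteStructure L) :
    Nonempty (L.Hom (Fin X.size) A) ↔ ∃ H, IsHom e X H := by
  constructor
  · rintro ⟨h⟩
    refine ⟨fun x => ∃ hx : x < X.size, e (h ⟨x, hx⟩), ?_, ?_⟩
    · rintro ⟨k, f⟩ _ j hj
      have h1 := X.fn_lt f hj
      have h2 : (⟨X.fn f j, h1⟩ : Fin X.size) = _ := Fin.ext (X.fn_eq f hj)
      have h3 : (∃ hx : X.fn f j < X.size, (e (h ⟨X.fn f j, hx⟩) : Prop)) ↔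
          e (h ⟨X.fn f j, h1⟩) := ⟨fun ⟨_, h⟩ => h, fun h => ⟨h1, h⟩⟩
      dsimp only
      rw [h3, h2, h.map_fun, boolFun]
      have : (fun i : Fin k => e.symm (∃ hx : digit X.size j i < X.size,
          e (h ⟨digit X.size j i, hx⟩))) =
          h ∘ fun i : Fin k => ⟨digit X.size j i, digit_lt hj i⟩ := by
        funext i
        have : (∃ hx : digit X.size j i < X.size, (e (h ⟨digit X.size j i, hx⟩) : Prop)) =
            e (h ⟨digit X.size j i, digit_lt hj i⟩) :=
          propext ⟨fun ⟨_, h⟩ => h, fun h => ⟨_, h⟩⟩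
        rw [this, Equiv.symm_apply_apply]; rfl
      rw [this]
    · rintro ⟨k, R⟩ _ j hj hR
      have h2 := h.map_rel R _ ((X.rl_iff R hj).1 hR)
      rw [boolRel]
      convert h2 using 1
      funext i
      have : (∃ hx : digit X.size j i < X.size, (e (h ⟨digit X.size j i, hx⟩) : Prop)) =
          e (h ⟨digit X.size j i, digit_lt hj i⟩) :=
        propext ⟨fun ⟨_, h⟩ => h, fun h => ⟨_, h⟩⟩
      dsimp only
      rw [this, Equiv.symm_apply_apply]; rfl
  · rintro ⟨H, h1, h2⟩
    refine ⟨⟨fun x => e.symm (H x), fun {k} f x => ?_, fun {k} R x hR => ?_⟩⟩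
    · have := IsHom.fn ⟨h1, h2⟩ f (x := fun i => x i) (fun i => (x i).is_lt)
      rw [X.fn_tupleCode] at this
      rw [Equiv.symm_apply_eq, propext this, boolFun]
      rfl
    · have := h2 ⟨k, R⟩ (mem_relationSymbols L _) _ (tupleCode_lt fun i => (x i).is_lt)
        ((X.rl_tupleCode R x).2 hR)
      simp only [boolRel, digit_tupleCode fun i => (x i).is_lt] at this
      exact this

theorem PTPred.isHom (hX : ∀ a, Ctx.inp a = (X a).encode) (e : A ≃ Prop) {H : α → ℕ → Prop}
    (hH : PTPred fun p : α × ℕ => H p.1 p.2) : PTPred fun a => IsHom e (X a) (H a) := by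
  have hX' : ∀ p : α × ℕ, Ctx.inp p = (X p.1).encode := fun p => hX p.1
  have hH' : PTPred fun p : (α × ℕ) × ℕ => H p.1.1 p.2 := hH.comap (IsRenaming.lift_nat .fst)
  have hdig : ∀ k (g : (Fin k → Prop) → Prop), PTPred fun p : α × ℕ =>
      g fun i => H p.1 (PolyTime.digit (X p.1).size p.2 i) := fun k g =>
    comb g fun i => subst (Φ := fun p x => H p.1 x) (.digit (.size hX') .snd i) hH'
  refine .and (forall_mem _ fun f => .all ((PTFun.size hX).pow _) (.iff ?_ (hdig _ _)))
    (forall_mem _ fun R => .all ((PTFun.size hX).pow _) (.imp (.rl hX' _ .snd) (hdig _ _)))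
  exact subst (Φ := fun p x => H p.1 x) (.fn hX' f.2 .snd) hH'

/-! ### From definability to complexity classes -/

/-- A problem whose yes-instances are given by a formula is in P. -/
theorem inP_of_ptPred {Φ : FiniteStructure L → Prop} (hΦ : PTPred Φ)
    (h : ∀ X : FiniteStructure L, (CSP L A).Yes X ↔ Φ X) : (CSP L A).InP := by
  classical
  obtain ⟨o, ho⟩ := PTStr.ite hΦ (.singleton true) (.singleton false)
  refine Out.computable _ _ _ o fun X => (Eq.trans (ho X) ?_).symm
  by_cases hX : Φ X
  · have h' := (h X).2 hX
    simp [h', hX, Computability.encodeBool]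
  · have h' : ¬ (CSP L A).Yes X := fun hy => hX ((h X).1 hy)
    simp [h', hX, Computability.encodeBool]

/-- A reduction whose output is given by an output program is a polynomial-time reduction. -/
theorem manyOneReducible_of_ptStr {L' : FirstOrder.Language.{0, 0}} [Finite L'.Symbols]
    {A' : Type*} [L'.Structure A'] {g : FiniteStructure L → FiniteStructure L'}
    (hg : PTStr fun X => (g X).encode)
    (h : ∀ X, (CSP L A).Yes X ↔ (CSP L' A').Yes (g X)) :
    (CSP L A).ManyOneReducible (CSP L' A') := by
  obtain ⟨o, ho⟩ := hg
  exact ⟨g, Out.computable _ _ _ o fun X => (ho X).symm, h⟩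

/-- The code of a structure is given by an output program if its size and tables are. -/
theorem PTStr.encode {Y : α → FiniteStructure L} (hsize : PTFun fun a => (Y a).size)
    (hfn : ∀ k (f : L.Functions k), PTFun fun p : α × ℕ => (Y p.1).fn f p.2)
    (hrl : ∀ k (R : L.Relations k), PTPred fun p : α × ℕ => (Y p.1).rl R p.2) :
    PTStr fun a => (Y a).encode := by
  classical
  have hnum : ∀ {β : Type} [Ctx β] {f : β → ℕ}, PTFun f → PTStr fun b => unaryEncode [f b] := by
    intro β _ f hf
    exact ((PTStr.replicate hf true).append (.singleton false)).congr fun b => by simp [unaryEncode]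
  have hrange : ∀ l : List ℕ, unaryEncode l =
      (List.range l.length).flatMap fun j => unaryEncode [l.getD j 0] := by
    intro l
    rw [← List.flatMap_map (f := fun j => l.getD j 0) (g := fun m => unaryEncode [m])]
    have : (List.range l.length).map (fun j => l.getD j 0) = l := by
      apply List.ext_getElem (by simp)
      intro i h1 h2
      simp [List.getElem?_eq_getElem h2]
    rw [this]
    simp [unaryEncode]
  have happ : ∀ {σ : Type} (l : List σ) (T : σ → List ℕ), unaryEncode (l.flatMap T) =
      l.flatMap fun s => unaryEncode (T s) := by
    intro σ l T
    simp [unaryEncode, List.flatMap_assoc]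
  refine ((hnum hsize).append ((PTStr.flatMap (functionSymbols L) (g := fun a f =>
    unaryEncode ((Y a).functionTable f)) fun f => ?_).append
    (PTStr.flatMap (relationSymbols L) (g := fun a f =>
      unaryEncode ((Y a).relationTable f)) fun R => ?_))).congr fun a => ?_
  · refine (PTStr.flatMap_range (g := fun a j => unaryEncode [(Y a).fn f.2 j]) (hsize.pow f.1)
      (hnum (hfn f.1 f.2))).congr fun a => ?_
    rw [hrange, FiniteStructure.length_functionTable]
    rfl
  · refine (PTStr.flatMap_range (g := fun a j => unaryEncode [if (Y a).rl R.2 j then 1 else 0])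
      (hsize.pow R.1)
      (hnum (PTFun.ite (hrl R.1 R.2) (.const 1) (.const 0)))).congr fun a => ?_
    rw [hrange, FiniteStructure.length_relationTable]
    refine List.flatMap_congr fun j hj => ?_
    have hj := List.mem_range.1 hj
    have h1 : ((Y a).relationTable R).getD j 0 = if (Y a).rl R.2 j then 1 else 0 := by
      split_ifs with h
      · exact h
      · rw [FiniteStructure.rl, List.getD_eq_getElem _ _
          (by rw [FiniteStructure.length_relationTable]; exact hj)] at h
        rw [List.getD_eq_getElem _ _
          (by rw [FiniteStructure.length_relationTable]; exact hj)]
        simp only [FiniteStructure.relationTable, List.getElem_ofFn] at h ⊢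
        exact if_neg fun hP => h (if_pos hP)
    rw [h1]
  · rw [FiniteStructure.encode, ← happ, ← happ, ← unaryEncode_append, ← unaryEncode_append]
    rfl

end PolyTime

/-! ### From a structure to its graph -/

namespace FiniteStructure

open PolyTime

variable {L : FirstOrder.Language.{0, 0}} (X : FiniteStructure L)

theorem lt_of_rl {k : ℕ} {R : L.Relations k} {j : ℕ} (h : X.rl R j) : j < X.size ^ k := by
  by_contra hj
  rw [rl, List.getD_eq_default _ _ (by rw [length_relationTable]; exact not_lt.1 hj)] at h
  exact zero_ne_one h

theorem fn_of_le {k : ℕ} (f : L.Functions k) {j : ℕ} (hj : X.size ^ k ≤ j) : X.fn f j = 0 :=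
  List.getD_eq_default _ _ (by rw [length_functionTable]; exact hj)

/-- A relation symbol of `L` as a symbol of the graph signature. -/
def relSymbol {k : ℕ} (R : L.Relations k) : (graphLanguage L).Relations k := GraphRel.rel R

/-- The symbol of the graph signature for the graph of a basic operation. -/
def graphSymbol {k : ℕ} (f : L.Functions k) : (graphLanguage L).Relations (k + 1) :=
  GraphRel.graph f

/-- The graph of a finite structure. -/
def graph : FiniteStructure (graphLanguage L) where
  size := X.size
  str := graphStructure L (Fin X.size)

theorem rl_graph_rel {k : ℕ} (R : L.Relations k) (j : ℕ) :
    X.graph.rl (relSymbol R) j ↔ X.rl R j := by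
  have key : ∀ hj : j < X.size ^ k, X.graph.rl (relSymbol R) j ↔ X.rl R j := fun hj => by
    exact (X.graph.rl_iff (relSymbol R) hj).trans (X.rl_iff R hj).symm
  exact ⟨fun h => (key (X.graph.lt_of_rl h)).1 h, fun h => (key (X.lt_of_rl h)).2 h⟩

theorem rl_graph_graph {k : ℕ} (f : L.Functions k) (j : ℕ) :
    X.graph.rl (graphSymbol f) j ↔ j < X.size ^ (k + 1) ∧
      X.fn f (tupleCode X.size fun i : Fin k => digit X.size j i) = digit X.size j k := by
  have key : ∀ hj : j < X.size ^ (k + 1), X.graph.rl (graphSymbol f) j ↔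
      X.fn f (tupleCode X.size fun i : Fin k => digit X.size j i) = digit X.size j k := fun hj => by
    refine (X.graph.rl_iff (graphSymbol f) hj).trans ?_
    have := X.fn_tupleCode f fun i : Fin k => ⟨digit X.size j i, digit_lt hj i.castSucc⟩
    dsimp only at this
    rw [this]
    exact Fin.ext_iff
  exact ⟨fun h => ⟨X.graph.lt_of_rl h, (key (X.graph.lt_of_rl h)).1 h⟩, fun h => (key h.1).2 h.2⟩

theorem nonempty_hom_graph {A : Type*} [L.Structure A] :
    Nonempty (L.Hom (Fin X.size) A) ↔
      Nonempty ((graphLanguage L).Hom (Fin X.graph.size) A) := by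
  constructor
  · rintro ⟨h⟩
    refine ⟨⟨h, fun f => f.elim, ?_⟩⟩
    rintro _ (R | f) x hx
    · exact h.map_rel R x hx
    · exact (h.map_fun f _).symm.trans (congrArg h hx)
  · rintro ⟨h⟩
    refine ⟨⟨h, fun {k} f x => ?_, fun {k} R x hx => h.map_rel (relSymbol R) x hx⟩⟩
    have := h.map_rel (graphSymbol f)
      (Fin.snoc (α := fun _ => Fin X.size) x (FirstOrder.Language.Structure.funMap f x))
    have := this (by
      change FirstOrder.Language.Structure.funMap f _ = _
      simp)
    change FirstOrder.Language.Structure.funMap f _ = _ at this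
    have e1 : h (Fin.snoc (α := fun _ => Fin X.size) x
        (FirstOrder.Language.Structure.funMap f x) (Fin.last k)) =
        h (FirstOrder.Language.Structure.funMap f x : Fin X.size) := congrArg h (Fin.snoc_last _ _)
    have e2 : (fun i : Fin k => h (Fin.snoc (α := fun _ => Fin X.size) x
        (FirstOrder.Language.Structure.funMap f x) i.castSucc)) = h ∘ x :=
      funext fun i => congrArg h (Fin.snoc_castSucc (α := fun _ => Fin X.size) _ _ i)
    exact (e1.symm.trans this.symm).trans (congrArg _ e2)

end FiniteStructure

namespace PolyTime

variable {L : FirstOrder.Language.{0, 0}} [Finite L.Symbols]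

/-- Homomorphisms of structures are homomorphisms of their graphs, and the graph of a structure can be
written down in polynomial time. -/
theorem csp_reducible_graph (A : Type*) [L.Structure A] :
    (CSP L A).ManyOneReducible (CSP (graphLanguage L) A) := by
  have hX : ∀ X : FiniteStructure L, Ctx.inp X = X.encode := fun _ => rfl
  have hX' : ∀ p : FiniteStructure L × ℕ, Ctx.inp p = p.1.encode := fun _ => rfl
  refine manyOneReducible_of_ptStr (g := FiniteStructure.graph)
    (.encode (PTFun.size (X := fun X => X) hX) (fun k f => f.elim) ?_) fun X => X.nonempty_hom_graph
  rintro _ (R | f)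
  · exact (PTPred.rl hX' R .snd).congr fun p => p.1.rl_graph_rel R p.2
  · exact ((PTPred.lt .snd ((PTFun.size hX').pow _)).and
      (.eq (.fn hX' f (.tupleCode (.size hX') fun i => .digit (.size hX') .snd i))
        (.digit (.size hX') .snd _))).congr fun p => p.1.rl_graph_graph f p.2

end PolyTime

/-! ### Least equivalence relations -/

namespace PolyTime

/-- One step of the generation of an equivalence relation on `{0, …, M - 1}` closed under the
rule `G`; the pair `(x, y)` has the code `x + M * y`. -/
def eqvStep (M : ℕ) (G : (ℕ → ℕ → Prop) → ℕ → ℕ → Prop) (S : ℕ → Prop) (p : ℕ) : Prop :=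
  p % M = p / M ∨ (p / M < M ∧ S (p / M + M * (p % M))) ∨
    (∃ z < M, (p % M < M ∧ S (p % M + M * z)) ∧ z < M ∧ S (z + M * (p / M))) ∨
      G (fun x y => x < M ∧ S (x + M * y)) (p % M) (p / M)

/-- The least equivalence relation on `{0, …, M - 1}` closed under the rule `G`. -/
def eqv (M : ℕ) (G : (ℕ → ℕ → Prop) → ℕ → ℕ → Prop) (x y : ℕ) : Prop :=
  x < M ∧ lfp (M * M) (eqvStep M G) (x + M * y)

/-- A rule to generate a binary relation is monotone. -/
def MonoRule (G : (ℕ → ℕ → Prop) → ℕ → ℕ → Prop) : Prop :=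
  ∀ R S : ℕ → ℕ → Prop, (∀ x y, R x y → S x y) → ∀ x y, G R x y → G S x y

theorem eqvStep_mono {M : ℕ} {G : (ℕ → ℕ → Prop) → ℕ → ℕ → Prop} (hG : MonoRule G)
    (X Y : ℕ → Prop) (h : ∀ x, X x → Y x) (p : ℕ) (hp : eqvStep M G X p) : eqvStep M G Y p := by
  rcases hp with hp | ⟨h1, hp⟩ | ⟨z, h1, ⟨h2, h3⟩, h4, h5⟩ | hp
  · exact Or.inl hp
  · exact Or.inr (Or.inl ⟨h1, h _ hp⟩)
  · exact Or.inr (Or.inr (Or.inl ⟨z, h1, ⟨h2, h _ h3⟩, h4, h _ h5⟩))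
  · exact Or.inr (Or.inr (Or.inr (hG _ _ (fun x y hxy => ⟨hxy.1, h _ hxy.2⟩) _ _ hp)))

theorem pair_mod {M x y : ℕ} (hx : x < M) : (x + M * y) % M = x := by
  rw [Nat.add_mul_mod_self_left, Nat.mod_eq_of_lt hx]

theorem pair_div {M x y : ℕ} (hx : x < M) : (x + M * y) / M = y := by
  rw [Nat.add_mul_div_left _ _ (by omega), Nat.div_eq_of_lt hx, zero_add]

theorem pair_lt {M x y : ℕ} (hx : x < M) (hy : y < M) : x + M * y < M * M := by
  have : M * (y + 1) ≤ M * M := Nat.mul_le_mul_left _ hy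
  rw [Nat.mul_add, Nat.mul_one] at this
  omega

section

variable {M : ℕ} {G : (ℕ → ℕ → Prop) → ℕ → ℕ → Prop}

theorem eqv.left_lt {x y : ℕ} (h : eqv M G x y) : x < M := h.1

theorem eqv.right_lt {x y : ℕ} (h : eqv M G x y) : y < M := by
  have := lfp_lt h.2
  exact Nat.lt_of_mul_lt_mul_left (a := M) (by omega)

theorem eqv_closed (hG : MonoRule G) {x y : ℕ} (hx : x < M) (hy : y < M)
    (h : eqvStep M G (lfp (M * M) (eqvStep M G)) (x + M * y)) : eqv M G x y :=
  ⟨hx, lfp_closed (eqvStep_mono hG) (pair_lt hx hy) h⟩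

theorem eqv_refl (hG : MonoRule G) {x : ℕ} (hx : x < M) : eqv M G x x :=
  eqv_closed hG hx hx (Or.inl (by rw [pair_mod hx, pair_div hx]))

theorem eqv.symm {x y : ℕ} (h : eqv M G x y) (hG : MonoRule G) : eqv M G y x :=
  eqv_closed hG h.right_lt h.left_lt (Or.inr (Or.inl (by
    rw [pair_mod h.right_lt, pair_div h.right_lt]; exact h)))

theorem eqv.trans {x y z : ℕ} (h : eqv M G x y) (h' : eqv M G y z) (hG : MonoRule G) :
    eqv M G x z :=
  eqv_closed hG h.left_lt h'.right_lt (Or.inr (Or.inr (Or.inl (by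
    rw [pair_mod h.left_lt, pair_div h.left_lt]; exact ⟨y, h.right_lt, h, h'⟩))))

theorem eqv_rule (hG : MonoRule G) {x y : ℕ} (hx : x < M) (hy : y < M)
    (h : G (eqv M G) x y) : eqv M G x y :=
  eqv_closed hG hx hy (Or.inr (Or.inr (Or.inr (by
    rw [pair_mod hx, pair_div hx]; exact h))))

/-- The induction principle: an equivalence relation `R` with the rule `G` contains the least one. In
the rule, `R` may be restricted to `{0, …, M - 1}`. -/
theorem eqv_least (hG : MonoRule G) {R : ℕ → ℕ → Prop} (hr : ∀ x, R x x)
    (hs : ∀ x y, R x y → R y x) (ht : ∀ x y z, R x y → R y z → R x z)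
    (h : ∀ x < M, ∀ y < M, G (fun x y => x < M ∧ y < M ∧ R x y) x y → R x y) {x y : ℕ}
    (hxy : eqv M G x y) : R x y := by
  have key := lfp_least (eqvStep_mono hG) (X := fun p => p < M * M ∧ R (p % M) (p / M)) ?_ hxy.2
  · rw [pair_mod hxy.1, pair_div hxy.1] at key
    exact key.2
  · intro p hp hstep
    refine ⟨hp, ?_⟩
    have hM : 0 < M := by
      rcases Nat.eq_zero_or_pos M with rfl | h
      · omega
      · exact h
    have h1 : p % M < M := Nat.mod_lt _ hM
    have h2 : p / M < M := Nat.div_lt_of_lt_mul hp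
    rcases hstep with hp | ⟨-, -, hp⟩ | ⟨z, hz, ⟨-, -, hp⟩, -, -, hp'⟩ | hp
    · rw [hp]; exact hr _
    · rw [pair_mod h2, pair_div h2] at hp
      exact hs _ _ hp
    · rw [pair_mod h1, pair_div h1] at hp
      rw [pair_mod hz, pair_div hz] at hp'
      exact ht _ _ _ hp hp'
    · refine h _ h1 _ h2 (hG _ _ ?_ _ _ hp)
      rintro x y ⟨hx, hl, hxy⟩
      rw [pair_mod hx, pair_div hx] at hxy
      exact ⟨hx, Nat.lt_of_mul_lt_mul_left (a := M) (by omega), hxy⟩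

end

variable {α : Type} [Ctx α]

theorem PTPred.eqv {M x y : α → ℕ} (hM : PTFun M) (hx : PTFun x) (hy : PTFun y)
    {G : α → (ℕ → ℕ → Prop) → ℕ → ℕ → Prop}
    (hG : PTPred fun p : ((α × List Bool) × ℕ) × ℕ => G p.1.1.1
      (fun u v => u < M p.1.1.1 ∧ p.1.1.2.getD (u + M p.1.1.1 * v) false = true) p.1.2 p.2) :
    PTPred fun a => PolyTime.eqv (M a) (G a) (x a) (y a) := by
  refine (PTPred.lt hx hM).and (.lfp (F := fun a => eqvStep (M a) (G a)) (hM.mul hM)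
    (hx.add (hM.mul hy)) ?_)
  have hM' : PTFun fun p : (α × List Bool) × ℕ => M p.1.1 := hM.fst.fst
  have h1 := PTFun.snd.mod hM'
  have h2 := PTFun.snd.div hM'
  refine (PTPred.eq h1 h2).or (.or ((PTPred.lt h2 hM').and
    (.arr_of_renaming .fst (h2.add (hM'.mul h1)))) (.or (.ex hM' (.and (.and (.lt h1.fst hM'.fst)
      (.arr_of_renaming (g := fun p : ((α × List Bool) × ℕ) × ℕ => p.1.1) (IsRenaming.fst.comp .fst)
        (h1.fst.add (hM'.fst.mul .snd)))) (.and (.lt .snd hM'.fst)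
      (.arr_of_renaming (g := fun p : ((α × List Bool) × ℕ) × ℕ => p.1.1) (IsRenaming.fst.comp .fst)
        (PTFun.snd.add (hM'.fst.mul h2.fst)))))) ?_))
  exact PTPred.subst₂ (Φ := fun (p : (α × List Bool) × ℕ) u v => G p.1.1
    (fun u v => u < M p.1.1 ∧ p.1.2.getD (u + M p.1.1 * v) false = true) u v) h1 h2
    (hG.comap (IsRenaming.lift_nat (IsRenaming.lift_nat .fst)))

/-- The least element related to `x`; the value is `0` if there is none. -/
noncomputable def least (E : ℕ → ℕ → Prop) (x : ℕ) : ℕ := sInf {y | E x y}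

theorem least_rel {E : ℕ → ℕ → Prop} {x y : ℕ} (h : E x y) : E x (least E x) :=
  Nat.sInf_mem (s := {y | E x y}) ⟨y, h⟩

theorem PTFun.least {x M : α → ℕ} (hM : PTFun M) (hx : PTFun x) {E : α → ℕ → ℕ → Prop}
    (hE : PTPred fun p : (α × ℕ) × ℕ => E p.1.1 p.1.2 p.2) (h : ∀ a x y, E a x y → y < M a) :
    PTFun fun a => PolyTime.least (E a) (x a) := by
  have hE' : PTPred fun p : α × ℕ => E p.1 (x p.1) p.2 :=
    PTPred.subst₂ (Φ := fun (p : α × ℕ) u v => E p.1 u v) hx.fst .snd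
      (hE.comap (IsRenaming.lift_nat (IsRenaming.lift_nat .fst)))
  refine .of_graph hM (fun a => ?_) ((hE'.and (.all (Φ := fun p y => ¬ E p.1 (x p.1) y) .snd (.not ?_))).or
    ((PTPred.eq .snd (.const 0)).and (.all (Φ := fun p y => ¬ E p.1 (x p.1) y) hM.fst (.not ?_)))
    |>.congr fun p => ?_)
  · by_cases h0 : ∃ y, E a (x a) y
    · obtain ⟨y, hy⟩ := h0
      exact (h _ _ _ (least_rel hy)).le
    · push Not at h0
      simp [PolyTime.least, h0]
  · exact PTPred.subst (Φ := fun (p : (α × ℕ) × ℕ) v => E p.1.1 (x p.1.1) v) .snd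
      (hE'.comap (IsRenaming.lift_nat (IsRenaming.fst.comp .fst)))
  · exact hE'.comap (IsRenaming.lift_nat .fst)
  · obtain ⟨a, y⟩ := p
    dsimp only
    by_cases h0 : ∃ y, E a (x a) y
    · obtain ⟨z, hz⟩ := h0
      have h1 := least_rel hz
      have h2 : ∀ v, E a (x a) v → PolyTime.least (E a) (x a) ≤ v := fun v hv => Nat.sInf_le hv
      constructor
      · rintro rfl
        exact Or.inl ⟨h1, fun v hv hE => absurd (h2 v hE) (by omega)⟩
      · rintro (⟨h3, h4⟩ | ⟨-, h4⟩)
        · have := h2 _ h3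
          by_contra hne
          exact h4 _ (by omega) h1
        · exact absurd hz (h4 z (h _ _ _ hz))
    · push Not at h0
      simp [PolyTime.least, h0]

end PolyTime

/-! ### Essentially unary operations of a two-element structure -/

/-- Arguments on which an operation does not depend may be changed one after the other. -/
theorem eq_of_forall_not_dependsOnArg {A : Type*} {k : ℕ} {f : (Fin k → A) → A} {x y : Fin k → A}
    (h : ∀ j, x j ≠ y j → ¬ DependsOnArg f j) : f y = f x := by
  have key : ∀ s : Finset (Fin k), f (s.piecewise y x) = f x := by
    intro s
    induction s using Finset.induction_on with
    | empty => rw [Finset.piecewise_empty]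
    | insert j s hj ih =>
      rw [Finset.piecewise_insert, ← ih]
      by_cases hxy : x j = y j
      · rw [← hxy, ← Finset.piecewise_eq_of_notMem s y x hj, Function.update_eq_self]
      · by_contra hne
        exact h j hxy ⟨_, _, hne⟩
  have := key Finset.univ
  rwa [Finset.piecewise_univ] at this

namespace PolyTime

open FirstOrder.Language.Structure

section

variable {L : FirstOrder.Language.{0, 0}} {A : Type*} [L.Structure A]

/-- An essentially unary operation on truth values is a constant, a projection or a negated
projection; here `none` stands for the constant `False`, and the Boolean says whether the value is
negated. -/
theorem exists_unary_form (e : A ≃ Prop) {k : ℕ} (f : L.Functions k)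
    (hf : EssentiallyUnary fun x : Fin k → A => funMap f x) :
    ∃ c : Option (Fin k) × Bool, ∀ b : Fin k → Prop,
      boolFun e f b ↔ (c.1.elim False b ↔ c.2 = false) := by
  by_cases hd : ∃ i, DependsOnArg (fun x : Fin k → A => funMap f x) i
  · obtain ⟨i, hi⟩ := hd
    have h1 : ∀ b : Fin k → Prop, boolFun e f b = boolFun e f fun _ => b i := by
      intro b
      refine congrArg e (eq_of_forall_not_dependsOnArg (f := fun x : Fin k → A => funMap f x)
        fun j hj hdj => ?_)
      obtain rfl := hf i j hi hdj
      exact hj rfl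
    have h2 : ∀ b : Fin k → Prop, (b i → (boolFun e f b ↔ boolFun e f fun _ => True)) ∧
        (¬ b i → (boolFun e f b ↔ boolFun e f fun _ => False)) := by
      intro b
      constructor <;> intro hb <;> rw [h1] <;> simp [hb]
    by_cases hT : boolFun e f (fun _ => True) <;> by_cases hF : boolFun e f (fun _ => False)
    · refine ⟨(none, true), fun b => ?_⟩
      have := h2 b
      by_cases hb : b i <;> simp_all
    · refine ⟨(some i, false), fun b => ?_⟩
      have := h2 b
      by_cases hb : b i <;> simp_all
    · refine ⟨(some i, true), fun b => ?_⟩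
      have := h2 b
      by_cases hb : b i <;> simp_all
    · refine ⟨(none, false), fun b => ?_⟩
      have := h2 b
      by_cases hb : b i <;> simp_all
  · have h1 : ∀ b : Fin k → Prop, boolFun e f b = boolFun e f fun _ => False := fun b =>
      congrArg e (eq_of_forall_not_dependsOnArg (f := fun x : Fin k → A => funMap f x)
        fun j _ hdj => hd ⟨j, hdj⟩)
    by_cases hF : boolFun e f (fun _ => False)
    · exact ⟨(none, true), fun b => by rw [h1 b]; simp [hF]⟩
    · exact ⟨(none, false), fun b => by rw [h1 b]; simp [hF]⟩

theorem boolRel_graphSymbol (e : A ≃ Prop) {k : ℕ} (f : L.Functions k) (b : Fin (k + 1) → Prop) :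
    boolRel e (FiniteStructure.graphSymbol f) b ↔
      (boolFun e f (fun i => b i.castSucc) ↔ b (Fin.last k)) := by
  change funMap f _ = e.symm _ ↔ _
  rw [Equiv.eq_symm_apply, boolFun, eq_iff_iff]

end

/-! ### From the graph back to a structure with essentially unary operations -/

/-- The partner of a signed element: `2 * z` stands for `z` and `2 * z + 1` for its negation. -/
def flip (w : ℕ) : ℕ := if w % 2 = 0 then w + 1 else w - 1

theorem flip_flip (w : ℕ) : flip (flip w) = w := by
  unfold flip; split_ifs <;> omega

theorem flip_lt {w n : ℕ} (h : w < 2 * n + 2) : flip w < 2 * n + 2 := by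
  unfold flip; split_ifs <;> omega

/-- The essentially unary operation with the form `c` on signed elements; `2 * n` stands for the
constant `False`. -/
def unaryOp {k : ℕ} (c : Option (Fin k) × Bool) (n : ℕ) (y : Fin k → ℕ) : ℕ :=
  if c.2 = true then flip (c.1.elim (2 * n) y) else c.1.elim (2 * n) y

theorem unaryOp_lt {k : ℕ} (c : Option (Fin k) × Bool) {n : ℕ} {y : Fin k → ℕ}
    (hy : ∀ i, y i < 2 * n + 2) : unaryOp c n y < 2 * n + 2 := by
  have : c.1.elim (2 * n) y < 2 * n + 2 := by
    cases c.1 with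
    | none => simp
    | some i => exact hy i
  unfold unaryOp
  split_ifs
  exacts [flip_lt this, this]

/-- The truth value of a signed element. -/
def signed (h : ℕ → Prop) (w : ℕ) : Prop := h (w / 2) ↔ w % 2 = 0

theorem signed_flip (h : ℕ → Prop) (w : ℕ) : signed h (flip w) ↔ ¬ signed h w := by
  unfold signed flip
  split_ifs with hw
  · rw [show (w + 1) / 2 = w / 2 by omega]
    have : ¬ (w + 1) % 2 = 0 := by omega
    simp [hw, this]
  · rw [show (w - 1) / 2 = w / 2 by omega]
    have : (w - 1) % 2 = 0 := by omega
    simp [hw, this]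

theorem signed_two_mul (h : ℕ → Prop) (z : ℕ) : signed h (2 * z) ↔ h z := by
  simp [signed]

theorem signed_unaryOp {h : ℕ → Prop} {k n : ℕ} (hn : ¬ h n) (c : Option (Fin k) × Bool)
    (y : Fin k → ℕ) : signed h (unaryOp c n y) ↔
      (c.1.elim False (fun i => signed h (y i)) ↔ c.2 = false) := by
  have : signed h (c.1.elim (2 * n) y) ↔ c.1.elim False (fun i => signed h (y i)) := by
    cases c.1 with
    | none => simp [signed_two_mul, hn]
    | some i => simp
  unfold unaryOp
  split_ifs with hc
  · rw [signed_flip, this]; simp [hc]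
  · rw [this]; simp [hc]

section

variable {L : FirstOrder.Language.{0, 0}} [Finite L.Symbols]
  (form : ∀ s : (Σ k, L.Functions k), Option (Fin s.1) × Bool)
  (X : FiniteStructure (graphLanguage L))

/-- The rule that generates the equality of signed elements in all homomorphic images: a tuple in
the graph of an operation makes its last entry equal to the value of the operation. -/
def linkRule (R : ℕ → ℕ → Prop) (x y : ℕ) : Prop :=
  R (flip x) (flip y) ∨ ∃ s ∈ functionSymbols L, ∃ j < X.size ^ (s.1 + 1),
    X.rl (FiniteStructure.graphSymbol s.2) j ∧ x = 2 * digit X.size j s.1 ∧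
      y = unaryOp (form s) X.size fun i => 2 * digit X.size j i

theorem linkRule_mono : MonoRule (linkRule form X) := by
  rintro R S h x y (hR | hR)
  · exact Or.inl (h _ _ hR)
  · exact Or.inr hR

/-- The equality of signed elements forced by the graphs of the operations. -/
def linked : ℕ → ℕ → Prop := eqv (2 * X.size + 2) (linkRule form X)

variable {form X}

theorem linked.flip {x y : ℕ} (h : linked form X x y) :
    linked form X (PolyTime.flip x) (PolyTime.flip y) :=
  eqv_rule (linkRule_mono form X) (flip_lt h.left_lt) (flip_lt h.right_lt)
    (Or.inl (by rw [flip_flip, flip_flip]; exact h))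

theorem linked.unaryOp {k : ℕ} (c : Option (Fin k) × Bool) {x y : Fin k → ℕ}
    (h : ∀ i, linked form X (x i) (y i)) :
    linked form X (unaryOp c X.size x) (unaryOp c X.size y) := by
  have : linked form X (c.1.elim (2 * X.size) x) (c.1.elim (2 * X.size) y) := by
    cases c.1 with
    | none => exact eqv_refl (linkRule_mono form X) (by simp)
    | some i => exact h i
  unfold PolyTime.unaryOp
  split_ifs
  exacts [this.flip, this]

theorem linked_least {x : ℕ} (hx : x < 2 * X.size + 2) :
    linked form X x (least (linked form X) x) :=
  least_rel (eqv_refl (linkRule_mono form X) hx)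

/-- Linked elements have the same least partner, which serves as a normal form. -/
theorem linked.least_eq {x y : ℕ} (h : linked form X x y) :
    least (linked form X) x = least (linked form X) y := by
  have hm := linkRule_mono form X
  have : ∀ z, linked form X x z ↔ linked form X y z := fun z =>
    ⟨fun h' => (h.symm hm).trans h' hm, fun h' => h.trans h' hm⟩
  simp only [least, this]

variable (form X)

/-- The `L`-structure on the signed elements in which linked elements are identified, by taking
least elements as the values of operations and the entries of tuples in relations. -/
noncomputable def collapse : FiniteStructure L where
  size := 2 * X.size + 2
  str :=
    { funMap := fun {k} f y => ⟨least (linked form X) (unaryOp (form ⟨k, f⟩) X.size fun i => y i),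
        (linked_least (unaryOp_lt _ fun i => (y i).is_lt)).right_lt⟩
      RelMap := fun {k} R y => ∃ x : Fin k → Fin X.size,
        RelMap (FiniteStructure.relSymbol R) x ∧
          ∀ i, (y i : ℕ) = least (linked form X) (2 * x i) }

theorem fn_collapse {k : ℕ} (f : L.Functions k) {j : ℕ} (hj : j < (2 * X.size + 2) ^ k) :
    (collapse form X).fn f j = least (linked form X)
      (unaryOp (form ⟨k, f⟩) X.size fun i => digit (2 * X.size + 2) j i) :=
  (collapse form X).fn_eq f hj

theorem rl_collapse {k : ℕ} (R : L.Relations k) (j : ℕ) :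
    (collapse form X).rl R j ↔ j < (2 * X.size + 2) ^ k ∧ ∃ j' < X.size ^ k,
      X.rl (FiniteStructure.relSymbol R) j' ∧ ∀ i : Fin k,
        digit (2 * X.size + 2) j i = least (linked form X) (2 * digit X.size j' i) := by
  have key : ∀ hj : j < (2 * X.size + 2) ^ k, (collapse form X).rl R j ↔ ∃ j' < X.size ^ k,
      X.rl (FiniteStructure.relSymbol R) j' ∧ ∀ i : Fin k,
        digit (2 * X.size + 2) j i = least (linked form X) (2 * digit X.size j' i) := fun hj => by
    refine ((collapse form X).rl_iff R hj).trans ⟨?_, ?_⟩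
    · rintro ⟨x, hx, h⟩
      have hlt : ∀ i, (x i : ℕ) < X.size := fun i => (x i).is_lt
      refine ⟨_, tupleCode_lt hlt, (X.rl_tupleCode _ x).2 hx, fun i => ?_⟩
      rw [digit_tupleCode hlt]
      exact h i
    · rintro ⟨j', hj', hx, h⟩
      exact ⟨_, (X.rl_iff _ hj').1 hx, h⟩
  exact ⟨fun h => ⟨(collapse form X).lt_of_rl h, (key ((collapse form X).lt_of_rl h)).1 h⟩,
    fun h => (key h.1).2 h.2⟩

variable {A : Type*} [L.Structure A]

/-- A homomorphism `H` on `X` extends to the signed elements, and respects linked elements, because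
the operations are essentially unary; conversely a homomorphism on the collapsed structure is
restricted to the normal forms of the elements of `X`. -/
theorem nonempty_hom_collapse (e : A ≃ Prop)
    (hform : ∀ (s : Σ k, L.Functions k) (b : Fin s.1 → Prop),
      boolFun e s.2 b ↔ ((form s).1.elim False b ↔ (form s).2 = false)) :
    Nonempty ((graphLanguage L).Hom (Fin X.size) A) ↔
      Nonempty (L.Hom (Fin (collapse form X).size) A) := by
  have hm := linkRule_mono form X
  rw [nonempty_hom_iff e X, nonempty_hom_iff e (collapse form X)]
  constructor
  · rintro ⟨H, -, hR⟩
    set h : ℕ → Prop := fun z => z ≠ X.size ∧ H z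
    have hn : ¬ h X.size := fun hh => hh.1 rfl
    have hH : ∀ z < X.size, h z ↔ H z := fun z hz => ⟨And.right, fun hh => ⟨hz.ne, hh⟩⟩
    have hlink : ∀ x y, linked form X x y → (signed h x ↔ signed h y) := by
      intro x y hxy
      refine eqv_least hm (R := fun x y => (signed h x ↔ signed h y)) (fun _ => Iff.rfl)
        (fun _ _ => Iff.symm) (fun _ _ _ => Iff.trans) ?_ hxy
      rintro x - y - (⟨-, -, h'⟩ | ⟨s, hs, j, hj, hr, rfl, rfl⟩)
      · rwa [signed_flip, signed_flip, not_iff_not] at h'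
      · have := (boolRel_graphSymbol e s.2 _).1
          (hR ⟨_, FiniteStructure.graphSymbol s.2⟩ (mem_relationSymbols _ _) j hj hr)
        have h1 : digit X.size j s.1 < X.size := digit_lt hj (Fin.last _)
        rw [signed_two_mul, hH _ h1, signed_unaryOp hn, ← hform]
        refine this.symm.trans ?_
        refine iff_of_eq (congrArg _ (funext fun i => propext ?_))
        rw [signed_two_mul]
        exact (hH _ (digit_lt hj i.castSucc)).symm
    refine ⟨signed h, ?_, ?_⟩
    · rintro ⟨k, f⟩ - j hj
      dsimp only
      have h1 : ∀ i : Fin k, digit (2 * X.size + 2) j i < 2 * X.size + 2 := digit_lt hj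
      rw [fn_collapse form X f hj, ← hlink _ _ (linked_least (unaryOp_lt _ h1)),
        signed_unaryOp hn, hform ⟨k, f⟩]
      rfl
    · rintro ⟨k, R⟩ - j hj hr
      obtain ⟨-, j', hj', hr', h1⟩ := (rl_collapse form X R j).1 hr
      have := hR ⟨_, FiniteStructure.relSymbol R⟩ (mem_relationSymbols _ _) j' hj' hr'
      refine cast (congrArg _ (funext fun i => propext ?_)) this
      have h2 := digit_lt hj' i
      change _ ↔ signed h (digit (2 * X.size + 2) j i)
      rw [h1 i, ← hlink _ _ (linked_least (by omega)), signed_two_mul, hH _ h2]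
  · rintro ⟨K, hK⟩
    refine ⟨fun x => K (least (linked form X) (2 * x)), fun f => f.2.elim, ?_⟩
    have hl : ∀ x < X.size, linked form X (2 * x) (least (linked form X) (2 * x)) :=
      fun x hx => linked_least (by omega)
    rintro ⟨_, R | f⟩ - j hj hr
    · rename_i k
      have h1 := fun i : Fin k => (hl _ (digit_lt hj i)).right_lt
      have := hK.2 ⟨k, R⟩ (mem_relationSymbols _ _) _ (tupleCode_lt h1)
        ((rl_collapse form X R _).2 ⟨tupleCode_lt h1, j, hj, hr, digit_tupleCode h1⟩)
      refine cast (congrArg _ (funext fun i => ?_)) this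
      exact congrArg K (digit_tupleCode h1 i)
    · rename_i k
      refine (boolRel_graphSymbol e f _).2 ?_
      have h0 := fun i : Fin k => hl _ (digit_lt hj i.castSucc)
      have h1 := fun i : Fin k => (h0 i).right_lt
      have h2 := (hl _ (digit_lt hj (Fin.last k))).left_lt
      have := hK.fn f h1
      rw [← this, show (collapse form X).size = 2 * X.size + 2 from rfl,
        fn_collapse form X f (tupleCode_lt h1)]
      simp only [digit_tupleCode h1]
      rw [← (linked.unaryOp (form ⟨k, f⟩) h0).least_eq]
      refine iff_of_eq (congrArg K (linked.least_eq ?_))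
      exact eqv.symm (eqv_rule hm h2 (unaryOp_lt _ fun i => (h0 i).left_lt)
        (Or.inr ⟨⟨k, f⟩, mem_functionSymbols L _, j, hj, hr, rfl, rfl⟩)) hm

end

section

variable {α : Type} [Ctx α]

theorem PTFun.flip {w : α → ℕ} (hw : PTFun w) : PTFun fun a => PolyTime.flip (w a) :=
  .ite (.eq (hw.mod (.const 2)) (.const 0)) (hw.add (.const 1)) (hw.sub (.const 1))

theorem PTFun.unaryOp {k : ℕ} (c : Option (Fin k) × Bool) {n : α → ℕ} {y : α → Fin k → ℕ}
    (hn : PTFun n) (hy : ∀ i, PTFun fun a => y a i) :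
    PTFun fun a => PolyTime.unaryOp c (n a) (y a) := by
  have : PTFun fun a => c.1.elim (2 * n a) (y a) := by
    cases c.1 with
    | none => exact (PTFun.const 2).mul hn
    | some i => exact hy i
  exact .ite (.const _) this.flip this

variable {L : FirstOrder.Language.{0, 0}} [Finite L.Symbols]

theorem PTPred.linked (form : ∀ s : (Σ k, L.Functions k), Option (Fin s.1) × Bool)
    {X : α → FiniteStructure (graphLanguage L)} (hX : ∀ a, Ctx.inp a = (X a).encode)
    {x y : α → ℕ} (hx : PTFun x) (hy : PTFun y) :
    PTPred fun a => PolyTime.linked form (X a) (x a) (y a) := by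
  have hM : PTFun fun a => 2 * (X a).size + 2 :=
    ((PTFun.const 2).mul (.size hX)).add (.const 2)
  have hX' : ∀ p : ((α × List Bool) × ℕ) × ℕ, Ctx.inp p = (X p.1.1.1).encode := fun p =>
    hX p.1.1.1
  have hX'' : ∀ p : (((α × List Bool) × ℕ) × ℕ) × ℕ, Ctx.inp p = (X p.1.1.1.1).encode := fun p =>
    hX p.1.1.1.1
  have hs := PTFun.size hX''
  have hM' := hM.fst (γ := List Bool) |>.fst (γ := ℕ) |>.fst (γ := ℕ)
  refine .eqv hM hx hy (G := fun a => linkRule form (X a)) (.or ?_ (.exists_mem _ fun s =>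
    .ex ((PTFun.size hX').pow _) (.and (.rl hX'' _ .snd) (.and
      (.eq .var₂ ((PTFun.const 2).mul (.digit hs .snd _)))
      (.eq .var₁ (.unaryOp _ hs fun i => (PTFun.const 2).mul (.digit hs .snd _)))))))
  exact .and (.lt (PTFun.flip .var₁) hM') (.arr_of_renaming
    (g := fun p : ((α × List Bool) × ℕ) × ℕ => p.1.1) (IsRenaming.fst.comp .fst)
    ((PTFun.flip .var₁).add (hM'.mul (PTFun.flip .snd))))

/-- The collapsed structure is a polynomial-time reduction. -/
theorem graph_reducible_csp {A : Type*} [L.Structure A] (e : A ≃ Prop)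
    (hA : ∀ (k : ℕ) (f : L.Functions k), EssentiallyUnary fun x : Fin k → A => funMap f x) :
    (CSP (graphLanguage L) A).ManyOneReducible (CSP L A) := by
  choose form hform using fun s : (Σ k, L.Functions k) => exists_unary_form e s.2 (hA s.1 s.2)
  have hX' : ∀ p : FiniteStructure (graphLanguage L) × ℕ, Ctx.inp p = p.1.encode := fun _ => rfl
  have hX'' : ∀ p : (FiniteStructure (graphLanguage L) × ℕ) × ℕ, Ctx.inp p = p.1.1.encode :=
    fun _ => rfl
  have hM : PTFun fun X : FiniteStructure (graphLanguage L) => 2 * X.size + 2 :=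
    ((PTFun.const 2).mul (.size (X := fun X => X) fun _ => rfl)).add (.const 2)
  have hleast : ∀ {β : Type} [Ctx β] {X : β → FiniteStructure (graphLanguage L)},
      (∀ b, Ctx.inp b = (X b).encode) → ∀ {x : β → ℕ}, PTFun x →
        PTFun fun b => least (linked form (X b)) (x b) := fun hX _ hx =>
    .least (((PTFun.const 2).mul (.size hX)).add (.const 2)) hx
      (.linked form (fun p => hX p.1.1) .var₁ .snd) fun _ _ _ h => h.right_lt
  refine manyOneReducible_of_ptStr (g := collapse form)
    (.encode hM (fun k f => ?_) fun k R => ?_) fun X => nonempty_hom_collapse form X e hform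
  · classical
    refine (PTFun.ite (P := fun p : FiniteStructure (graphLanguage L) × ℕ =>
      p.2 < (2 * p.1.size + 2) ^ k) (.lt .snd (hM.fst.pow k))
      (hleast hX' (.unaryOp (form ⟨k, f⟩) (.size hX') fun i => .digit hM.fst .snd i))
      (.const 0)).congr fun p => ?_
    split_ifs with hj
    · exact fn_collapse form p.1 f hj
    · exact FiniteStructure.fn_of_le _ f (not_lt.1 hj)
  · refine ((PTPred.lt .snd (hM.fst.pow k)).and (.ex (Φ := fun p j' => p.1.rl (FiniteStructure.relSymbol R) j' ∧ ∀ i : Fin k,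
      digit (2 * p.1.size + 2) p.2 i = least (linked form p.1) (2 * digit p.1.size j' i))
      ((PTFun.size hX').pow k) (.and
      (.rl hX'' _ .snd) (.forall_fintype fun i : Fin k => .eq (.digit hM.fst.fst .var₁ i)
        (hleast hX'' ((PTFun.const 2).mul (.digit (.size hX'') .snd i))))))).congr fun p => ?_
    exact rl_collapse form p.1 R p.2

end

end PolyTime

/-! ### Bounded recursion on numbers -/

namespace PolyTime

/-- The rule that generates the graph of a recursively defined function; the pair `(i, w)` has the
code `i + M * w`. -/
def recRule (M m B c : ℕ) (step : ℕ → ℕ → ℕ) (S : ℕ → Prop) (q : ℕ) : Prop :=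
  (q % M = 0 ∧ q / M = c) ∨ ∃ i < m, ∃ w < B + 1, S (i + M * w) ∧ q % M = i + 1 ∧ q / M = step i w

theorem lfp_recRule {M m B c : ℕ} {step : ℕ → ℕ → ℕ} (hM : M = m + B + 1)
    (hB : ∀ i ≤ m, Nat.rec c step i ≤ B) (y : ℕ) (hy : y ≤ B) :
    lfp (M * M) (recRule M m B c step) (m + M * y) ↔ y = Nat.rec c step m := by
  have mono : ∀ X Y : ℕ → Prop, (∀ x, X x → Y x) → ∀ x,
      recRule M m B c step X x → recRule M m B c step Y x := by
    rintro X Y h x (hx | ⟨i, hi, w, hw, h1, h2⟩)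
    · exact Or.inl hx
    · exact Or.inr ⟨i, hi, w, hw, h _ h1, h2⟩
  have up : ∀ i ≤ m, lfp (M * M) (recRule M m B c step) (i + M * Nat.rec c step i) := by
    intro i
    induction i with
    | zero =>
      intro _
      have h0 := hB 0 (Nat.zero_le _)
      refine lfp_closed mono (pair_lt (by omega) (lt_of_le_of_lt h0 (by omega))) (Or.inl ⟨?_, ?_⟩)
      · rw [pair_mod (by omega)]
      · exact pair_div (by omega)
    | succ i ih =>
      intro hi
      have h0 := hB (i + 1) hi
      have h1 := hB i (by omega)
      refine lfp_closed mono (pair_lt (by omega) (lt_of_le_of_lt h0 (by omega)))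
        (Or.inr ⟨i, hi, _, Nat.lt_succ_of_le h1, ih (by omega), ?_, ?_⟩)
      · rw [pair_mod (by omega)]
      · rw [pair_div (by omega)]
  constructor
  · intro h
    have := lfp_least mono (X := fun q => q / M = Nat.rec c step (q % M)) ?_ h
    · rwa [pair_div (by omega), pair_mod (by omega)] at this
    · rintro q hq (⟨h1, h2⟩ | ⟨i, hi, w, hw, h1, h2, h3⟩)
      · rw [h1]
        exact h2
      · rw [pair_div (by omega), pair_mod (by omega)] at h1
        rw [h2, h3, h1]
  · rintro rfl
    exact up m le_rfl

variable {α : Type} [Ctx α]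

/-- Recursion with polynomially bounded values; the graph of the function is a least fixed point. -/
theorem PTFun.natRec {m B c : α → ℕ} (hm : PTFun m) (hB : PTFun B) (hc : PTFun c)
    {step : α → ℕ → ℕ → ℕ} (hstep : PTFun fun p : (α × ℕ) × ℕ => step p.1.1 p.1.2 p.2)
    (h : ∀ a, ∀ i ≤ m a, Nat.rec (c a) (step a) i ≤ B a) :
    PTFun fun a => Nat.rec (c a) (step a) (m a) := by
  have hM := (hm.add hB).add (.const 1)
  refine .of_graph hB (fun a => h a _ le_rfl) (((PTPred.le .snd hB.fst).and
    (.lfp (B := fun p : α × ℕ => (m p.1 + B p.1 + 1) * (m p.1 + B p.1 + 1))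
      (x := fun p => m p.1 + (m p.1 + B p.1 + 1) * p.2)
      (F := fun p => recRule (m p.1 + B p.1 + 1) (m p.1) (B p.1) (c p.1) (step p.1))
      (hM.fst.mul hM.fst) (hm.fst.add (hM.fst.mul .snd)) ?_)).congr fun p => ?_)
  · have hM' : PTFun fun p : ((α × ℕ) × List Bool) × ℕ => m p.1.1.1 + B p.1.1.1 + 1 :=
      hM.fst.fst.fst
    refine .or (.and (.eq (PTFun.snd.mod hM') (.const 0)) (.eq (PTFun.snd.div hM') hc.fst.fst.fst))
      (.ex hm.fst.fst.fst (.ex (hB.fst.fst.fst.fst.add (.const 1)) (.and ?_ (.and ?_ ?_))))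
    · exact .arr_of_renaming (g := fun p : ((((α × ℕ) × List Bool) × ℕ) × ℕ) × ℕ => p.1.1.1)
        (IsRenaming.fst.comp (IsRenaming.fst.comp .fst))
        (PTFun.var₁.add (hM'.fst.fst.mul .snd))
    · exact .eq (PTFun.snd.mod hM').fst.fst (PTFun.var₁.add (.const 1))
    · have h1 : IsRenaming fun p : (((α × ℕ) × List Bool) × ℕ) => p.1.1.1 :=
        IsRenaming.fst.comp (IsRenaming.fst.comp .fst)
      exact .eq (PTFun.snd.div hM').fst.fst (hstep.comap h1.lift_nat.lift_nat)
  · obtain ⟨a, y⟩ := p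
    constructor
    · intro hy
      have h0 : y ≤ B a := hy.le.trans (h a _ le_rfl)
      exact ⟨h0, (lfp_recRule rfl (h a) y h0).2 hy⟩
    · rintro ⟨h0, h1⟩
      exact (lfp_recRule rfl (h a) y h0).1 h1

end PolyTime

/-! ### Operations that depend on two arguments -/

/-- A binary operation depends on both of its arguments. -/
def DependsOnBoth {A : Type*} (g : A → A → A) : Prop :=
  (∃ x y z, g x z ≠ g y z) ∧ ∃ x y z, g z x ≠ g z y

/-- An operation that is not essentially unary has a binary restriction that depends on both
arguments: otherwise, if it is sensitive to the `i`-th argument at one point, it is sensitive to it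
at all points, and hence to no other argument. -/
theorem exists_dependsOnBoth {A : Type*} {k : ℕ} {f : (Fin k → A) → A} (hf : ¬ EssentiallyUnary f) :
    ∃ (i j : Fin k) (c : Fin k → A), i ≠ j ∧
      DependsOnBoth fun x y => f (Function.update (Function.update c i x) j y) := by
  by_contra hno
  push Not at hno
  refine hf fun i j hi hj => ?_
  by_contra hij
  obtain ⟨x, a, hxa⟩ := hi
  -- On a square in the directions `i` and `l`, sensitivity to `i` excludes sensitivity to `l`.
  have face : ∀ (c : Fin k → A) (l : Fin k), l ≠ i →
      f (Function.update c i a) ≠ f (Function.update c i (x i)) →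
        ∀ b y y', f (Function.update (Function.update c i b) l y) =
          f (Function.update (Function.update c i b) l y') := by
    intro c l hl hc b y y'
    by_contra hne
    refine hno i l c hl.symm ⟨⟨a, x i, c l, ?_⟩, y, y', b, hne⟩
    dsimp only
    rwa [Function.update_comm hl.symm, Function.update_comm hl.symm, Function.update_eq_self]
  -- Sensitivity to `i` spreads from `x` to all points, since the other coordinates can be changed
  -- one by one without changing the values on the edges in direction `i`.
  have key : ∀ (y : Fin k → A) (s : Finset (Fin k)),
      f (Function.update (s.piecewise y x) i a) ≠ f (Function.update (s.piecewise y x) i (x i)) := by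
    intro y s
    induction s using Finset.induction_on with
    | empty => rwa [Finset.piecewise_empty, Function.update_eq_self]
    | insert l s hl ih =>
      rw [Finset.piecewise_insert]
      by_cases hli : l = i
      · subst hli
        rwa [Function.update_idem, Function.update_idem]
      · have h := face _ l hli ih
        rw [Function.update_comm hli, Function.update_comm hli, h a _ (s.piecewise y x l),
          h (x i) _ (s.piecewise y x l), ← Function.update_comm hli, ← Function.update_comm hli,
          Function.update_eq_self]
        exact ih
  obtain ⟨y, b, hyb⟩ := hj
  have h1 := key y Finset.univ
  rw [Finset.piecewise_univ] at h1
  have h2 := face y j (Ne.symm hij) h1 (y i) b (y j)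
  rw [Function.update_eq_self, Function.update_eq_self] at h2
  exact hyb h2

namespace PolyTime

/-- Four ways to combine a binary operation with itself. -/
def combine {T : Type*} (m : Fin 4) (t : T → T → T) (x y : T) : T :=
  if m = 0 then t x y else if m = 1 then t (t x y) (t x y) else if m = 2 then t x (t x y)
    else t (t x y) y

theorem combine_map {T T' : Type*} {t : T → T → T} {g : T' → T' → T'} {h : T → T'} {s : Set T}
    (hs : ∀ x ∈ s, ∀ y ∈ s, t x y ∈ s) (H : ∀ x ∈ s, ∀ y ∈ s, h (t x y) = g (h x) (h y))
    (m : Fin 4) {x y : T} (hx : x ∈ s) (hy : y ∈ s) :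
    h (combine m t x y) = combine m g (h x) (h y) := by
  unfold combine
  have := hs x hx y hy
  split_ifs
  · exact H x hx y hy
  · rw [H _ this _ this, H x hx y hy]
  · rw [H x hx _ this, H x hx y hy]
  · rw [H _ this y hy, H x hx y hy]

/-- An operation on truth values that depends on both arguments is the addition modulo two or its
negation, or it generates a conjunction or a disjunction. -/
theorem conjunction_or_addition {g : Prop → Prop → Prop} (hg : DependsOnBoth g) :
    (∃ (m : Fin 4) (c : Prop), ∀ p q, (combine m g p q ↔ c) ↔ (p ↔ c) ∧ (q ↔ c)) ∨
      ∃ c : Prop, ∀ p q, g p q ↔ (p ↔ (q ↔ c)) := by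
  have h0 : ∀ p : Prop, p = True ∨ p = False := Classical.propComplete
  rcases h0 (g True True) with h1 | h1 <;> rcases h0 (g True False) with h2 | h2 <;>
    rcases h0 (g False True) with h3 | h3 <;> rcases h0 (g False False) with h4 | h4 <;>
    first
    | (refine Or.inr ⟨True, ?_⟩; simp [Prop.forall, h1, h2, h3, h4]; done)
    | (refine Or.inr ⟨False, ?_⟩; simp [Prop.forall, h1, h2, h3, h4]; done)
    | (refine Or.inl ⟨0, True, ?_⟩; simp [Prop.forall, combine, h1, h2, h3, h4]; done)
    | (refine Or.inl ⟨0, False, ?_⟩; simp [Prop.forall, combine, h1, h2, h3, h4]; done)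
    | (refine Or.inl ⟨1, True, ?_⟩; simp [Prop.forall, combine, h1, h2, h3, h4]; done)
    | (refine Or.inl ⟨1, False, ?_⟩; simp [Prop.forall, combine, h1, h2, h3, h4]; done)
    | (refine Or.inl ⟨2, True, ?_⟩; simp [Prop.forall, combine, h1, h2, h3, h4]; done)
    | (refine Or.inl ⟨2, False, ?_⟩; simp [Prop.forall, combine, h1, h2, h3, h4]; done)
    | (refine Or.inl ⟨3, True, ?_⟩; simp [Prop.forall, combine, h1, h2, h3, h4]; done)
    | (refine Or.inl ⟨3, False, ?_⟩; simp [Prop.forall, combine, h1, h2, h3, h4]; done)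
    | (exfalso; simp [DependsOnBoth, Prop.exists, h1, h2, h3, h4] at hg)

end PolyTime

/-! ### Solutions closed under a conjunction -/

namespace PolyTime

/-- An operation on numbers, with parameters in a context, whose values are polynomial-time
functions in all extensions of the context. -/
def PTOp {α : Type} [Ctx α] (t : α → ℕ → ℕ → ℕ) : Prop :=
  ∀ ⦃β : Type⦄ [Ctx β] ⦃r : β → α⦄, IsRenaming r → ∀ ⦃f g : β → ℕ⦄, PTFun f → PTFun g →
    PTFun fun b => t (r b) (f b) (g b)

/-- The rule that generates the upward closed set of `a` for a conjunction `t`: the factors of an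
element above `a` are above `a`. -/
def aboveRule (n : ℕ) (t : ℕ → ℕ → ℕ) (a : ℕ) (S : ℕ → Prop) (x : ℕ) : Prop :=
  x = a ∨ ∃ y < n, S (t x y) ∨ S (t y x)

/-- The upward closed set of `a`. -/
def above (n : ℕ) (t : ℕ → ℕ → ℕ) (a : ℕ) : ℕ → Prop := lfp n (aboveRule n t a)

theorem aboveRule_mono {n a : ℕ} {t : ℕ → ℕ → ℕ} (X Y : ℕ → Prop) (h : ∀ x, X x → Y x) (x : ℕ)
    (hx : aboveRule n t a X x) : aboveRule n t a Y x := by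
  rcases hx with rfl | ⟨y, hy, hx⟩
  · exact Or.inl rfl
  · exact Or.inr ⟨y, hy, hx.imp (h _) (h _)⟩

/-- A nonempty set `S` for which `t` is a conjunction is the upward closed set of the product of its
elements. -/
theorem exists_eq_above {n : ℕ} {t : ℕ → ℕ → ℕ} (ht : ∀ x < n, ∀ y < n, t x y < n) {S : ℕ → Prop}
    (hS : ∀ x < n, ∀ y < n, S (t x y) ↔ S x ∧ S y) {b : ℕ} (hb : b < n) (hSb : S b) :
    ∃ a < n, ∀ x < n, S x ↔ above n t a x := by
  have sub : ∀ a, S a → ∀ x, above n t a x → S x := by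
    intro a ha x hx
    refine lfp_least (aboveRule_mono (n := n) (t := t) (a := a)) ?_ hx
    rintro x hx (rfl | ⟨y, hy, h | h⟩)
    · exact ha
    · exact ((hS x hx y hy).1 h).1
    · exact ((hS y hy x hx).1 h).2
  have key : ∀ N ≤ n, ∃ a < n, S a ∧ ∀ x < N, S x → above n t a x := by
    intro N
    induction N with
    | zero => exact fun _ => ⟨b, hb, hSb, fun x hx => absurd hx (Nat.not_lt_zero x)⟩
    | succ N ih =>
      intro hN
      obtain ⟨a, ha, hSa, h⟩ := ih (by omega)
      by_cases hSN : S N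
      · have hp := ht a ha N hN
        have h1 : above n t (t a N) (t a N) := lfp_closed aboveRule_mono hp (Or.inl rfl)
        have h2 : above n t (t a N) a :=
          lfp_closed aboveRule_mono ha (Or.inr ⟨N, hN, Or.inl h1⟩)
        refine ⟨_, hp, (hS a ha N hN).2 ⟨hSa, hSN⟩, fun x hx hSx => ?_⟩
        rcases Nat.lt_succ_iff_lt_or_eq.1 hx with hx | rfl
        · refine lfp_least (aboveRule_mono (n := n) (t := t) (a := a)) ?_ (h x hx hSx)
          rintro x hx (rfl | hx')
          · exact h2
          · exact lfp_closed aboveRule_mono hx (Or.inr hx')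
        · exact lfp_closed aboveRule_mono hN (Or.inr ⟨a, ha, Or.inr h1⟩)
      · refine ⟨a, ha, hSa, fun x hx hSx => ?_⟩
        rcases Nat.lt_succ_iff_lt_or_eq.1 hx with hx | rfl
        · exact h x hx hSx
        · exact absurd hSx hSN
  obtain ⟨a, ha, hSa, h⟩ := key n le_rfl
  exact ⟨a, ha, fun x hx => ⟨h x hx, sub a hSa x⟩⟩

variable {α : Type} [Ctx α]

theorem PTPred.above {n a x : α → ℕ} {t : α → ℕ → ℕ → ℕ} (hn : PTFun n) (ht : PTOp t)
    (ha : PTFun a) (hx : PTFun x) : PTPred fun c => PolyTime.above (n c) (t c) (a c) (x c) := by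
  refine .lfp (F := fun c => aboveRule (n c) (t c) (a c)) hn hx (.or (.eq .snd ha.fst.fst)
    (.ex hn.fst.fst (.or ?_ ?_)))
  all_goals
    refine .arr_of_renaming (g := fun p : ((α × List Bool) × ℕ) × ℕ => p.1.1)
      (IsRenaming.fst.comp .fst) (ht (r := fun p : ((α × List Bool) × ℕ) × ℕ => p.1.1.1)
        (IsRenaming.fst.comp (IsRenaming.fst.comp .fst)) ?_ ?_)
  exacts [.var₁, .snd, .snd, .var₁]

/-! ### Solutions of an addition -/

/-- The rule that generates the equality in all solutions from the cancellation law. -/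
def cancelRule (n : ℕ) (t : ℕ → ℕ → ℕ) (R : ℕ → ℕ → Prop) (x y : ℕ) : Prop :=
  ∃ p < n, R (t p x) (t p y)

/-- The rule that generates the affine hull of `u` and the numbers below `i`. -/
def spanRule (n : ℕ) (t : ℕ → ℕ → ℕ) (u i : ℕ) (S : ℕ → Prop) (x : ℕ) : Prop :=
  x = u ∨ x < i ∨ (∃ y < n, S y ∧ eqv n (cancelRule n t) y x) ∨
    (∃ y < n, ∃ z < n, S y ∧ S z ∧ x = t y z) ∨ ∃ y < n, S y ∧ S (t x y)

/-- The affine hull of `u` and the numbers below `i`. -/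
def span (n : ℕ) (t : ℕ → ℕ → ℕ) (u i : ℕ) : ℕ → Prop := lfp n (spanRule n t u i)

/-- The elements of the greedy affine basis over `u`. -/
def Pivot (n : ℕ) (t : ℕ → ℕ → ℕ) (u i : ℕ) : Prop := ¬ span n t u i i

open Classical in
/-- The number of subsets of the set of pivots below `i`. -/
noncomputable def weight (n : ℕ) (t : ℕ → ℕ → ℕ) (u i : ℕ) : ℕ :=
  Nat.rec 1 (fun i w => if Pivot n t u i then 2 * w else w) i

open Classical in
/-- The weight, replaced by `n + 1` where it is larger. -/
noncomputable def cappedWeight (n : ℕ) (t : ℕ → ℕ → ℕ) (u i : ℕ) : ℕ :=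
  Nat.rec 1 (fun i w => min (if Pivot n t u i then 2 * w else w) (n + 1)) i

/-- The rule that propagates the values of a solution from `u` and the pivots; the fact that `x` has
the value `b` has the code `2 * x + b`. The value at `u` is `0`, the values at the pivots are the
binary digits of `l`. -/
def valueRule (n : ℕ) (t : ℕ → ℕ → ℕ) (u c l : ℕ) (S : ℕ → Prop) (q : ℕ) : Prop :=
  (q / 2 = u ∧ q % 2 = 0) ∨ (Pivot n t u (q / 2) ∧ l / cappedWeight n t u (q / 2) % 2 = q % 2) ∨
    (∃ y < n, S (2 * y + q % 2) ∧ eqv n (cancelRule n t) y (q / 2)) ∨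
    (∃ y < n, ∃ z < n, ∃ a < 2, ∃ b < 2, S (2 * y + a) ∧ S (2 * z + b) ∧ q / 2 = t y z ∧
      q % 2 = (a + b + c) % 2) ∨
    ∃ y < n, ∃ a < 2, ∃ b < 2, S (2 * y + a) ∧ S (2 * t (q / 2) y + b) ∧ q % 2 = (a + b + c) % 2

/-- The values of the solution with the number `l`. -/
def values (n : ℕ) (t : ℕ → ℕ → ℕ) (u c l : ℕ) : ℕ → Prop := lfp (2 * n) (valueRule n t u c l)

section

variable {n : ℕ} {t : ℕ → ℕ → ℕ}

theorem cancelRule_mono : MonoRule (cancelRule n t) := fun _ _ h _ _ ⟨p, hp, hR⟩ =>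
  ⟨p, hp, h _ _ hR⟩

theorem spanRule_mono {u i : ℕ} (X Y : ℕ → Prop) (h : ∀ x, X x → Y x) (x : ℕ)
    (hx : spanRule n t u i X x) : spanRule n t u i Y x := by
  rcases hx with hx | hx | ⟨y, hy, h1, h2⟩ | ⟨y, hy, z, hz, h1, h2, h3⟩ | ⟨y, hy, h1, h2⟩
  · exact Or.inl hx
  · exact Or.inr (Or.inl hx)
  · exact Or.inr (Or.inr (Or.inl ⟨y, hy, h _ h1, h2⟩))
  · exact Or.inr (Or.inr (Or.inr (Or.inl ⟨y, hy, z, hz, h _ h1, h _ h2, h3⟩)))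
  · exact Or.inr (Or.inr (Or.inr (Or.inr ⟨y, hy, h _ h1, h _ h2⟩)))

theorem valueRule_mono {u c l : ℕ} (X Y : ℕ → Prop) (h : ∀ x, X x → Y x) (x : ℕ)
    (hx : valueRule n t u c l X x) : valueRule n t u c l Y x := by
  rcases hx with hx | hx | ⟨y, hy, h1, h2⟩ | ⟨y, hy, z, hz, a, ha, b, hb, h1, h2, h3⟩ |
    ⟨y, hy, a, ha, b, hb, h1, h2, h3⟩
  · exact Or.inl hx
  · exact Or.inr (Or.inl hx)
  · exact Or.inr (Or.inr (Or.inl ⟨y, hy, h _ h1, h2⟩))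
  · exact Or.inr (Or.inr (Or.inr (Or.inl ⟨y, hy, z, hz, a, ha, b, hb, h _ h1, h _ h2, h3⟩)))
  · exact Or.inr (Or.inr (Or.inr (Or.inr ⟨y, hy, a, ha, b, hb, h _ h1, h _ h2, h3⟩)))

open Classical in
theorem weight_succ (u i : ℕ) : weight n t u (i + 1) =
    if Pivot n t u i then 2 * weight n t u i else weight n t u i := rfl

theorem cappedWeight_eq (u i : ℕ) : cappedWeight n t u i = min (weight n t u i) (n + 1) := by
  classical
  induction i with
  | zero => exact (min_eq_left (Nat.le_add_left 1 n)).symm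
  | succ i ih =>
    change min (if Pivot n t u i then 2 * cappedWeight n t u i else cappedWeight n t u i) (n + 1) = _
    rw [weight_succ, ih]
    split_ifs <;> omega

theorem weight_pos (u i : ℕ) : 0 < weight n t u i := by
  induction i with
  | zero => exact Nat.one_pos
  | succ i ih =>
    rw [weight_succ]
    split_ifs <;> omega

theorem two_mul_weight_dvd {u i : ℕ} (hi : Pivot n t u i) {N : ℕ} (hN : i < N) :
    2 * weight n t u i ∣ weight n t u N := by
  induction N with
  | zero => omega
  | succ N ih =>
    rcases Nat.lt_succ_iff_lt_or_eq.1 hN with h | rfl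
    · refine (ih h).trans ?_
      rw [weight_succ]
      split_ifs
      exacts [Dvd.intro_left _ rfl, dvd_rfl]
    · rw [weight_succ, if_pos hi]

/-- The affine hulls increase with `i`. -/
theorem span_mono {u i x : ℕ} (h : span n t u i x) : span n t u (i + 1) x := by
  refine lfp_least (spanRule_mono (n := n) (t := t) (u := u) (i := i)) ?_ h
  rintro x hx (h | h | h)
  · exact lfp_closed spanRule_mono hx (Or.inl h)
  · exact lfp_closed spanRule_mono hx (Or.inr (Or.inl (h.trans (Nat.lt_succ_self i))))
  · exact lfp_closed spanRule_mono hx (Or.inr (Or.inr h))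

/-- Each pivot doubles the size of the affine hull, so that there are at most `n` sets of pivots. -/
theorem weight_le (ht : ∀ x < n, ∀ y < n, t x y < n) {u : ℕ} (hu : u < n) {N : ℕ} (hN : N ≤ n) :
    weight n t u N ≤ n := by
  classical
  have key : ∀ N ≤ n, ∃ D : Finset ℕ, D.card = weight n t u N ∧ (∀ x ∈ D, span n t u N x) ∧
      ∀ x ∈ D, ∀ y ∈ D, eqv n (cancelRule n t) x y → x = y := by
    intro N
    induction N with
    | zero =>
      refine fun _ => ⟨{u}, rfl, fun x hx => ?_, fun x hx y hy _ => ?_⟩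
      · rw [Finset.mem_singleton] at hx
        exact lfp_closed spanRule_mono (by omega) (Or.inl hx)
      · rw [Finset.mem_singleton] at hx hy
        exact hx.trans hy.symm
    | succ N ih =>
      intro hN
      obtain ⟨D, hcard, hspan, hD⟩ := ih (by omega)
      have hlt : ∀ x ∈ D, x < n := fun x hx => lfp_lt (hspan x hx)
      rw [weight_succ]
      split_ifs with hp
      · have hcancel : ∀ x ∈ D, ∀ y ∈ D, eqv n (cancelRule n t) (t N x) (t N y) → x = y :=
          fun x hx y hy h => hD x hx y hy
            (eqv_rule cancelRule_mono (hlt x hx) (hlt y hy) ⟨N, hN, h⟩)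
        have hinj : Set.InjOn (t N) D := fun x hx y hy h =>
          hcancel x hx y hy (h ▸ eqv_refl cancelRule_mono (ht N hN x (hlt x hx)))
        have hsep : ∀ x ∈ D, ∀ y ∈ D, ¬ eqv n (cancelRule n t) x (t N y) := fun x hx y hy h => by
          have h1 : span n t u N (t N y) := lfp_closed spanRule_mono h.right_lt
            (Or.inr (Or.inr (Or.inl ⟨x, hlt x hx, hspan x hx, h⟩)))
          exact hp (lfp_closed spanRule_mono hN (Or.inr (Or.inr (Or.inr (Or.inr
            ⟨y, hlt y hy, hspan y hy, h1⟩)))))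
        have hdisj : Disjoint D (D.image (t N)) := by
          rw [Finset.disjoint_left]
          intro x hx hx'
          obtain ⟨y, hy, rfl⟩ := Finset.mem_image.1 hx'
          exact hsep _ hx y hy (eqv_refl cancelRule_mono (hlt _ hx))
        -- The translates `t N x` of the old elements lie outside of the old hull.
        refine ⟨D ∪ D.image (t N), ?_, fun x hx => ?_, fun x hx y hy h => ?_⟩
        · rw [Finset.card_union_of_disjoint hdisj, Finset.card_image_of_injOn hinj, hcard]
          omega
        · rcases Finset.mem_union.1 hx with hx | hx
          · exact span_mono (hspan x hx)
          · obtain ⟨y, hy, rfl⟩ := Finset.mem_image.1 hx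
            have hNN : span n t u (N + 1) N :=
              lfp_closed spanRule_mono hN (Or.inr (Or.inl (Nat.lt_succ_self N)))
            exact lfp_closed spanRule_mono (ht N hN y (hlt y hy)) (Or.inr (Or.inr (Or.inr (Or.inl
              ⟨N, hN, y, hlt y hy, hNN, span_mono (hspan y hy), rfl⟩))))
        · rcases Finset.mem_union.1 hx with hx | hx <;> rcases Finset.mem_union.1 hy with hy | hy
          · exact hD x hx y hy h
          · obtain ⟨y', hy', rfl⟩ := Finset.mem_image.1 hy
            exact absurd h (hsep x hx y' hy')
          · obtain ⟨x', hx', rfl⟩ := Finset.mem_image.1 hx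
            exact absurd (h.symm cancelRule_mono) (hsep y hy x' hx')
          · obtain ⟨x', hx', rfl⟩ := Finset.mem_image.1 hx
            obtain ⟨y', hy', rfl⟩ := Finset.mem_image.1 hy
            rw [hcancel x' hx' y' hy' h]
      · exact ⟨D, hcard, fun x hx => span_mono (hspan x hx), hD⟩
  obtain ⟨D, hcard, hspan, -⟩ := key N hN
  rw [← hcard, ← Finset.card_range n]
  exact Finset.card_le_card fun x hx => Finset.mem_range.2 (lfp_lt (hspan x hx))

/-- The values at the pivots are arbitrary. -/
theorem exists_digits (u : ℕ) {h : ℕ → ℕ} (hh : ∀ x, h x < 2) (N : ℕ) :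
    ∃ l < weight n t u N, ∀ i < N, Pivot n t u i → l / weight n t u i % 2 = h i := by
  induction N with
  | zero => exact ⟨0, Nat.one_pos, fun i hi => absurd hi (Nat.not_lt_zero i)⟩
  | succ N ih =>
    obtain ⟨l, hl, hdig⟩ := ih
    by_cases hp : Pivot n t u N
    -- The weight of `N` is a power of two above `l`, so that the new digit stands in front.
    · refine ⟨l + weight n t u N * h N, ?_, fun i hi hpi => ?_⟩
      · rw [weight_succ, if_pos hp]
        have := hh N
        have : weight n t u N * h N ≤ weight n t u N * 1 := Nat.mul_le_mul_left _ (by omega)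
        omega
      · rcases Nat.lt_succ_iff_lt_or_eq.1 hi with hi | rfl
        · obtain ⟨q, hq⟩ := two_mul_weight_dvd hpi hi
          rw [hq, show 2 * weight n t u i * q * h N = weight n t u i * (2 * (q * h N)) by ring,
            Nat.add_mul_div_left _ _ (weight_pos u i), Nat.add_mul_mod_self_left]
          exact hdig i hi hpi
        · rw [Nat.add_mul_div_left _ _ (weight_pos u i), Nat.div_eq_of_lt hl, zero_add]
          exact Nat.mod_eq_of_lt (hh i)
    · refine ⟨l, by rwa [weight_succ, if_neg hp], fun i hi hpi => ?_⟩
      rcases Nat.lt_succ_iff_lt_or_eq.1 hi with hi | rfl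
      · exact hdig i hi hpi
      · exact absurd hpi hp

/-- Every solution that vanishes at `u` is determined by its values at the pivots. -/
theorem exists_values {u c : ℕ} (ht : ∀ x < n, ∀ y < n, t x y < n) (hu : u < n) {h : ℕ → ℕ}
    (hh : ∀ x, h x < 2) (hhu : h u = 0)
    (hadd : ∀ x < n, ∀ y < n, h (t x y) = (h x + h y + c) % 2) :
    ∃ l < n, ∀ x < n, values n t u c l (2 * x + 1) ↔ h x = 1 := by
  obtain ⟨l, hl, hdig⟩ := exists_digits (n := n) (t := t) u hh n
  have hE : ∀ x y, eqv n (cancelRule n t) x y → h x = h y := fun x y hxy =>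
    eqv_least cancelRule_mono (R := fun x y => h x = h y) (fun _ => rfl) (fun _ _ => Eq.symm)
      (fun _ _ _ => Eq.trans) (fun x hx y hy ⟨p, hp, _, _, h1⟩ => by
        rw [hadd p hp x hx, hadd p hp y hy] at h1
        have := hh x
        have := hh y
        omega) hxy
  have hcap : ∀ x < n, cappedWeight n t u x = weight n t u x := fun x hx => by
    have := weight_le ht hu hx.le
    rw [cappedWeight_eq]
    omega
  -- Only values of `h` are derived.
  have sound : ∀ q, values n t u c l q → q % 2 = h (q / 2) := by
    intro q hq
    refine lfp_least (valueRule_mono (n := n) (t := t) (u := u) (c := c) (l := l))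
      (X := fun q => q % 2 = h (q / 2)) ?_ hq
    have e : ∀ y a : ℕ, a < 2 → (2 * y + a) % 2 = a ∧ (2 * y + a) / 2 = y := by omega
    rintro q hq (⟨h1, h2⟩ | ⟨h1, h2⟩ | ⟨y, hy, h1, h2⟩ | ⟨y, hy, z, hz, a, ha, b, hb, h1, h2, h3, h4⟩ |
      ⟨y, hy, a, ha, b, hb, h1, h2, h3⟩)
    · rw [h1, h2, hhu]
    · rw [← h2, hcap _ (by omega)]
      exact hdig _ (by omega) h1
    · have h3 := e y (q % 2) (by omega)
      rw [h3.1, h3.2] at h1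
      rw [h1]
      exact hE _ _ h2
    · rw [(e y a ha).1, (e y a ha).2] at h1
      rw [(e z b hb).1, (e z b hb).2] at h2
      rw [h4, h3, h1, h2, hadd y hy z hz]
    · rw [(e y a ha).1, (e y a ha).2] at h1
      rw [(e _ b hb).1, (e _ b hb).2, hadd _ (by omega) y hy] at h2
      have := hh (q / 2)
      change q % 2 = h (q / 2)
      omega
  have closed : ∀ x < n, valueRule n t u c l (values n t u c l) (2 * x + h x) →
      values n t u c l (2 * x + h x) := fun x hx h1 =>
    lfp_closed valueRule_mono (by have := hh x; omega) h1
  have e1 : ∀ x, (2 * x + h x) / 2 = x := fun x => by have := hh x; omega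
  have e2 : ∀ x, (2 * x + h x) % 2 = h x := fun x => by have := hh x; omega
  -- All values of `h` are derived: an element that is not a pivot is in the hull of earlier elements.
  have complete : ∀ x < n, values n t u c l (2 * x + h x) := by
    intro x
    induction x using Nat.strong_induction_on with
    | _ x ih =>
      intro hx
      by_cases hp : Pivot n t u x
      · refine closed x hx (Or.inr (Or.inl ?_))
        rw [e1, e2, hcap x hx]
        exact ⟨hp, hdig x hx hp⟩
      · refine lfp_least (spanRule_mono (n := n) (t := t) (u := u) (i := x))
          (X := fun y => values n t u c l (2 * y + h y)) ?_ (not_not.1 hp)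
        rintro y hy (rfl | hlt | ⟨z, hz, h1, h2⟩ | ⟨z, hz, w, hw, h1, h2, rfl⟩ | ⟨z, hz, h1, h2⟩)
        · exact closed y hy (Or.inl (by rw [e1, e2]; exact ⟨rfl, hhu⟩))
        · exact ih y hlt hy
        · refine closed y hy (Or.inr (Or.inr (Or.inl ⟨z, hz, ?_⟩)))
          rw [e1, e2, ← hE _ _ h2]
          exact ⟨h1, h2⟩
        · refine closed _ hy (Or.inr (Or.inr (Or.inr (Or.inl
            ⟨z, hz, w, hw, _, hh z, _, hh w, h1, h2, ?_⟩))))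
          rw [e1, e2]
          exact ⟨rfl, hadd z hz w hw⟩
        · refine closed y hy (Or.inr (Or.inr (Or.inr (Or.inr
            ⟨z, hz, _, hh z, h (t y z), hh _, h1, ?_, ?_⟩))))
          · rw [e1]
            exact h2
          · rw [e2, hadd y hy z hz]
            have := hh y
            omega
  refine ⟨l, hl.trans_le (weight_le ht hu le_rfl), fun x hx => ⟨fun h1 => ?_, fun h1 => ?_⟩⟩
  · have := sound _ h1
    rw [show (2 * x + 1) / 2 = x by omega] at this
    omega
  · rw [← h1]
    exact complete x hx

end

theorem PTOp.comap {β : Type} [Ctx β] {t : α → ℕ → ℕ → ℕ} (ht : PTOp t) {r : β → α}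
    (hr : IsRenaming r) : PTOp fun b => t (r b) := by
  intro _ _ _ hr' _ _ hf hg
  exact ht (hr.comp hr') hf hg

theorem PTPred.cancel {n x y : α → ℕ} {t : α → ℕ → ℕ → ℕ} (hn : PTFun n) (ht : PTOp t)
    (hx : PTFun x) (hy : PTFun y) :
    PTPred fun c => PolyTime.eqv (n c) (cancelRule (n c) (t c)) (x c) (y c) := by
  have hr : IsRenaming fun p : (((α × List Bool) × ℕ) × ℕ) × ℕ => p.1.1.1.1 :=
    IsRenaming.fst.comp (IsRenaming.fst.comp (IsRenaming.fst.comp .fst))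
  have h1 := ht hr .snd .var₂
  have h2 := ht hr .snd .var₁
  have hn' := hn.comap hr
  exact .eqv (G := fun c => cancelRule (n c) (t c)) hn hx hy (.ex (hn.fst.fst.fst)
    (.and (.lt h1 hn') (.arr_of_renaming
      (g := fun p : (((α × List Bool) × ℕ) × ℕ) × ℕ => p.1.1.1)
      (IsRenaming.fst.comp (IsRenaming.fst.comp .fst)) (h1.add (hn'.mul h2)))))

theorem PTPred.span {n u i x : α → ℕ} {t : α → ℕ → ℕ → ℕ} (hn : PTFun n) (ht : PTOp t)
    (hu : PTFun u) (hi : PTFun i) (hx : PTFun x) :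
    PTPred fun c => PolyTime.span (n c) (t c) (u c) (i c) (x c) := by
  have hr₁ : IsRenaming fun p : ((α × List Bool) × ℕ) × ℕ => p.1.1.1 :=
    IsRenaming.fst.comp (IsRenaming.fst.comp .fst)
  have hr₂ : IsRenaming fun p : (((α × List Bool) × ℕ) × ℕ) × ℕ => p.1.1.1.1 := hr₁.comp .fst
  have ha₁ : IsRenaming fun p : ((α × List Bool) × ℕ) × ℕ => p.1.1 := IsRenaming.fst.comp .fst
  have ha₂ : IsRenaming fun p : (((α × List Bool) × ℕ) × ℕ) × ℕ => p.1.1.1 := ha₁.comp .fst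
  refine .lfp (F := fun c => spanRule (n c) (t c) (u c) (i c)) hn hx (.or (.eq .snd hu.fst.fst)
    (.or (.lt .snd hi.fst.fst) (.or (.ex hn.fst.fst (.and (.arr_of_renaming ha₁ .snd) ?_))
      (.or (.ex hn.fst.fst (.ex hn.fst.fst.fst (.and (.arr_of_renaming ha₂ .var₁)
        (.and (.arr_of_renaming ha₂ .snd) (.eq .var₂ (ht hr₂ .var₁ .snd))))))
        (.ex hn.fst.fst (.and (.arr_of_renaming ha₁ .snd)
          (.arr_of_renaming ha₁ (ht hr₁ .var₁ .snd))))))))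
  exact .cancel (t := fun p : ((α × List Bool) × ℕ) × ℕ => t p.1.1.1) hn.fst.fst.fst
    (ht.comap hr₁) .snd .var₁

theorem PTPred.pivot {n u i : α → ℕ} {t : α → ℕ → ℕ → ℕ} (hn : PTFun n) (ht : PTOp t)
    (hu : PTFun u) (hi : PTFun i) : PTPred fun c => Pivot (n c) (t c) (u c) (i c) :=
  (PTPred.span hn ht hu hi hi).not

theorem PTFun.cappedWeight {n u i : α → ℕ} {t : α → ℕ → ℕ → ℕ} (hn : PTFun n) (ht : PTOp t)
    (hu : PTFun u) (hi : PTFun i) :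
    PTFun fun c => PolyTime.cappedWeight (n c) (t c) (u c) (i c) := by
  classical
  have hr : IsRenaming fun p : (α × ℕ) × ℕ => p.1.1 := IsRenaming.fst.comp .fst
  have h1 : PTFun fun p : (α × ℕ) × ℕ =>
      if Pivot (n p.1.1) (t p.1.1) (u p.1.1) p.1.2 then 2 * p.2 else p.2 :=
    .ite (.pivot (t := fun p : (α × ℕ) × ℕ => t p.1.1) hn.fst.fst (ht.comap hr) hu.fst.fst .var₁)
      ((PTFun.const 2).mul .snd) .snd
  have h2 : PTFun fun p : (α × ℕ) × ℕ => n p.1.1 + 1 := hn.fst.fst.add (.const 1)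
  refine .natRec (B := fun c => n c + 1) (c := fun _ => 1) hi (hn.add (.const 1)) (.const 1)
    (step := fun c i w => min (if Pivot (n c) (t c) (u c) i then 2 * w else w) (n c + 1))
    ((PTFun.ite (.le h1 h2) h1 h2).congr fun p => min_def _ _) fun c i _ => ?_
  cases i with
  | zero => exact Nat.le_add_left 1 _
  | succ i => exact min_le_right _ _

theorem PTPred.values {n u l x : α → ℕ} {t : α → ℕ → ℕ → ℕ} (hn : PTFun n) (ht : PTOp t)
    (hu : PTFun u) (c : ℕ) (hl : PTFun l) (hx : PTFun x) :
    PTPred fun a => PolyTime.values (n a) (t a) (u a) c (l a) (x a) := by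
  have hr₀ : IsRenaming fun p : (α × List Bool) × ℕ => p.1.1 := IsRenaming.fst.comp .fst
  have ha₀ : IsRenaming fun p : (α × List Bool) × ℕ => p.1 := .fst
  have hq := PTFun.snd (α := α × List Bool).div (.const 2)
  have hb := PTFun.snd (α := α × List Bool).mod (.const 2)
  have hn₀ := hn.comap hr₀
  have two : ∀ {β : Type} [Ctx β], PTFun fun _ : β => 2 := .const 2
  refine .lfp (F := fun a => valueRule (n a) (t a) (u a) c (l a)) (two.mul hn) hx (.or (.and
    (.eq hq hu.fst.fst) (.eq hb (.const 0))) (.or (.and ?_ ?_) (.or (.ex hn₀ (.and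
    (.arr_of_renaming (ha₀.comp .fst) ((two.mul .snd).add hb.fst)) ?_)) (.or ?_ ?_))))
  · exact .pivot (t := fun p : (α × List Bool) × ℕ => t p.1.1) hn₀ (ht.comap hr₀) hu.fst.fst hq
  · exact .eq ((hl.fst.fst.div (.cappedWeight (t := fun p : (α × List Bool) × ℕ => t p.1.1) hn₀
      (ht.comap hr₀) hu.fst.fst hq)).mod two) hb
  · exact .cancel (t := fun p : ((α × List Bool) × ℕ) × ℕ => t p.1.1.1) hn₀.fst
      (ht.comap (hr₀.comp .fst)) .snd hq.fst
  · have ha : IsRenaming fun p : (((((α × List Bool) × ℕ) × ℕ) × ℕ) × ℕ) × ℕ => p.1.1.1.1.1 :=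
      (((ha₀.comp .fst).comp .fst).comp .fst).comp .fst
    exact .ex hn₀ (.ex hn₀.fst (.ex two (.ex two (.and
      (.arr_of_renaming ha ((two.mul PTFun.var₂.fst).add .var₁)) (.and
      (.arr_of_renaming ha ((two.mul .var₂).add .snd)) (.and
      (.eq hq.fst.fst.fst.fst (ht ((((hr₀.comp .fst).comp .fst).comp .fst).comp .fst)
        PTFun.var₂.fst .var₂))
      (.eq hb.fst.fst.fst.fst (((PTFun.var₁.add .snd).add (.const c)).mod two))))))))
  · have ha : IsRenaming fun p : ((((α × List Bool) × ℕ) × ℕ) × ℕ) × ℕ => p.1.1.1.1 :=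
      ((ha₀.comp .fst).comp .fst).comp .fst
    exact .ex hn₀ (.ex two (.ex two (.and
      (.arr_of_renaming ha ((two.mul .var₂).add .var₁)) (.and
      (.arr_of_renaming ha ((two.mul (ht (((hr₀.comp .fst).comp .fst).comp .fst) hq.fst.fst.fst
        .var₂)).add .snd))
      (.eq hb.fst.fst.fst (((PTFun.var₁.add .snd).add (.const c)).mod two))))))

end PolyTime

/-! ### Structures with an operation that is not essentially unary -/

namespace PolyTime

open FirstOrder.Language.Structure

variable {L : FirstOrder.Language.{0, 0}} {A : Type*}

open Classical in
/-- The binary operation obtained from a basic operation by fixing the arguments other than the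
`i`-th and the `j`-th; `u` and `v` stand for the elements of the template. -/
noncomputable def restrict (e : A ≃ Prop) {k : ℕ} (f : L.Functions k) (i j : Fin k) (c : Fin k → A)
    (X : FiniteStructure L) (u v x y : ℕ) : ℕ :=
  X.fn f (tupleCode X.size fun l =>
    if l = j then y else if l = i then x else if e (c l) then v else u)

section

variable (e : A ≃ Prop) {k : ℕ} (f : L.Functions k) (i j : Fin k) (c : Fin k → A)

section

variable {X : FiniteStructure L} {u v : ℕ}

theorem restrict_args_lt (hu : u < X.size) (hv : v < X.size) {x y : ℕ} (hx : x < X.size)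
    (hy : y < X.size) (l : Fin k) [DecidablePred fun l => (e (c l) : Prop)] :
    (if l = j then y else if l = i then x else if e (c l) then v else u) < X.size := by
  split_ifs <;> assumption

theorem restrict_lt (hu : u < X.size) (hv : v < X.size) {x y : ℕ} (hx : x < X.size)
    (hy : y < X.size) : restrict e f i j c X u v x y < X.size :=
  X.fn_lt f (tupleCode_lt fun l => by classical exact restrict_args_lt e i j c hu hv hx hy l)

end

theorem PTOp.restrict [Finite L.Symbols] :
    PTOp fun a : (FiniteStructure L × ℕ) × ℕ => PolyTime.restrict e f i j c a.1.1 a.1.2 a.2 := by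
  intro β _ r hr g h hg hh
  have hX : ∀ b, Ctx.inp b = (r b).1.1.encode := fun b => by
    obtain ⟨ρ, τ, hr⟩ := hr
    exact (hr b).1.symm
  refine .fn hX f (.tupleCode (.size hX) fun l => ?_)
  split_ifs
  exacts [hh, hg, PTFun.snd.comap hr, PTFun.var₁.comap hr]

theorem PTOp.combine {α : Type} [Ctx α] {t : α → ℕ → ℕ → ℕ} (ht : PTOp t) (m : Fin 4) :
    PTOp fun a => PolyTime.combine m (t a) := by
  intro β _ r hr g h hg hh
  unfold PolyTime.combine
  split_ifs
  exacts [ht hr hg hh, ht hr (ht hr hg hh) (ht hr hg hh), ht hr hg (ht hr hg hh),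
    ht hr (ht hr hg hh) hh]

variable [L.Structure A]

/-- The corresponding binary operation on truth values. -/
def restrictProp (p q : Prop) : Prop :=
  e (funMap f (Function.update (Function.update c i (e.symm p)) j (e.symm q)))

theorem dependsOnBoth_restrictProp
    (h : DependsOnBoth fun x y => funMap f (Function.update (Function.update c i x) j y)) :
    DependsOnBoth (restrictProp e f i j c) := by
  obtain ⟨⟨x, y, z, h1⟩, x', y', z', h2⟩ := h
  refine ⟨⟨e x, e y, e z, fun h => h1 ?_⟩, e x', e y', e z', fun h => h2 ?_⟩ <;>
    simpa [restrictProp] using h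

variable {X : FiniteStructure L} {u v : ℕ}

theorem IsHom.restrict [Finite L.Symbols] {e : A ≃ Prop} {H : ℕ → Prop} (h : IsHom e X H)
    (hu : u < X.size) (hv : v < X.size) (hHu : ¬ H u) (hHv : H v) {x y : ℕ} (hx : x < X.size)
    (hy : y < X.size) : H (PolyTime.restrict e f i j c X u v x y) =
      restrictProp e f i j c (H x) (H y) := by
  classical
  refine (propext (h.fn f fun l => restrict_args_lt e i j c hu hv hx hy l)).trans ?_
  refine congrArg (fun z => e (funMap f z)) (funext fun l => ?_)
  rcases eq_or_ne l j with rfl | hj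
  · simp
  rcases eq_or_ne l i with rfl | hi
  · simp [hj]
  dsimp only
  rw [Function.update_of_ne hj, Function.update_of_ne hi, if_neg hj, if_neg hi, Equiv.symm_apply_eq]
  by_cases hc : e (c l) <;> simp [hc, hHu, hHv]

end

variable [L.Structure A] [Finite L.Symbols]

theorem IsHom.congr {e : A ≃ Prop} {X : FiniteStructure L} {H H' : ℕ → Prop} (h : IsHom e X H)
    (hH : ∀ x < X.size, H' x ↔ H x) : IsHom e X H' := by
  have hdig : ∀ (k j : ℕ) (hj : j < X.size ^ k), (fun i : Fin k => H' (digit X.size j i)) =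
      fun i : Fin k => H (digit X.size j i) := fun k j hj =>
    funext fun i => propext (hH _ (digit_lt hj i))
  refine ⟨fun f hf j hj => ?_, fun R hR j hj hr => ?_⟩
  · rw [hH _ (X.fn_lt f.2 hj), hdig _ _ hj]
    exact h.1 f hf j hj
  · rw [hdig _ _ hj]
    exact h.2 R hR j hj hr

/-- If all nonconstant homomorphisms occur in a polynomial-time enumeration, with parameters among
which are elements `u` and `v` that are mapped to false and true, the problem is in P. -/
theorem inP_of_candidates (e : A ≃ Prop)
    {cand : ((FiniteStructure L × ℕ) × ℕ) × ℕ → ℕ → Prop}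
    (hcand : PTPred fun p : (((FiniteStructure L × ℕ) × ℕ) × ℕ) × ℕ => cand p.1 p.2)
    (h : ∀ (X : FiniteStructure L) (H : ℕ → Prop) (u v : ℕ), IsHom e X H → u < X.size →
      v < X.size → ¬ H u → H v → ∃ l < X.size, ∀ x < X.size, cand (((X, u), v), l) x ↔ H x) :
    (CSP L A).InP := by
  have hX₀ : ∀ X : FiniteStructure L, Ctx.inp X = X.encode := fun _ => rfl
  have hX₁ : ∀ p : FiniteStructure L × ℕ, Ctx.inp p = p.1.encode := fun _ => rfl
  have hX₂ : ∀ p : (FiniteStructure L × ℕ) × ℕ, Ctx.inp p = p.1.1.encode := fun _ => rfl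
  have hX₃ : ∀ p : ((FiniteStructure L × ℕ) × ℕ) × ℕ, Ctx.inp p = p.1.1.1.encode := fun _ => rfl
  refine inP_of_ptPred (Φ := fun X => IsHom e X (fun _ => False) ∨ IsHom e X (fun _ => True) ∨
    ∃ u < X.size, ∃ v < X.size, ∃ l < X.size, IsHom e X (cand (((X, u), v), l)))
    (.or (.isHom hX₀ e (.const False)) (.or (.isHom hX₀ e (.const True))
      (.ex (.size hX₀) (.ex (.size hX₁) (.ex (.size hX₂)
        (.isHom hX₃ (H := fun p => cand p) e hcand)))))) fun X => ?_
  refine (nonempty_hom_iff e X).trans ⟨?_, ?_⟩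
  · rintro ⟨H, hH⟩
    by_cases h0 : ∃ u < X.size, ¬ H u
    · by_cases h1 : ∃ v < X.size, H v
      · obtain ⟨u, hu, hHu⟩ := h0
        obtain ⟨v, hv, hHv⟩ := h1
        obtain ⟨l, hl, hc⟩ := h X H u v hH hu hv hHu hHv
        exact Or.inr (Or.inr ⟨u, hu, v, hv, l, hl, hH.congr hc⟩)
      · push Not at h1
        exact Or.inl (hH.congr fun x hx => by simp [h1 x hx])
    · push Not at h0
      exact Or.inr (Or.inl (hH.congr fun x hx => by simp [h0 x hx]))
  · rintro (h | h | ⟨u, -, v, -, l, -, h⟩) <;> exact ⟨_, h⟩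

/-- The nonconstant homomorphisms respect a binary operation that generates a conjunction or is an
addition. In the first case they are given by the upward closed sets, in the second case by the
digits at the pivots. -/
theorem inP_of_not_essentiallyUnary (e : A ≃ Prop) {k : ℕ} {f : L.Functions k}
    (hf : ¬ EssentiallyUnary fun x : Fin k → A => funMap f x) : (CSP L A).InP := by
  classical
  obtain ⟨i, j, c, -, hboth⟩ := exists_dependsOnBoth hf
  have hX : ∀ p : (((FiniteStructure L × ℕ) × ℕ) × ℕ) × ℕ, Ctx.inp p = p.1.1.1.1.encode :=
    fun _ => rfl
  have hr : IsRenaming fun p : (((FiniteStructure L × ℕ) × ℕ) × ℕ) × ℕ => p.1.1 :=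
    IsRenaming.fst.comp .fst
  have hop := PTOp.comap (PTOp.restrict e f i j c) hr
  rcases conjunction_or_addition (dependsOnBoth_restrictProp e f i j c hboth) with
    ⟨m, b, hm⟩ | ⟨b, hb⟩
  · refine inP_of_candidates e (cand := fun p x => above p.1.1.1.size
      (combine m (restrict e f i j c p.1.1.1 p.1.1.2 p.1.2)) p.2 x ↔ b)
      (.iff (.above (t := fun p : (((FiniteStructure L × ℕ) × ℕ) × ℕ) × ℕ =>
        combine m (restrict e f i j c p.1.1.1.1 p.1.1.1.2 p.1.1.2)) (.size hX) (PTOp.combine hop m)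
        .var₁ .snd) (.const b)) fun X H u v hH hu hv hHu hHv => ?_
    have hlt : ∀ x < X.size, ∀ y < X.size, restrict e f i j c X u v x y < X.size :=
      fun x hx y hy => restrict_lt e f i j c hu hv hx hy
    have hlt' : ∀ x < X.size, ∀ y < X.size, combine m (restrict e f i j c X u v) x y < X.size := by
      intro x hx y hy
      have h1 := hlt x hx y hy
      unfold combine
      split_ifs
      exacts [h1, hlt _ h1 _ h1, hlt x hx _ h1, hlt _ h1 y hy]
    have hS : ∀ x < X.size, ∀ y < X.size,
        (H (combine m (restrict e f i j c X u v) x y) ↔ b) ↔ (H x ↔ b) ∧ (H y ↔ b) := by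
      intro x hx y hy
      rw [combine_map (h := H) (s := {x | x < X.size}) hlt (fun x hx y hy =>
        hH.restrict f i j c hu hv hHu hHv hx hy) m hx hy]
      exact hm _ _
    obtain ⟨w, hw, hwb⟩ : ∃ w < X.size, H w ↔ b := by
      by_cases hb : b
      · exact ⟨v, hv, iff_of_true hHv hb⟩
      · exact ⟨u, hu, iff_of_false hHu hb⟩
    obtain ⟨a, ha, hab⟩ := exists_eq_above (S := fun x => H x ↔ b) hlt' hS hw hwb
    refine ⟨a, ha, fun x hx => ?_⟩
    dsimp only
    rw [← hab x hx]
    tauto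
  · refine inP_of_candidates e (cand := fun p x => values p.1.1.1.size
      (restrict e f i j c p.1.1.1 p.1.1.2 p.1.2) p.1.1.2 (if b then 1 else 0) p.2 (2 * x + 1))
      (.values (t := fun p : (((FiniteStructure L × ℕ) × ℕ) × ℕ) × ℕ =>
        restrict e f i j c p.1.1.1.1 p.1.1.1.2 p.1.1.2) (.size hX) hop PTFun.var₁.fst.fst _
        .var₁ (((PTFun.const 2).mul .snd).add (.const 1))) fun X H u v hH hu hv hHu hHv => ?_
    obtain ⟨l, hl, h⟩ := exists_values (c := if b then 1 else 0) (h := fun x => if H x then 1 else 0)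
      (fun x hx y hy => restrict_lt e f i j c hu hv hx hy) hu (fun x => by split_ifs <;> omega)
      (if_neg hHu) fun x hx y hy => by
        have h1 := (iff_of_eq (hH.restrict f i j c hu hv hHu hHv hx hy)).trans (hb _ _)
        by_cases h2 : H x <;> by_cases h3 : H y <;> by_cases h4 : b <;>
          simp [h1, h2, h3, h4]
    exact ⟨l, hl, fun x hx => (h x hx).trans (by split_ifs <;> simp_all)⟩

end PolyTime

theorem mainTheorem2 (L : FirstOrder.Language.{0, 0}) [Finite L.Symbols]
    (A : Type*) [L.Structure A] (hA : Nat.card A = 2) :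
    ((∀ (k : ℕ) (f : L.Functions k),
        EssentiallyUnary (fun x : Fin k → A => FirstOrder.Language.Structure.funMap f x)) →
      (CSP L A).PolyTimeEquivalent (CSP (graphLanguage L) A)) ∧
    ((∃ (k : ℕ) (f : L.Functions k),
        ¬ EssentiallyUnary (fun x : Fin k → A => FirstOrder.Language.Structure.funMap f x)) →
      (CSP L A).InP) := by
  have : Finite A := Nat.finite_of_card_ne_zero (by omega)
  obtain ⟨e⟩ : Nonempty (A ≃ Prop) := Finite.card_eq.1 (by simp [hA])
  exact ⟨fun h => ⟨PolyTime.csp_reducible_graph A, PolyTime.graph_reducible_csp e h⟩,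
    fun ⟨_, _, hf⟩ => PolyTime.inP_of_not_essentiallyUnary e hf⟩
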